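/- Let $k$ be a field of characteristic $0$ and $[n]=\{1,\dots,n\}$. Let $\mathbf{sur}$ be the category of finite sets and surjections, $\mathbf{part}$ the category of finite sets and partially defined maps, and let $\mathbf{Shsur}$, $\mathbf{Shpart}$ be the categories of functors from $\mathbf{sur}^{op}$, resp. $\mathbf{part}^{op}$, to (unbounded, cohomologically graded) complexes of $k$-vector spaces; $\mathbf{Shpart}$ is identified with the category of modules over the operad $\mathbf{comm}_1$ of unital commutative algebras. For $M\in\mathbf{Shsur}$ let $B(M)\in\mathbf{Shpart}$ be given by $B(M)(X)=\bigoplus_{Y\subseteq X}M(Y)$, where for a partial map $f:Z\to X$ the map $f^*$ sends $s\in M(Y)$ to $\sum_{Y'}(f|_{Y'}:Y'\to Y)^*s$, the sum being over all subsets $Y'$ of the domain of $f$ with $f(Y')=Y$. For $T\in\mathbf{Shpart}$ let $H(T)$ be the complex of derivations relative to $\mathrm{ho}\mathbf{comm}\to\mathbf{comm}$ with values in $T$, given by values $\varphi_n$ on generators $m_n$, $n\ge 1$, of degree $1-n$ which vanish on shuffles. Explicitly, $$H(T)^j=\prod_{n\ge1}\{\varphi_n\in T([n])^{\,j+1-n}:\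 \varphi_n \text{ vanishes on all signed shuffles}\},$$ that is, for all total orders $s,t$ on the two parts of any decomposition of $[n]$ into two nonempty sets, $\sum_w\operatorname{sgn}(w)\,w^*\varphi_n=0$, where $w$ runs over the total orders on $[n]$ compatible with $s$ and $t$, $\operatorname{sgn}(w)$ is the sign of the permutation carrying the concatenation $st$ to $w$, and $w^*$ is the pullback along the bijection $[n]\to[n]$ sending an element to its position in $w$. The differential is $$(D\varphi)_{n}=d_T\varphi_{n}+(-1)^{j}\delta\varphi_{n-1}\ \ (\varphi_0:=0),\qquad \delta x=\sum_{i=0}^{n}(-1)^i\delta_i^*x\quad(x\in T([n-1])),$$ where $\delta_i:[n]\to[n-1]$ is, for $0<i<n$, the monotone surjection identifying $i$ and $i+1$, while $\delta_0$ is undefined at $1$ and sends $a+1$ to $a$, and $\delta_n$ is undefined at $n$ and sends $a$ to $a$. Write $H(M)$ for $H(B(M))$ when $M\in\mathbf{Shsur}$. For $M\in\mathbf{Shsur}$ let $G(M)\subseteq M([1])$ be the subcomplex of all $x$ with $f^*x=0$ for every $f:[n]\to[1]$ with $n>1$, and let $i:G(M)\to H(M)$ be the natural morphism of complexes sending $x$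 to the derivation with value $x\in M([1])\subset B(M)([1])$ on $m_1$ and $0$ on $m_n$, $n>1$. **Corollary 6.5.** In the derived category of $\mathbf{Shsur}$ (the localization of $\mathbf{Shsur}$ at the morphisms that are quasi-isomorphisms on every finite set), $H$ represents the right derived functor of $G$: the functor $H$, viewed with values in the derived category $D(k)$ of complexes of $k$-vector spaces, sends these morphisms to isomorphisms, and the induced functor from the derived category of $\mathbf{Shsur}$ to $D(k)$, together with the natural transformation induced by $i:G\to H$, is the total right derived functor of $G:\mathbf{Shsur}\to D(k)$, i.e. the left Kan extension of $G$ along the localization functor. -/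

import Mathlib

open CategoryTheory Opposite

universe u w

section Shuffles

/-- The signed sum, over all shuffles `w` of the words `s` and `t`, of the values `F w`. The sign of
a shuffle is that of the permutation taking `s ++ t` to `w`. -/
def shuffleSum {α : Type*} {V : Type*} [AddCommGroup V] :
    (List α → V) → List α → List α → V
  | F, [], t => F t
  | F, a :: s, [] => F (a :: s)
  | F, a :: s, b :: t =>
      shuffleSum (fun w => F (a :: w)) s (b :: t) +
        (-1 : ℤ) ^ (s.length + 1) • shuffleSum (fun w => F (b :: w)) (a :: s) t
termination_by _ s t => s.length + t.length

variable {α β V W : Type*} [AddCommGroup V] [AddCommGroup W]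

theorem shuffleSum_nil_left (F : List α → V) (t : List α) : shuffleSum F [] t = F t := by
  simp [shuffleSum]

theorem shuffleSum_cons_cons (F : List α → V) (a b : α) (s t : List α) :
    shuffleSum F (a :: s) (b :: t) = shuffleSum (fun w => F (a :: w)) s (b :: t) +
      (-1 : ℤ) ^ (s.length + 1) • shuffleSum (fun w => F (b :: w)) (a :: s) t := by
  rw [shuffleSum]

theorem shuffleSum_nil_right (F : List α → V) (s : List α) : shuffleSum F s [] = F s := by
  cases s <;> simp [shuffleSum]

theorem shuffleSum_congr (F G : List α → V) (s t : List α)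
    (h : ∀ w : List α, w.Perm (s ++ t) → F w = G w) : shuffleSum F s t = shuffleSum G s t := by
  induction hn : s.length + t.length generalizing F G s t with
  | zero =>
    cases s <;> cases t <;> simp_all [shuffleSum]
  | succ n ih =>
    match s, t with
    | [], t => simpa [shuffleSum] using h t (by simp)
    | a :: s, [] => simpa [shuffleSum] using h (a :: s) (by simp)
    | a :: s, b :: t =>
      rw [shuffleSum, shuffleSum]
      congr 1
      · exact ih _ _ _ _ (fun w hw => h _ (by simpa using hw))
          (by simp only [List.length_cons] at hn ⊢; omega)
      · congr 1
        exact ih _ _ _ _ (fun w hw => h _ ((hw.cons b).trans List.perm_middle.symm))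
          (by simp only [List.length_cons] at hn ⊢; omega)

theorem shuffleSum_zero (s t : List α) : shuffleSum (fun _ => (0 : V)) s t = 0 := by
  induction hn : s.length + t.length generalizing s t with
  | zero => cases s <;> cases t <;> simp_all [shuffleSum]
  | succ n ih =>
    match s, t with
    | [], t => simp [shuffleSum]
    | a :: s, [] => simp [shuffleSum]
    | a :: s, b :: t =>
      rw [shuffleSum, ih, ih, smul_zero, add_zero] <;>
      · simp only [List.length_cons] at hn ⊢; omega

theorem shuffleSum_add (F G : List α → V) (s t : List α) :
    shuffleSum (fun w => F w + G w) s t = shuffleSum F s t + shuffleSum G s t := by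
  induction hn : s.length + t.length generalizing F G s t with
  | zero => cases s <;> cases t <;> simp_all [shuffleSum]
  | succ n ih =>
    match s, t with
    | [], t => simp [shuffleSum]
    | a :: s, [] => simp [shuffleSum]
    | a :: s, b :: t =>
      rw [shuffleSum, shuffleSum, shuffleSum, ih, ih, smul_add]
      · abel
      all_goals simp only [List.length_cons] at hn ⊢; omega

theorem map_shuffleSum {Φ : Type*} [FunLike Φ V W] [AddMonoidHomClass Φ V W] (φ : Φ)
    (F : List α → V) (s t : List α) :
    φ (shuffleSum F s t) = shuffleSum (fun w => φ (F w)) s t := by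
  induction hn : s.length + t.length generalizing F s t with
  | zero => cases s <;> cases t <;> simp_all [shuffleSum]
  | succ n ih =>
    match s, t with
    | [], t => simp [shuffleSum]
    | a :: s, [] => simp [shuffleSum]
    | a :: s, b :: t =>
      rw [shuffleSum, shuffleSum, map_add, map_zsmul, ih, ih]
      all_goals simp only [List.length_cons] at hn ⊢; omega

theorem shuffleSum_zsmul (c : ℤ) (F : List α → V) (s t : List α) :
    shuffleSum (fun w => c • F w) s t = c • shuffleSum F s t :=
  (map_shuffleSum (DistribSMul.toAddMonoidHom V c) F s t).symm

theorem shuffleSum_neg (F : List α → V) (s t : List α) :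
    shuffleSum (fun w => -F w) s t = -shuffleSum F s t :=
  (map_shuffleSum (-AddMonoidHom.id V) F s t).symm

theorem shuffleSum_sub (F G : List α → V) (s t : List α) :
    shuffleSum (fun w => F w - G w) s t = shuffleSum F s t - shuffleSum G s t := by
  simp only [sub_eq_add_neg, shuffleSum_add, shuffleSum_neg]

theorem shuffleSum_map (f : α → β) (F : List β → V) (s t : List α) :
    shuffleSum F (s.map f) (t.map f) = shuffleSum (fun w => F (w.map f)) s t := by
  induction hn : s.length + t.length generalizing F s t with
  | zero => cases s <;> cases t <;> simp_all [shuffleSum]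
  | succ n ih =>
    match s, t with
    | [], t => simp [shuffleSum]
    | a :: s, [] => simp [shuffleSum]
    | a :: s, b :: t =>
      have h1 := ih (fun w => F (f a :: w)) s (b :: t)
        (by simp only [List.length_cons] at hn ⊢; omega)
      have h2 := ih (fun w => F (f b :: w)) (a :: s) t
        (by simp only [List.length_cons] at hn ⊢; omega)
      simp only [List.map_cons] at h1 h2 ⊢
      rw [shuffleSum_cons_cons, shuffleSum_cons_cons, h1, h2, List.length_map]
      rfl

theorem shuffleSum_snoc (F : List α → V) (a b : α) (s t : List α) :
    shuffleSum F (s ++ [a]) (t ++ [b]) =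
      shuffleSum (fun w => F (w ++ [b])) (s ++ [a]) t +
        (-1 : ℤ) ^ (t.length + 1) • shuffleSum (fun w => F (w ++ [a])) s (t ++ [b]) := by
  induction hn : s.length + t.length generalizing F s t with
  | zero => cases s <;> cases t <;> simp_all [shuffleSum]
  | succ n ih =>
    match s, t with
    | [], [] => simp [shuffleSum]
    | [], d :: t =>
      have h2 := ih (fun w => F (d :: w)) [] t
        (by simp only [List.length_cons] at hn ⊢; omega)
      simp only [List.nil_append, List.cons_append] at h2 ⊢
      rw [shuffleSum_cons_cons, h2]
      simp [shuffleSum, pow_succ]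
      abel
    | c :: s, [] =>
      have h2 := ih (fun w => F (c :: w)) s []
        (by simp only [List.length_cons] at hn ⊢; omega)
      simp only [List.nil_append, List.cons_append] at h2 ⊢
      rw [shuffleSum_cons_cons, h2]
      simp [shuffleSum, shuffleSum_nil_right, pow_succ]
      abel
    | c :: s, d :: t =>
      have h1 := ih (fun w => F (c :: w)) s (d :: t)
        (by simp only [List.length_cons] at hn ⊢; omega)
      have h2 := ih (fun w => F (d :: w)) (c :: s) t
        (by simp only [List.length_cons] at hn ⊢; omega)
      simp only [List.cons_append] at h1 h2 ⊢
      rw [shuffleSum, h1, h2, shuffleSum, shuffleSum]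
      simp only [smul_add, List.length_cons, List.length_append, List.length_nil, pow_succ,
        smul_smul]
      have e1 : (-1 : ℤ) ^ s.length * -1 * -1 * ((-1) ^ t.length * -1) =
        (-1) ^ t.length * -1 * -1 * ((-1) ^ s.length * -1) := by ring
      simp only [List.cons_append, mul_neg, mul_one,
        neg_neg, neg_smul] at *
      rw [mul_comm ((-1 : ℤ) ^ s.length)]
      abel

variable [SemilatticeSup α]

/-- The alternating sum of the values of `F` on the words obtained from a given word by
multiplying two neighbouring letters (the product of letters is written `⊔`). -/
def mergeSum : (List α → V) → List α → V
  | _, [] => 0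
  | _, [_] => 0
  | F, a :: b :: w => F ((a ⊔ b) :: w) - mergeSum (fun w' => F (a :: w')) (b :: w)

theorem mergeSum_congr (F G : List α → V) (s : List α)
    (h : ∀ w : List α, w.length + 1 = s.length → w ≠ [] → F w = G w) :
    mergeSum F s = mergeSum G s := by
  induction s generalizing F G with
  | nil => rfl
  | cons a s ih =>
    cases s with
    | nil => rfl
    | cons b s =>
      rw [mergeSum, mergeSum, h _ (by simp) (by simp), ih]
      intro w hw _
      exact h _ (by simpa using hw) (by simp)

theorem mergeSum_zero (s : List α) : mergeSum (fun _ => (0 : V)) s = 0 := by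
  induction s with
  | nil => rfl
  | cons a s ih => cases s with
    | nil => rfl
    | cons b s => rw [mergeSum, ih, sub_zero]

theorem mergeSum_add (F G : List α → V) (s : List α) :
    mergeSum (fun w => F w + G w) s = mergeSum F s + mergeSum G s := by
  induction s generalizing F G with
  | nil => simp [mergeSum]
  | cons a s ih =>
    cases s with
    | nil => simp [mergeSum]
    | cons b s => rw [mergeSum, mergeSum, mergeSum, ih]; abel

theorem map_mergeSum (φ : V →+ W) (F : List α → V) (s : List α) :
    φ (mergeSum F s) = mergeSum (fun w => φ (F w)) s := by
  induction s generalizing F with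
  | nil => simp [mergeSum]
  | cons a s ih =>
    cases s with
    | nil => simp [mergeSum]
    | cons b s => rw [mergeSum, mergeSum, map_sub, ih]

theorem mergeSum_zsmul (c : ℤ) (F : List α → V) (s : List α) :
    mergeSum (fun w => c • F w) s = c • mergeSum F s :=
  (map_mergeSum (DistribSMul.toAddMonoidHom V c) F s).symm

theorem mergeSum_cons_shuffle_left (F : List α → V) (a b : α) (s t : List α) :
    mergeSum (fun w => shuffleSum F w (b :: t)) (a :: s) =
      (match s with
        | [] => 0
        | c :: s' => shuffleSum (fun w => F ((a ⊔ c) :: w)) s' (b :: t)) -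
      mergeSum (fun w => shuffleSum (fun w' => F (a :: w')) w (b :: t)) s +
      (-1 : ℤ) ^ s.length •
        mergeSum (fun w => shuffleSum (fun w' => F (b :: w')) w t) (a :: s) := by
  cases s with
  | nil => simp [mergeSum]
  | cons c s =>
    rw [mergeSum, mergeSum, shuffleSum]
    have : mergeSum (fun w => shuffleSum F (a :: w) (b :: t)) (c :: s) =
        mergeSum (fun w => shuffleSum (fun w' => F (a :: w')) w (b :: t) +
          (-1 : ℤ) ^ (s.length + 1) •
            shuffleSum (fun w' => F (b :: w')) (a :: w) t) (c :: s) := by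
      apply mergeSum_congr
      intro w hw _
      rw [shuffleSum]
      simp only [List.length_cons, Nat.add_right_cancel_iff] at hw
      rw [hw]
    rw [this, mergeSum_add, mergeSum_zsmul]
    simp only [List.length_cons, smul_sub]
    abel

theorem mergeSum_cons_shuffle_right (F : List α → V) (a b : α) (s t : List α) :
    mergeSum (fun w => shuffleSum F (a :: s) w) (b :: t) =
      mergeSum (fun w => shuffleSum (fun w' => F (a :: w')) s w) (b :: t) +
      (-1 : ℤ) ^ (s.length + 1) • (match t with
        | [] => 0
        | d :: t' => shuffleSum (fun w => F ((b ⊔ d) :: w)) (a :: s) t') -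
      (-1 : ℤ) ^ (s.length + 1) •
        mergeSum (fun w => shuffleSum (fun w' => F (b :: w')) (a :: s) w) t := by
  cases t with
  | nil => simp [mergeSum]
  | cons d t =>
    rw [mergeSum, mergeSum, shuffleSum_cons_cons]
    simp only [shuffleSum_cons_cons, mergeSum_add, mergeSum_zsmul]
    abel

theorem shuffleSum_mergeSum_cons_left (F : List α → V) (a b : α) (s t : List α) :
    shuffleSum (fun w => mergeSum F (a :: w)) s (b :: t) =
      (match s with
        | [] => 0
        | c :: s' => shuffleSum (fun w => F ((a ⊔ c) :: w)) s' (b :: t)) +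
      (-1 : ℤ) ^ s.length • shuffleSum (fun w => F ((a ⊔ b) :: w)) s t -
      shuffleSum (mergeSum fun w => F (a :: w)) s (b :: t) := by
  cases s with
  | nil => simp [shuffleSum_nil_left, mergeSum]
  | cons c s =>
    rw [shuffleSum_cons_cons, shuffleSum_cons_cons (mergeSum fun w => F (a :: w))]
    simp only [mergeSum, shuffleSum_sub, smul_sub, List.length_cons]
    abel

theorem shuffleSum_mergeSum_cons_right (F : List α → V) (a b : α) (s t : List α) :
    shuffleSum (fun w => mergeSum F (b :: w)) (a :: s) t =
      shuffleSum (fun w => F ((b ⊔ a) :: w)) s t +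
      (-1 : ℤ) ^ (s.length + 1) • (match t with
        | [] => 0
        | d :: t' => shuffleSum (fun w => F ((b ⊔ d) :: w)) (a :: s) t') -
      shuffleSum (mergeSum fun w => F (b :: w)) (a :: s) t := by
  cases t with
  | nil => simp [shuffleSum_nil_right, mergeSum]
  | cons d t =>
    rw [shuffleSum_cons_cons, shuffleSum_cons_cons (mergeSum fun w => F (b :: w))]
    simp only [mergeSum, shuffleSum_sub, smul_sub]
    abel

theorem shuffleSum_mergeSum (F : List α → V) (s t : List α) :
    shuffleSum (mergeSum F) s t =
      mergeSum (fun w => shuffleSum F w t) s +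
        (-1 : ℤ) ^ s.length • mergeSum (fun w => shuffleSum F s w) t := by
  induction hn : s.length + t.length generalizing F s t with
  | zero => cases s <;> cases t <;> simp_all [shuffleSum, mergeSum]
  | succ n ih =>
    match s, t with
    | [], t => simp [shuffleSum, mergeSum]
    | a :: s, [] => simp [shuffleSum_nil_right, mergeSum]
    | a :: s, b :: t =>
      have h1 := ih (fun w => F (a :: w)) s (b :: t)
        (by simp only [List.length_cons] at hn ⊢; omega)
      have h2 := ih (fun w => F (b :: w)) (a :: s) t
        (by simp only [List.length_cons] at hn ⊢; omega)
      rw [shuffleSum_cons_cons, shuffleSum_mergeSum_cons_left, shuffleSum_mergeSum_cons_right,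
        h1, h2, mergeSum_cons_shuffle_left, mergeSum_cons_shuffle_right, sup_comm b a]
      simp only [List.length_cons, smul_add, smul_sub, smul_smul, pow_succ, mul_neg, mul_one,
        neg_mul, neg_smul, neg_neg, smul_neg, ← mul_pow, one_pow, one_smul]
      abel


/-- The Hochschild type differential on functions of words of length `n`. -/
def hochschildSum (n : ℕ) (F : List α → V) (w : List α) : V :=
  F w.tail - mergeSum F w + (-1 : ℤ) ^ (n + 1) • F w.dropLast

theorem shuffleSum_hochschildSum (n : ℕ) (F : List α → V)
    (hF : ∀ s t : List α, s ≠ [] → t ≠ [] → s.length + t.length = n → shuffleSum F s t = 0)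
    (s t : List α) (hs : s ≠ []) (ht : t ≠ []) (hn : s.length + t.length = n + 1) :
    shuffleSum (hochschildSum n F) s t = 0 := by
  have h0 : shuffleSum (mergeSum F) s t = 0 := by
    rw [shuffleSum_mergeSum, mergeSum_congr (fun w => shuffleSum F w t) (fun _ => 0),
      mergeSum_congr (fun w => shuffleSum F s w) (fun _ => 0), mergeSum_zero, mergeSum_zero]
    · simp
    · intro w hw hw'
      exact hF _ _ hs hw' (by omega)
    · intro w hw hw'
      exact hF _ _ hw' ht (by omega)
  have h1 : shuffleSum (fun w => F w.tail) s t =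
      (if s.length = 1 then F t else 0) +
        (if t.length = 1 then (-1 : ℤ) ^ s.length • F s else 0) := by
    match s, t with
    | a :: s, b :: t =>
      rw [shuffleSum_cons_cons]
      simp only [List.tail_cons]
      congr 1
      · cases s with
        | nil => simp [shuffleSum_nil_left]
        | cons c s => rw [hF _ _ (by simp) (by simp) (by simp at hn ⊢; omega)]; simp
      · cases t with
        | nil => simp [shuffleSum_nil_right]
        | cons c t => rw [hF _ _ (by simp) (by simp) (by simp at hn ⊢; omega)]; simp
  have h2 : shuffleSum (fun w => F w.dropLast) s t =
      (if t.length = 1 then F s else 0) +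
        (if s.length = 1 then (-1 : ℤ) ^ t.length • F t else 0) := by
    obtain ⟨s, a, rfl⟩ := s.eq_nil_or_concat.resolve_left hs
    obtain ⟨t, b, rfl⟩ := t.eq_nil_or_concat.resolve_left ht
    rw [List.concat_eq_append, List.concat_eq_append] at *
    rw [shuffleSum_snoc]
    simp only [List.dropLast_concat]
    congr 1
    · rcases eq_or_ne t [] with rfl | h
      · simp [shuffleSum_nil_right]
      · rw [hF _ _ (by simp) h (by simp at hn ⊢; omega)]; simp [h]
    · rcases eq_or_ne s [] with rfl | h
      · simp [shuffleSum_nil_left]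
      · rw [hF _ _ h (by simp) (by simp at hn ⊢; omega)]; simp [h]
  have h3 : shuffleSum (hochschildSum n F) s t = shuffleSum (fun w => F w.tail) s t -
      shuffleSum (mergeSum F) s t +
        (-1 : ℤ) ^ (n + 1) • shuffleSum (fun w => F w.dropLast) s t := by
    rw [← shuffleSum_zsmul, ← shuffleSum_sub, ← shuffleSum_add]
    rfl
  rw [h3, h0, h1, h2, ← hn]
  by_cases hs1 : s.length = 1 <;> by_cases ht1 : t.length = 1
  · simp [hs1, ht1]
  · simp [hs1, ht1, smul_smul, pow_add, ← mul_pow]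
  · simp [hs1, ht1, pow_add]
  · simp [hs1, ht1]

/-- Multiply the letters number `i` and `i + 1` of a word. -/
def mergeAt : ℕ → List α → List α
  | 0, a :: b :: w => (a ⊔ b) :: w
  | i + 1, a :: w => a :: mergeAt i w
  | _, w => w

theorem mergeSum_eq_sum (F : List α → V) (n : ℕ) (w : List α) (hw : w.length = n + 1) :
    mergeSum F w = ∑ i ∈ Finset.range n, (-1 : ℤ) ^ i • F (mergeAt i w) := by
  induction n generalizing F w with
  | zero =>
    obtain ⟨a, rfl⟩ := List.length_eq_one_iff.1 hw
    simp [mergeSum]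
  | succ n ih =>
    match w, hw with
    | a :: b :: w, hw =>
      rw [mergeSum, ih _ _ (by simpa using hw), Finset.sum_range_succ', sub_eq_add_neg,
        add_comm, ← Finset.sum_neg_distrib]
      simp [mergeAt, pow_succ]

theorem pairwise_disjoint_mergeAt {X : Type*} (i : ℕ) (w : List (Set X))
    (hw : w.Pairwise Disjoint) : (mergeAt i w).Pairwise Disjoint := by
  have key : ∀ (i : ℕ) (w : List (Set X)) (S : Set X), (∀ T ∈ w, Disjoint S T) →
      ∀ T ∈ mergeAt i w, Disjoint S T := by
    intro i w S
    induction i generalizing w with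
    | zero =>
      match w with
      | [] => simp [mergeAt]
      | [a] => simp [mergeAt]
      | a :: b :: w => simp +contextual [mergeAt]
    | succ i ih =>
      match w with
      | [] => simp [mergeAt]
      | a :: w =>
        intro h
        simp only [mergeAt, List.forall_mem_cons] at h ⊢
        exact ⟨h.1, ih w h.2⟩
  induction i generalizing w with
  | zero =>
    match w with
    | [] => simp [mergeAt]
    | [a] => simp [mergeAt]
    | a :: b :: w =>
      simp only [mergeAt, List.pairwise_cons, List.forall_mem_cons] at hw ⊢
      exact ⟨fun T hT => Set.disjoint_union_left.2 ⟨hw.1.2 T hT, hw.2.1 T hT⟩, hw.2.2⟩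
  | succ i ih =>
    match w with
    | [] => simp [mergeAt]
    | a :: w =>
      simp only [mergeAt, List.pairwise_cons] at hw ⊢
      exact ⟨key i w a hw.1, ih w hw.2⟩

open Classical in
theorem findIdx_mergeAt {X : Type*} (x : X) (i : ℕ) (w : List (Set X)) (hi : i + 1 < w.length) :
    (mergeAt i w).findIdx (fun S => decide (x ∈ S)) =
      if w.findIdx (fun S => decide (x ∈ S)) ≤ i then w.findIdx (fun S => decide (x ∈ S))
      else w.findIdx (fun S => decide (x ∈ S)) - 1 := by
  induction i generalizing w with
  | zero =>
    match w, hi with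
    | a :: b :: w, _ =>
      by_cases ha : x ∈ a <;> by_cases hb : x ∈ b <;>
        simp [mergeAt, List.findIdx_cons, ha, hb]
  | succ i ih =>
    match w, hi with
    | a :: w, hi =>
      have := ih w (by simpa using hi)
      by_cases ha : x ∈ a
      · simp [mergeAt, List.findIdx_cons, ha]
      · simp only [mergeAt, List.findIdx_cons, ha, decide_false, cond_false, this]
        split_ifs <;> omega

end Shuffles

/-- The category of finite sets and surjective maps. -/
structure Sur : Type 1 where
  of ::
  carrier : Type
  [finite : Finite carrier]

instance : CoeSort Sur Type := ⟨Sur.carrier⟩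

instance (X : Sur) : Finite X := X.finite

instance : Category Sur where
  Hom X Y := {f : X → Y // Function.Surjective f}
  id _ := ⟨id, Function.surjective_id⟩
  comp f g := ⟨g.1 ∘ f.1, g.2.comp f.2⟩

/-- The category of finite sets and partially defined maps;
`f x = none` means that `f` is not defined at `x`. -/
structure FinPart : Type 1 where
  of ::
  carrier : Type
  [finite : Finite carrier]

instance : CoeSort FinPart Type := ⟨FinPart.carrier⟩

instance (X : FinPart) : Finite X := X.finite

instance : Category FinPart where
  Hom X Y := X → Option Y
  id _ := some
  comp f g := fun x => (f x).bind g
  id_comp _ := rfl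
  comp_id f := funext fun x => Option.bind_fun_some (f x)
  assoc f g h := funext fun x => Option.bind_assoc (f x) g h

theorem FinPart.comp_apply {X Y Z : FinPart} (f : X ⟶ Y) (g : Y ⟶ Z) (x : X) :
    (f ≫ g) x = (f x).bind g := rfl

/-- Contravariant functors from finite sets and surjections to complexes of `k`-vector spaces. -/
abbrev Shsur (k : Type u) [Field k] := Surᵒᵖ ⥤ CochainComplex (ModuleCat.{u} k) ℤ

/-- Contravariant functors from finite sets and partial maps to complexes of `k`-vector spaces
(equivalently, modules over the operad of unital commutative algebras). -/
abbrev Shpart (k : Type u) [Field k] := FinPartᵒᵖ ⥤ CochainComplex (ModuleCat.{u} k) ℤ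

namespace FinPart

/-- The finite set of `n` elements. -/
abbrev fin (n : ℕ) : FinPart := .of (Fin n)

/-- A word `w` in the letters `Fin n` gives the partial map sending a letter to its (first) position
in `w`. If `w` contains every letter exactly once, this is a bijection, and pulling back an
operation `x(y₁, …, yₙ)` along it gives the operation `x(y_{w₁}, …, y_{wₙ})`. -/
def position {n : ℕ} (w : List (Fin n)) : fin n ⟶ fin n :=
  fun a => if h : w.idxOf a < n then some (⟨w.idxOf a, h⟩ : Fin n) else none

/-- The partial maps `[n + 1] ⇀ [n]`, `0 ≤ i ≤ n + 1` along which the terms of the Hochschild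
differential are pulled back. With elements numbered from `1`: for `i = 0` it is undefined at `1`
and sends `j + 1` to `j`; for `i = n + 1` it is undefined at `n + 1` and
sends `j` to `j`; for the other `i` it is the monotone surjection that identifies `i` and `i + 1`. -/
def face (n i : ℕ) : fin (n + 1) ⟶ fin n :=
  fun j : Fin (n + 1) =>
    if (j : ℕ) < i then (if h : (j : ℕ) < n then some (⟨j, h⟩ : Fin n) else none)
    else (if h : 0 < (j : ℕ) then some (⟨j - 1, by omega⟩ : Fin n) else none)

theorem face_comp_face (n a b : ℕ) (hab : a ≤ b) (hb : b ≤ n + 1) :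
    face (n + 1) a ≫ face n b = face (n + 1) (b + 1) ≫ face n a := by
  funext j
  obtain ⟨j, hj⟩ : Fin (n + 2) := j
  change (face (n + 1) a ⟨j, hj⟩).bind _ = (face (n + 1) (b + 1) ⟨j, hj⟩).bind _
  simp only [face]
  split_ifs <;> simp [face] <;> grind

end FinPart

namespace FinPart

variable {k : Type u} [Field k] (F : FinPartᵒᵖ ⥤ ModuleCat.{u} k)

/-- The elements of `F [n]` which vanish on shuffles: for all ways of splitting `[n]` into two
nonempty sets and all total orders `s`, `t` on these sets, the signed sum over all total orders
`w` of `[n]` compatible with `s` and `t` of the images of the element under the permutations `w`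
vanishes. -/
def harrison (n : ℕ) : Submodule k (F.obj (op (fin n))) where
  carrier := {x | ∀ s t : List (Fin n), s ≠ [] → t ≠ [] → (s ++ t).Perm (List.finRange n) →
    shuffleSum (fun w => (F.map (position w).op).hom x) s t = 0}
  zero_mem' := by
    intro s t _ _ _
    simp only [map_zero, shuffleSum_zero]
  add_mem' := by
    intro x y hx hy s t hs ht hst
    simp only [map_add, shuffleSum_add, hx s t hs ht hst, hy s t hs ht hst, add_zero]
  smul_mem' := by
    intro c x hx s t hs ht hst
    have := map_shuffleSum (LinearMap.lsmul k _ c)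
      (fun w => (F.map (position w).op).hom x) s t
    rw [hx s t hs ht hst, map_zero] at this
    simp only [map_smul]
    exact this.symm

/-- The Hochschild differential `F [n] → F [n + 1]`. -/
def hochschild (n : ℕ) : F.obj (op (fin n)) →ₗ[k] F.obj (op (fin (n + 1))) :=
  ∑ i ∈ Finset.range (n + 2), (-1 : ℤ) ^ i • (F.map (face n i).op).hom

theorem hochschild_apply (n : ℕ) (x : F.obj (op (fin n))) :
    hochschild F n x =
      ∑ i ∈ Finset.range (n + 2), (-1 : ℤ) ^ i • (F.map (face n i).op).hom x := by
  simp [hochschild, LinearMap.sum_apply]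

theorem sum_alternating_eq_zero {V : Type*} [AddCommGroup V] (n : ℕ) (g : ℕ → ℕ → V)
    (hg : ∀ a b, a ≤ b → b < n → g a b = g (b + 1) a) :
    ∑ a ∈ Finset.range (n + 1), ∑ b ∈ Finset.range n, (-1 : ℤ) ^ (a + b) • g a b = 0 := by
  rw [← Finset.sum_product']
  refine Finset.sum_involution
    (fun p _ => if p.1 ≤ p.2 then (p.2 + 1, p.1) else (p.2, p.1 - 1)) ?_ ?_ ?_ ?_
  · rintro ⟨a, b⟩ hp
    simp only [Finset.mem_product, Finset.mem_range] at hp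
    dsimp only
    split_ifs with h
    · rw [← hg a b h hp.2, ← add_smul]
      have : (-1 : ℤ) ^ (a + b) + (-1) ^ (b + 1 + a) = 0 := by ring
      rw [this, zero_smul]
    · obtain ⟨a, rfl⟩ : ∃ c, a = c + 1 := ⟨a - 1, by omega⟩
      simp only [Nat.add_sub_cancel]
      rw [hg b a (by omega) (by omega), ← add_smul]
      have : (-1 : ℤ) ^ (a + 1 + b) + (-1) ^ (b + a) = 0 := by ring
      rw [this, zero_smul]
  · rintro ⟨a, b⟩ hp _
    dsimp only
    split_ifs with h <;> simp [Prod.ext_iff] <;> omega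
  · rintro ⟨a, b⟩ hp
    simp only [Finset.mem_product, Finset.mem_range] at hp ⊢
    split_ifs with h <;> dsimp only <;> omega
  · rintro ⟨a, b⟩ hp
    simp only [Finset.mem_product, Finset.mem_range] at hp
    dsimp only
    split_ifs with h h' h' <;> simp [Prod.ext_iff] at * <;> omega

theorem hochschild_hochschild (n : ℕ) (x : F.obj (op (fin n))) :
    hochschild F (n + 1) (hochschild F n x) = 0 := by
  have := sum_alternating_eq_zero (n + 2)
    (fun a b => (F.map (face (n + 1) a ≫ face n b).op).hom x) (by
      intro a b hab hb
      rw [face_comp_face n a b hab (by omega)])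
  rw [← this, hochschild_apply]
  refine Finset.sum_congr rfl fun a _ => ?_
  rw [hochschild_apply, map_sum, Finset.smul_sum]
  refine Finset.sum_congr rfl fun b _ => ?_
  rw [map_zsmul, smul_smul, pow_add, op_comp, F.map_comp]
  rfl

open Classical in
/-- The partial map `X ⇀ [n]` sending an element of the `i`-th set of the list `W`, but of none of
the previous ones, to `i`. -/
noncomputable def setPosition (X : FinPart) (n : ℕ) (W : List (Set X)) : X ⟶ fin n :=
  fun a => if h : W.findIdx (fun S => decide (a ∈ S)) < n then
    some (⟨W.findIdx (fun S => decide (a ∈ S)), h⟩ : Fin n) else none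

theorem setPosition_map (X : FinPart) (n : ℕ) (S : Fin n → Set X)
    (hS : ∀ i j, i ≠ j → Disjoint (S i) (S j)) (w : List (Fin n)) (hw : w.length = n) :
    setPosition X n (w.map S) =
      setPosition X n ((List.finRange n).map S) ≫ position w := by
  classical
  have key : ∀ (w : List (Fin n)) (a : X) (i : Fin n), a ∈ S i →
      (w.map S).findIdx (fun S => decide (a ∈ S)) = w.idxOf i := by
    intro w a i hi
    rw [List.findIdx_map, List.idxOf]
    congr 1
    funext j
    by_cases hij : j = i
    · subst hij; simp [hi]
    · have : a ∉ S j := fun h => Set.disjoint_left.1 (hS j i hij) h hi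
      simp [this, hij]
  have key' : ∀ (w : List (Fin n)) (a : X), (∀ i, a ∉ S i) →
      (w.map S).findIdx (fun S => decide (a ∈ S)) = w.length := by
    intro w a ha
    rw [List.findIdx_map]
    rw [List.findIdx_eq_length]
    intro i _
    simp [ha]
  funext a
  rw [comp_apply]
  by_cases ha : ∃ i, a ∈ S i
  · obtain ⟨i, hi⟩ := ha
    have h1 : setPosition X n ((List.finRange n).map S) a = some i := by
      simp [setPosition, key _ a i hi]
    rw [h1, Option.bind_some]
    simp only [setPosition, key _ a i hi, position]
  · push Not at ha
    simp [setPosition, key' _ a ha, hw]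

open Classical in
/-- The value of an element of `F [n]` on a list of disjoint subsets of `X`, viewed as
monomials in the variables `X`. -/
noncomputable def evalSets (X : FinPart) (n : ℕ) (x : F.obj (op (fin n))) (W : List (Set X)) :
    F.obj (op X) :=
  if W.Pairwise Disjoint then (F.map (setPosition X n W).op).hom x else 0

theorem shuffleSum_evalSets (X : FinPart) (n : ℕ) (x : F.obj (op (fin n)))
    (hx : x ∈ harrison F n) (U V : List (Set X)) (hU : U ≠ []) (hV : V ≠ [])
    (hn : U.length + V.length = n) : shuffleSum (evalSets F X n x) U V = 0 := by
  by_cases hd : (U ++ V).Pairwise Disjoint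
  · obtain ⟨S, hS⟩ : ∃ S : Fin n → Set X, U ++ V = (List.finRange n).map S := by
      refine ⟨fun i => (U ++ V)[i]'(by simp only [List.length_append, hn]; exact i.2), ?_⟩
      apply List.ext_getElem
      · simp [hn]
      · intro i h1 h2
        simp
    have hU' : U = ((List.finRange n).take U.length).map S := by
      rw [List.map_take, ← hS, List.take_left]
    have hV' : V = ((List.finRange n).drop U.length).map S := by
      rw [List.map_drop, ← hS, List.drop_left]
    have hSd : ∀ i j, i ≠ j → Disjoint (S i) (S j) := by
      rw [hS, List.pairwise_map] at hd
      intro i j hij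
      have : Std.Symm (fun a b : Fin n => Disjoint (S a) (S b)) := ⟨fun _ _ h => h.symm⟩
      exact hd.forall (List.mem_finRange i) (List.mem_finRange j) hij
    generalize U.length = p at hU' hV'
    have hs := hx ((List.finRange n).take p) ((List.finRange n).drop p)
      (by rintro h; rw [h] at hU'; exact hU hU') (by rintro h; rw [h] at hV'; exact hV hV')
      (by rw [List.take_append_drop])
    rw [hU', hV', shuffleSum_map]
    rw [shuffleSum_congr _ (fun w => (F.map (setPosition X n ((List.finRange n).map S)).op).hom
      ((F.map (position w).op).hom x)), ← map_shuffleSum, hs, map_zero]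
    intro w hw
    rw [List.take_append_drop] at hw
    have hw' : (w.map S).Pairwise Disjoint := by
      rw [hS] at hd
      exact (hw.map S).symm.pairwise hd (fun h => h.symm)
    rw [evalSets, if_pos hw', setPosition_map X n S hSd w (by simpa using hw.length_eq),
      op_comp, F.map_comp]
    rfl
  · rw [shuffleSum_congr _ (fun _ => 0), shuffleSum_zero]
    intro w hw
    rw [evalSets, if_neg]
    exact fun h => hd (hw.pairwise h (fun h => h.symm))

theorem map_position_hochschild (n : ℕ) (x : F.obj (op (fin n))) (w : List (Fin (n + 1)))
    (hw : w.Perm (List.finRange (n + 1))) :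
    (F.map (position w).op).hom (hochschild F n x) =
      hochschildSum n (evalSets F (fin (n + 1)) n x) (w.map fun a => ({a} : Set (Fin (n + 1)))) := by
  classical
  have hlen : w.length = n + 1 := by simpa using hw.length_eq
  have hnd : w.Nodup := hw.nodup_iff.2 (List.nodup_finRange _)
  set W : List (Set (Fin (n + 1))) := w.map fun a => ({a} : Set (Fin (n + 1))) with hW
  have hWd : W.Pairwise Disjoint := by
    rw [hW, List.pairwise_map]
    exact hnd.imp (fun h => by simpa using h)
  have hWlen : W.length = n + 1 := by simp [hW, hlen]
  have hidx : ∀ a : Fin (n + 1), W.findIdx (fun S => decide (a ∈ S)) = w.idxOf a := by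
    intro a
    rw [hW, List.findIdx_map, List.idxOf]
    congr 1
    funext j
    simp [eq_comm, beq_eq_decide]
  have hlt : ∀ a : Fin (n + 1), w.idxOf a < n + 1 := by
    intro a
    exact (List.idxOf_lt_length_iff.2 (hw.mem_iff.2 (List.mem_finRange a))).trans_eq hlen
  have hpos : ∀ a, position w a = some ⟨w.idxOf a, hlt a⟩ := fun a => by
    simp [position, hlt a]
  have e1 : position w ≫ face n 0 = setPosition (fin (n + 1)) n W.tail := by
    funext a
    rw [comp_apply, hpos, Option.bind_some]
    have h := hidx a
    have hl := hlt a
    cases hWc : W with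
    | nil => simp [hWc] at hWlen
    | cons S W' =>
      rw [hWc] at hWd hWlen h
      have hWlen' : W'.length = n := by simpa using hWlen
      rw [List.findIdx_cons] at h
      by_cases ha : a ∈ S
      · have h0 : W'.findIdx (fun S => decide (a ∈ S)) = n := by
          refine (List.findIdx_eq_length.2 ?_).trans hWlen'
          intro T hT
          simpa using Set.disjoint_left.1 ((List.pairwise_cons.1 hWd).1 T hT) ha
        simp only [ha, decide_true, cond_true] at h
        simp [setPosition, face, h0, ← h]
      · simp only [ha, decide_false, cond_false] at h
        have hl' : W'.findIdx (fun S => decide (a ∈ S)) < n := by omega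
        simp [setPosition, face, ← h, hl']
  have e2 : position w ≫ face n (n + 1) = setPosition (fin (n + 1)) n W.dropLast := by
    funext a
    rw [comp_apply, hpos, Option.bind_some]
    have h := hidx a
    have hl := hlt a
    obtain ⟨W', S, hWc⟩ := W.eq_nil_or_concat.resolve_left (by rintro h; simp [h] at hWlen)
    rw [List.concat_eq_append] at hWc
    rw [hWc] at hWlen h ⊢
    have hWlen' : W'.length = n := by simpa using hWlen
    rw [List.findIdx_append, hWlen'] at h
    have hle : W'.findIdx (fun S => decide (a ∈ S)) ≤ n :=
      List.findIdx_le_length.trans_eq hWlen'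
    simp only [setPosition, face, List.dropLast_concat]
    grind
  have e3 : ∀ i < n, position w ≫ face n (i + 1) =
      setPosition (fin (n + 1)) n (mergeAt i W) := by
    intro i hi
    funext a
    rw [comp_apply, hpos, Option.bind_some]
    simp only [setPosition, findIdx_mergeAt a i W (by omega), hidx, face]
    have := hlt a
    grind
  have hF : ∀ i, (F.map (position w).op).hom ((F.map (face n i).op).hom x) =
      (F.map (position w ≫ face n i).op).hom x := by
    intro i
    rw [op_comp, F.map_comp]
    rfl
  rw [hochschild_apply, map_sum, Finset.sum_range_succ, Finset.sum_range_succ']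
  simp only [map_zsmul, hF]
  rw [e1, e2, hochschildSum, mergeSum_eq_sum _ n W hWlen]
  simp only [evalSets]
  rw [if_pos (hWd.sublist (List.tail_sublist _)), if_pos (hWd.sublist (List.dropLast_sublist _))]
  rw [add_comm (∑ k ∈ _, _), pow_zero, one_smul, sub_eq_add_neg, ← Finset.sum_neg_distrib]
  congr 2
  refine Finset.sum_congr rfl fun i hi => ?_
  rw [e3 i (Finset.mem_range.1 hi), if_pos (pairwise_disjoint_mergeAt i W hWd), pow_succ]
  simp

theorem hochschild_mem_harrison (n : ℕ) (x : F.obj (op (fin n))) (hx : x ∈ harrison F n) :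
    hochschild F n x ∈ harrison F (n + 1) := by
  intro s t hs ht hst
  have hlen : s.length + t.length = n + 1 := by simpa using hst.length_eq
  rw [shuffleSum_congr _ (fun w => hochschildSum n (evalSets F (fin (n + 1)) n x)
    (w.map fun a => ({a} : Set (Fin (n + 1))))), ← shuffleSum_map]
  · exact shuffleSum_hochschildSum n _ (fun U V hU hV h => shuffleSum_evalSets F _ n x hx U V hU hV h)
      _ _ (by simpa using hs) (by simpa using ht) (by simpa using hlen)
  · intro w hw
    exact map_position_hochschild F n x w (hw.trans hst)

end FinPart

namespace FinPart

variable {k : Type u} [Field k] {F F' F'' : FinPartᵒᵖ ⥤ ModuleCat.{u} k}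

/-- The Hochschild differential on the elements vanishing on shuffles. -/
def harrisonDifferential (F : FinPartᵒᵖ ⥤ ModuleCat.{u} k) (n : ℕ) :
    harrison F n →ₗ[k] harrison F (n + 1) :=
  (hochschild F n).restrict (hochschild_mem_harrison F n)

/-- The map on elements vanishing on shuffles given by a natural transformation. -/
def harrisonMap (τ : F ⟶ F') (n : ℕ) : harrison F n →ₗ[k] harrison F' n :=
  (τ.app (op (fin n))).hom.restrict (by
    intro x hx s t hs ht hst
    have := map_shuffleSum (τ.app (op (fin n))).hom (fun w => (F.map (position w).op).hom x) s t
    rw [hx s t hs ht hst, map_zero] at this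
    rw [this]
    congr 1
    funext w
    exact (congr($(τ.naturality (position w).op).hom x)).symm)

theorem harrisonDifferential_comp (n : ℕ) (x : harrison F n) :
    harrisonDifferential F (n + 1) (harrisonDifferential F n x) = 0 :=
  Subtype.ext (hochschild_hochschild F n x.1)

theorem harrisonMap_differential (τ : F ⟶ F') (n : ℕ) (x : harrison F n) :
    harrisonMap τ (n + 1) (harrisonDifferential F n x) =
      harrisonDifferential F' n (harrisonMap τ n x) := by
  apply Subtype.ext
  change (τ.app _).hom (hochschild F n x.1) = hochschild F' n ((τ.app _).hom x.1)
  rw [hochschild_apply, hochschild_apply, map_sum]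
  refine Finset.sum_congr rfl fun i _ => ?_
  rw [map_zsmul]
  congr 1
  exact (congr($(τ.naturality (face n i).op).hom x.1))

end FinPart

namespace Shpart

open FinPart

variable {k : Type u} [Field k] (T : Shpart k)

/-- The degree `i` part of a functor to complexes. -/
abbrev deg (i : ℤ) : FinPartᵒᵖ ⥤ ModuleCat.{u} k := T ⋙ HomologicalComplex.eval _ _ i

/-- The differential of `T`, as a natural transformation. -/
def degD (i j : ℤ) : T.deg i ⟶ T.deg j where
  app X := (T.obj X).d i j
  naturality X Y f := by
    change (T.map f).f i ≫ (T.obj Y).d i j = (T.obj X).d i j ≫ (T.map f).f j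
    exact (T.map f).comm i j

/-- The pairs consisting of a number `m` (standing for `m + 1` arguments) and
of an internal degree `i` whose sum is `j`. -/
abbrev Bidegree (j : ℤ) : Type := {p : ℕ × ℤ // p.2 + p.1 = j}

/-- The degree `j` part of `H T`: a cochain is a family of elements of
`T [m + 1]` of degree `j - m`, `m ≥ 0`, vanishing on shuffles. -/
abbrev HX (j : ℤ) : Type u := ∀ p : Bidegree j, harrison (T.deg p.1.2) (p.1.1 + 1)

/-- The part of the differential of `H T` that comes from the
products of arguments. -/
def horizontal {j : ℤ} : ∀ (m : ℕ) (i : ℤ), i + m = j + 1 →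
    (T.HX j →ₗ[k] harrison (T.deg i) (m + 1))
  | 0, _, _ => 0
  | m + 1, i, h =>
      harrisonDifferential (T.deg i) (m + 1) ∘ₗ
        LinearMap.proj (⟨(m, i), by push_cast at h; dsimp only; omega⟩ : Bidegree j)

/-- The part of the differential of `H T` that comes from the differential of `T`. -/
def vertical {j : ℤ} (m : ℕ) (i : ℤ) (h : i + m = j + 1) :
    T.HX j →ₗ[k] harrison (T.deg i) (m + 1) :=
  harrisonMap (T.degD (i - 1) i) (m + 1) ∘ₗ
    LinearMap.proj (⟨(m, i - 1), by dsimp only; omega⟩ : Bidegree j)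

/-- The differential of `H T`: `D φ = d ∘ φ + (-1) ^ j • δ φ` in degree `j`, where `d` is the
differential of `T` and `δ` is the Hochschild differential. -/
def HD (j j' : ℤ) (hj : j + 1 = j') : T.HX j →ₗ[k] T.HX j' :=
  LinearMap.pi fun p =>
    T.vertical p.1.1 p.1.2 (p.2.trans hj.symm) +
      (j.negOnePow : ℤ) • T.horizontal p.1.1 p.1.2 (p.2.trans hj.symm)

theorem HD_HD (j j' j'' : ℤ) (hj : j + 1 = j') (hj' : j' + 1 = j'') (φ : T.HX j) :
    T.HD j' j'' hj' (T.HD j j' hj φ) = 0 := by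
  have hv : ∀ (m : ℕ) (i : ℤ) (x : harrison (T.deg (i - 1 - 1)) (m + 1)),
      harrisonMap (T.degD (i - 1) i) (m + 1) (harrisonMap (T.degD (i - 1 - 1) (i - 1)) (m + 1) x)
        = 0 := by
    intro m i x
    apply Subtype.ext
    exact congr($((T.obj _).d_comp_d (i - 1 - 1) (i - 1) i).hom x.1)
  subst hj hj'
  funext ⟨⟨m, i⟩, h⟩
  match m with
  | 0 => simp [HD, vertical, horizontal, hv]
  | 1 =>
    change harrisonMap (T.degD (i - 1) i) 2
        (harrisonMap (T.degD (i - 1 - 1) (i - 1)) 2 (φ ⟨(1, i - 1 - 1), _⟩) +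
          (j.negOnePow : ℤ) • harrisonDifferential (T.deg (i - 1)) 1 (φ ⟨(0, i - 1), _⟩)) +
      ((j + 1).negOnePow : ℤ) • harrisonDifferential (T.deg i) 1
        (harrisonMap (T.degD (i - 1) i) 1 (φ ⟨(0, i - 1), _⟩) + (j.negOnePow : ℤ) • 0) = 0
    rw [map_add, map_zsmul, hv, harrisonMap_differential, Int.negOnePow_succ]
    simp
  | m + 2 =>
    change harrisonMap (T.degD (i - 1) i) (m + 3)
        (harrisonMap (T.degD (i - 1 - 1) (i - 1)) (m + 3) (φ ⟨(m + 2, i - 1 - 1), _⟩) +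
          (j.negOnePow : ℤ) •
            harrisonDifferential (T.deg (i - 1)) (m + 2) (φ ⟨(m + 1, i - 1), _⟩)) +
      ((j + 1).negOnePow : ℤ) • harrisonDifferential (T.deg i) (m + 2)
        (harrisonMap (T.degD (i - 1) i) (m + 2) (φ ⟨(m + 1, i - 1), _⟩) +
          (j.negOnePow : ℤ) • harrisonDifferential (T.deg i) (m + 1) (φ ⟨(m, i), _⟩)) = 0
    rw [map_add, map_add, map_zsmul, map_zsmul, hv, harrisonMap_differential,
      harrisonDifferential_comp, Int.negOnePow_succ]
    simp

/-- The complex `H T` of derivations (relative to the projection from the operad of homotopy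
commutative algebras to the operad of commutative algebras) with values in `T`. A derivation is
given by its values on the generators `m₁, m₂, …`; these vanish on shuffles.
The degrees are normalized so that the values on `m₁` have the same degree as the derivation. -/
def HObj : CochainComplex (ModuleCat.{u} k) ℤ where
  X j := ModuleCat.of k (T.HX j)
  d j j' := if h : j + 1 = j' then ModuleCat.ofHom (T.HD j j' h) else 0
  shape j j' h := dif_neg h
  d_comp_d' j j' j'' h h' := by
    rw [dif_pos (show j + 1 = j' from h), dif_pos (show j' + 1 = j'' from h')]
    exact ModuleCat.hom_ext (LinearMap.ext fun φ => T.HD_HD j j' j'' h h' φ)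

variable {T} {T' T'' : Shpart k}

/-- A natural transformation in a fixed degree. -/
def degMap (τ : T ⟶ T') (i : ℤ) : T.deg i ⟶ T'.deg i := Functor.whiskerRight τ _

/-- The map on cochains given by a natural transformation. -/
def HXMap (τ : T ⟶ T') (j : ℤ) : T.HX j →ₗ[k] T'.HX j :=
  LinearMap.pi fun p => harrisonMap (degMap τ p.1.2) (p.1.1 + 1) ∘ₗ LinearMap.proj p

theorem HD_HXMap (τ : T ⟶ T') (j j' : ℤ) (hj : j + 1 = j') (φ : T.HX j) :
    T'.HD j j' hj (HXMap τ j φ) = HXMap τ j' (T.HD j j' hj φ) := by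
  have hv : ∀ (m : ℕ) (i i' : ℤ) (x : harrison (T.deg i') (m + 1)),
      harrisonMap (T'.degD i' i) (m + 1) (harrisonMap (degMap τ i') (m + 1) x) =
      harrisonMap (degMap τ i) (m + 1) (harrisonMap (T.degD i' i) (m + 1) x) := by
    intro m i i' x
    apply Subtype.ext
    exact congr($((τ.app (op (fin (m + 1)))).comm i' i).hom x.1)
  subst hj
  funext ⟨⟨m, i⟩, h⟩
  match m with
  | 0 => simp [HD, vertical, horizontal, hv, HXMap]
  | m + 1 =>
    change harrisonMap (T'.degD (i - 1) i) (m + 2)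
        (harrisonMap (degMap τ (i - 1)) (m + 2) (φ ⟨(m + 1, i - 1), _⟩)) +
      (j.negOnePow : ℤ) • harrisonDifferential (T'.deg i) (m + 1)
        (harrisonMap (degMap τ i) (m + 1) (φ ⟨(m, i), _⟩)) =
      harrisonMap (degMap τ i) (m + 2)
        (harrisonMap (T.degD (i - 1) i) (m + 2) (φ ⟨(m + 1, i - 1), _⟩) +
          (j.negOnePow : ℤ) • harrisonDifferential (T.deg i) (m + 1) (φ ⟨(m, i), _⟩))
    rw [map_add, map_zsmul, harrisonMap_differential, hv]

variable (k) in
/-- The functor `H` from modules over the operad of unital commutative algebras to complexes. -/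
def H : Shpart k ⥤ CochainComplex (ModuleCat.{u} k) ℤ where
  obj T := T.HObj
  map {T T'} τ :=
    { f := fun j => ModuleCat.ofHom (HXMap τ j)
      comm' := fun j j' h => by
        have h' : j + 1 = j' := h
        simp only [HObj, dif_pos h']
        exact ModuleCat.hom_ext (LinearMap.ext fun φ => HD_HXMap τ j j' h' φ) }
  map_id _ := rfl
  map_comp _ _ := rfl

end Shpart

namespace Shsur

variable {k : Type u} [Field k] (M : Shsur k)

/-- The image of a set under a partial map. -/
def image {Z X : FinPart} (f : Z ⟶ X) (S : Set Z) : Set X := {x | ∃ z ∈ S, f z = some x}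

/-- A partial map defined on all of `S` induces a surjection from `S` to its image. -/
def restr {Z X : FinPart} (f : Z ⟶ X) (S : Set Z) (h : ∀ z ∈ S, (f z).isSome) :
    Sur.of S ⟶ Sur.of (image f S) :=
  ⟨fun z => ⟨(f z.1).get (h z.1 z.2), z.1, z.2, (Option.some_get _).symm⟩, by
    rintro ⟨x, z, hz, hx⟩
    exact ⟨⟨z, hz⟩, Subtype.ext (by simp [hx])⟩⟩

/-- The degree `i` part of `B M` on a finite set: the direct sum of the values of `M`
on all subsets (there are finitely many of them, so the direct sum is the product). -/
abbrev BX (X : FinPart) (i : ℤ) : Type u := ∀ S : Set X, (M.obj (op (Sur.of S))).X i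

open Classical in
/-- The inverse image along a partial map `f`: the component on `S` of the inverse image of `s` is
the inverse image of the component of `s` on `f(S)` along `S → f(S)` if `f` is defined on `S`, and
is zero otherwise. -/
noncomputable def BMap {Z X : FinPart} (f : Z ⟶ X) (i : ℤ) : M.BX X i →ₗ[k] M.BX Z i :=
  LinearMap.pi fun S =>
    if h : ∀ z ∈ S, (f z).isSome then
      ((M.map (restr f S h).op).f i).hom ∘ₗ LinearMap.proj (image f S)
    else 0

theorem BMap_of_isSome {Z X : FinPart} (f : Z ⟶ X) (i : ℤ) (s : M.BX X i) (S : Set Z)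
    (h : ∀ z ∈ S, (f z).isSome) :
    M.BMap f i s S = ((M.map (restr f S h).op).f i).hom (s (image f S)) := by
  simp only [BMap, LinearMap.pi_apply, dif_pos h, LinearMap.comp_apply, LinearMap.proj_apply]

theorem BMap_of_not {Z X : FinPart} (f : Z ⟶ X) (i : ℤ) (s : M.BX X i) (S : Set Z)
    (h : ¬ ∀ z ∈ S, (f z).isSome) : M.BMap f i s S = 0 := by
  simp only [BMap, LinearMap.pi_apply, dif_neg h, LinearMap.zero_apply]

theorem map_apply_congr {X : FinPart} {i : ℤ} (s : M.BX X i) {Y : Sur} {S S' : Set X} (h : S = S')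
    (f : Y ⟶ Sur.of S) (f' : Y ⟶ Sur.of S') (hf : ∀ y, (f.1 y).1 = (f'.1 y).1) :
    ((M.map f.op).f i).hom (s S) = ((M.map f'.op).f i).hom (s S') := by
  subst h
  obtain rfl : f = f' := Subtype.ext (funext fun y => Subtype.ext (hf y))
  rfl

theorem BMap_id (X : FinPart) (i : ℤ) (s : M.BX X i) : M.BMap (𝟙 X) i s = s := by
  funext S
  have h : ∀ z ∈ S, ((𝟙 X : X ⟶ X) z).isSome := fun _ _ => rfl
  have hS : image (𝟙 X) S = S := by
    ext x
    exact ⟨fun ⟨z, hz, hx⟩ => Option.some_injective _ hx ▸ hz, fun hx => ⟨x, hx, rfl⟩⟩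
  simp only [BMap, LinearMap.pi_apply, dif_pos h, LinearMap.comp_apply, LinearMap.proj_apply]
  rw [M.map_apply_congr s hS (restr (𝟙 X) S h) (𝟙 _) (fun _ => rfl)]
  simp

theorem BMap_comp {Z Y X : FinPart} (f : Z ⟶ Y) (g : Y ⟶ X) (i : ℤ) (s : M.BX X i) :
    M.BMap (f ≫ g) i s = M.BMap f i (M.BMap g i s) := by
  funext S
  by_cases hf : ∀ z ∈ S, (f z).isSome
  · by_cases hg : ∀ y ∈ image f S, (g y).isSome
    · have h : ∀ z ∈ S, ((f ≫ g) z).isSome := by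
        intro z hz
        obtain ⟨y, hy⟩ := Option.isSome_iff_exists.1 (hf z hz)
        rw [FinPart.comp_apply, hy]
        exact hg y ⟨z, hz, hy⟩
      have hS : image (f ≫ g) S = image g (image f S) := by
        ext x
        constructor
        · rintro ⟨z, hz, hx⟩
          rw [FinPart.comp_apply, Option.bind_eq_some_iff] at hx
          obtain ⟨y, hy, hx⟩ := hx
          exact ⟨y, ⟨z, hz, hy⟩, hx⟩
        · rintro ⟨y, ⟨z, hz, hy⟩, hx⟩
          exact ⟨z, hz, by rw [FinPart.comp_apply, hy]; exact hx⟩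
      simp only [BMap, LinearMap.pi_apply, dif_pos hf, dif_pos hg, dif_pos h,
        LinearMap.comp_apply, LinearMap.proj_apply]
      rw [M.map_apply_congr s hS (restr (f ≫ g) S h) (restr f S hf ≫ restr g _ hg) ?_]
      · rw [op_comp, M.map_comp]
        rfl
      · intro z
        change ((f z.1).bind g).get _ = (g ((f z.1).get _)).get _
        simp
    · have h : ¬ ∀ z ∈ S, ((f ≫ g) z).isSome := by
        intro h
        apply hg
        rintro y ⟨z, hz, hy⟩
        have := h z hz
        rw [FinPart.comp_apply, hy] at this
        exact this
      simp only [BMap, LinearMap.pi_apply, dif_pos hf, dif_neg hg, dif_neg h,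
        LinearMap.comp_apply, LinearMap.proj_apply, LinearMap.zero_apply, map_zero]
  · have h : ¬ ∀ z ∈ S, ((f ≫ g) z).isSome := by
      intro h
      apply hf
      intro z hz
      have := h z hz
      rw [FinPart.comp_apply] at this
      exact Option.isSome_of_isSome_bind this
    simp only [BMap, LinearMap.pi_apply, dif_neg hf, dif_neg h, LinearMap.zero_apply]

/-- The value of `B M` on a finite set `X`: the direct sum of the complexes `M(S)` over all subsets
`S` of `X`. -/
def BObjObj (X : FinPart) : CochainComplex (ModuleCat.{u} k) ℤ where
  X i := ModuleCat.of k (M.BX X i)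
  d i j := ModuleCat.ofHom (LinearMap.pi fun S =>
    ((M.obj (op (Sur.of S))).d i j).hom ∘ₗ LinearMap.proj S)
  shape i j h := by
    exact ModuleCat.hom_ext (LinearMap.ext fun s => funext fun S =>
      congr($((M.obj (op (Sur.of S))).shape i j h).hom (s S)))
  d_comp_d' i j l _ _ := by
    exact ModuleCat.hom_ext (LinearMap.ext fun s => funext fun S =>
      congr($((M.obj (op (Sur.of S))).d_comp_d i j l).hom (s S)))

/-- The functor `B M` on finite sets and partial maps. -/
noncomputable def BObj : Shpart k where
  obj X := M.BObjObj X.unop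
  map f :=
    { f := fun i => ModuleCat.ofHom (M.BMap f.unop i)
      comm' := fun i j _ => by
        refine ModuleCat.hom_ext (LinearMap.ext fun (s : M.BX _ i) => funext fun S => ?_)
        change ((M.obj (op (Sur.of S))).d i j).hom (M.BMap f.unop i s S) =
          M.BMap f.unop j (fun S => ((M.obj (op (Sur.of S))).d i j).hom (s S)) S
        by_cases h : ∀ z ∈ S, (f.unop z).isSome
        · rw [BMap_of_isSome _ _ _ _ _ h, BMap_of_isSome _ _ _ _ _ h]
          exact congr($((M.map (restr f.unop S h).op).comm i j).hom (s (image f.unop S)))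
        · rw [BMap_of_not _ _ _ _ _ h, BMap_of_not _ _ _ _ _ h, map_zero] }
  map_id X := HomologicalComplex.hom_ext _ _ fun i =>
    ModuleCat.hom_ext (LinearMap.ext fun s => M.BMap_id X.unop i s)
  map_comp f g := HomologicalComplex.hom_ext _ _ fun i =>
    ModuleCat.hom_ext (LinearMap.ext fun s => M.BMap_comp g.unop f.unop i s)

variable (k) in
/-- The functor `B`, which turns a functor on finite sets and surjections into a functor on
finite sets and partial maps (a module over the operad of unital commutative algebras). -/
noncomputable def B : Shsur k ⥤ Shpart k where
  obj M := M.BObj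
  map {M N} τ :=
    { app := fun X =>
        { f := fun i => ModuleCat.ofHom (LinearMap.pi fun S =>
            ((τ.app (op (Sur.of S))).f i).hom ∘ₗ LinearMap.proj S)
          comm' := fun i j _ => by
            exact ModuleCat.hom_ext (LinearMap.ext fun s => funext fun S =>
              congr($((τ.app (op (Sur.of S))).comm i j).hom (s S))) }
      naturality := fun X Y f => by
        refine HomologicalComplex.hom_ext _ _ fun i =>
          ModuleCat.hom_ext (LinearMap.ext fun (s : M.BX _ i) => funext fun S => ?_)
        change ((τ.app (op (Sur.of S))).f i).hom (M.BMap f.unop i s S) =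
          N.BMap f.unop i (fun S => ((τ.app (op (Sur.of S))).f i).hom (s S)) S
        by_cases h : ∀ z ∈ S, (f.unop z).isSome
        · rw [BMap_of_isSome _ _ _ _ _ h, BMap_of_isSome _ _ _ _ _ h]
          exact congr(($(τ.naturality (restr f.unop S h).op).f i).hom
            (s (image f.unop S)))
        · rw [BMap_of_not _ _ _ _ _ h, BMap_of_not _ _ _ _ _ h, map_zero] }
  map_id _ := rfl
  map_comp _ _ := rfl

variable (k) in
/-- The functor `H` on functors on finite sets and surjections. -/
noncomputable def H : Shsur k ⥤ CochainComplex (ModuleCat.{u} k) ℤ := B k ⋙ Shpart.H k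

/-- The elements of degree `i` of `M [1]` killed by the inverse images along all
surjections `[n] → [1]` with `n > 1`. -/
def GX (i : ℤ) : Submodule k ((M.obj (op (Sur.of (Fin 1)))).X i) where
  carrier := {x | ∀ n : ℕ, 1 < n → ∀ f : Sur.of (Fin n) ⟶ Sur.of (Fin 1),
    ((M.map f.op).f i).hom x = 0}
  zero_mem' := fun _ _ _ => map_zero _
  add_mem' := fun hx hy n hn f => by rw [map_add, hx n hn f, hy n hn f, add_zero]
  smul_mem' := fun c x hx n hn f => by rw [map_smul, hx n hn f, smul_zero]

/-- The subcomplex `G M` of `M [1]`. -/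
def GObj : CochainComplex (ModuleCat.{u} k) ℤ where
  X i := ModuleCat.of k (M.GX i)
  d i j := ModuleCat.ofHom (((M.obj (op (Sur.of (Fin 1)))).d i j).hom.restrict (by
    intro x hx n hn f
    have := congr($((M.map f.op).comm i j).hom x)
    simp only [ModuleCat.hom_comp, LinearMap.comp_apply, hx n hn f, map_zero] at this
    exact this.symm))
  shape i j h := by
    exact ModuleCat.hom_ext (LinearMap.ext fun x => Subtype.ext
      congr($((M.obj (op (Sur.of (Fin 1)))).shape i j h).hom x.1))
  d_comp_d' i j l _ _ := by
    exact ModuleCat.hom_ext (LinearMap.ext fun x => Subtype.ext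
      congr($((M.obj (op (Sur.of (Fin 1)))).d_comp_d i j l).hom x.1))

variable (k) in
/-- The functor `G`, the elements of `M [1]` killed by inverse images along all
`[n] → [1]` with `n > 1`. -/
def G : Shsur k ⥤ CochainComplex (ModuleCat.{u} k) ℤ where
  obj M := M.GObj
  map {M N} τ :=
    { f := fun i => ModuleCat.ofHom (((τ.app (op (Sur.of (Fin 1)))).f i).hom.restrict (by
        intro x hx n hn f
        have := congr(($(τ.naturality f.op).f i).hom x)
        simp only [HomologicalComplex.comp_f, ModuleCat.hom_comp, LinearMap.comp_apply,
          hx n hn f, map_zero] at this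
        exact this.symm))
      comm' := fun i j _ => by
        exact ModuleCat.hom_ext (LinearMap.ext fun x => Subtype.ext
          congr($((τ.app (op (Sur.of (Fin 1)))).comm i j).hom x.1)) }
  map_id _ := rfl
  map_comp _ _ := rfl

end Shsur

namespace Shsur

variable {k : Type u} [Field k] (M : Shsur k)

/-- The unique map to the one-element set, for a nonempty set. -/
def toPoint (Y : Sur) (h : Nonempty Y) : Y ⟶ Sur.of (Fin 1) :=
  ⟨fun _ => (0 : Fin 1), fun _ => ⟨h.some, Subsingleton.elim (α := Fin 1) _ _⟩⟩

theorem toPoint_unique {Y : Sur} (h : Nonempty Y) (f : Y ⟶ Sur.of (Fin 1)) : f = toPoint Y h :=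
  Subtype.ext (funext fun _ => Subsingleton.elim (α := Fin 1) _ _)

open Classical in
/-- The inclusion `M [1] → (B M) [1]`. (The one-element subset of `[1]` is identified with `[1]`.) -/
noncomputable def inclB (i : ℤ) :
    (M.obj (op (Sur.of (Fin 1)))).X i →ₗ[k] M.BX (FinPart.fin 1) i :=
  LinearMap.pi fun S =>
    if h : Nonempty S then ((M.map (toPoint (Sur.of S) h).op).f i).hom else 0

theorem inclB_of_nonempty (i : ℤ) (x) (S : Set (FinPart.fin 1)) (h : Nonempty S) :
    M.inclB i x S = ((M.map (toPoint (Sur.of S) h).op).f i).hom x := by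
  simp only [inclB, LinearMap.pi_apply, dif_pos h]

theorem inclB_of_isEmpty (i : ℤ) (x) (S : Set (FinPart.fin 1)) (h : ¬ Nonempty S) :
    M.inclB i x S = 0 := by
  simp only [inclB, LinearMap.pi_apply, dif_neg h, LinearMap.zero_apply]

/-- The inverse image under partial maps of an element of `M [1]`, viewed in `B M`. -/
theorem BMap_inclB {Z : FinPart} (f : Z ⟶ FinPart.fin 1) (i : ℤ) (x) (S : Set Z)
    (hS : Nonempty S) (h : ∀ z ∈ S, (f z).isSome) :
    M.BMap f i (M.inclB i x) S = ((M.map (toPoint (Sur.of S) hS).op).f i).hom x := by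
  have hS' : Nonempty (image f S) := ⟨(restr f S h).1 hS.some⟩
  rw [BMap_of_isSome _ _ _ _ _ h, inclB_of_nonempty _ _ _ _ hS',
    ← toPoint_unique hS (restr f S h ≫ toPoint (Sur.of (image f S)) hS'), op_comp, M.map_comp]
  rfl

theorem BMap_inclB_of_isEmpty {Z : FinPart} (f : Z ⟶ FinPart.fin 1) (i : ℤ) (x) (S : Set Z)
    (hS : ¬ Nonempty S) : M.BMap f i (M.inclB i x) S = 0 := by
  have h : ∀ z ∈ S, (f z).isSome := fun z hz => (hS ⟨z, hz⟩).elim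
  rw [BMap_of_isSome _ _ _ _ _ h, inclB_of_isEmpty, map_zero]
  rintro ⟨_, z, hz, _⟩
  exact hS ⟨z, hz⟩

theorem hochschild_inclB (i : ℤ) (x) (hx : x ∈ M.GX i) :
    FinPart.hochschild (((B k).obj M).deg i) 1 (M.inclB i x) = 0 := by
  have key : M.BMap (FinPart.face 1 0) i (M.inclB i x) - M.BMap (FinPart.face 1 1) i (M.inclB i x)
      + M.BMap (FinPart.face 1 2) i (M.inclB i x) = 0 := by
    funext S
    change _ - _ + _ = (0 : (M.obj (op (Sur.of S))).X i)
    by_cases hS : Nonempty S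
    · have h1 : ∀ z ∈ S, (FinPart.face 1 1 z).isSome := by
        rintro (z : Fin 2) _
        fin_cases z <;> simp [FinPart.face]
      by_cases h0 : (0 : Fin 2) ∈ S <;> by_cases h2 : (1 : Fin 2) ∈ S
      · have hn0 : ¬ ∀ z ∈ S, (FinPart.face 1 0 z).isSome := by
          intro h; simpa [FinPart.face] using h _ h0
        have hn2 : ¬ ∀ z ∈ S, (FinPart.face 1 2 z).isSome := by
          intro h; simpa [FinPart.face] using h _ h2
        rw [BMap_of_not _ _ _ _ _ hn0, BMap_of_not _ _ _ _ _ hn2, BMap_inclB _ _ _ _ _ hS h1]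
        let g : Sur.of S ⟶ Sur.of (Fin 2) := ⟨fun z => z.1, fun (z : Fin 2) => by
          fin_cases z
          · exact ⟨⟨_, h0⟩, rfl⟩
          · exact ⟨⟨_, h2⟩, rfl⟩⟩
        have hz := hx 2 (by norm_num) (toPoint (Sur.of (Fin 2)) ⟨(0 : Fin 2)⟩)
        rw [← toPoint_unique hS (g ≫ toPoint (Sur.of (Fin 2)) ⟨(0 : Fin 2)⟩), op_comp, M.map_comp,
          HomologicalComplex.comp_f, ModuleCat.hom_comp, LinearMap.comp_apply, hz, map_zero]
        simp
      · have hn0 : ¬ ∀ z ∈ S, (FinPart.face 1 0 z).isSome := by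
          intro h; simpa [FinPart.face] using h _ h0
        have hp2 : ∀ z ∈ S, (FinPart.face 1 2 z).isSome := by
          rintro (z : Fin 2) hz
          fin_cases z
          · simp [FinPart.face]
          · exact (h2 hz).elim
        rw [BMap_of_not _ _ _ _ _ hn0, BMap_inclB _ _ _ _ _ hS hp2, BMap_inclB _ _ _ _ _ hS h1]
        simp
      · have hn2 : ¬ ∀ z ∈ S, (FinPart.face 1 2 z).isSome := by
          intro h; simpa [FinPart.face] using h _ h2
        have hp0 : ∀ z ∈ S, (FinPart.face 1 0 z).isSome := by
          rintro (z : Fin 2) hz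
          fin_cases z
          · exact (h0 hz).elim
          · simp [FinPart.face]
        rw [BMap_of_not _ _ _ _ _ hn2, BMap_inclB _ _ _ _ _ hS hp0, BMap_inclB _ _ _ _ _ hS h1]
        simp
      · obtain ⟨z, hz⟩ := hS
        change Fin 2 at z
        fin_cases z
        · exact (h0 hz).elim
        · exact (h2 hz).elim
    · rw [BMap_inclB_of_isEmpty _ _ _ _ _ hS, BMap_inclB_of_isEmpty _ _ _ _ _ hS,
        BMap_inclB_of_isEmpty _ _ _ _ _ hS]
      simp
  refine Eq.trans ?_ key
  refine (FinPart.hochschild_apply _ 1 _).trans ?_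
  rw [Finset.sum_range_succ, Finset.sum_range_succ, Finset.sum_range_one, pow_zero, one_smul,
    pow_one, neg_smul, one_smul, neg_one_sq, one_smul, ← sub_eq_add_neg]
  rfl

/-- An element of `G M`, viewed in the space of elements of `(B M) [1]` vanishing on shuffles (there
are no shuffles of total length `1`). -/
noncomputable def inclHarrison (i : ℤ) :
    M.GX i →ₗ[k] FinPart.harrison (((B k).obj M).deg i) 1 :=
  LinearMap.codRestrict _ (M.inclB i ∘ₗ (M.GX i).subtype) (by
    intro x s t hs ht hst
    have := hst.length_eq
    have h1 := List.length_pos_iff.2 hs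
    have h2 := List.length_pos_iff.2 ht
    simp only [List.length_append, List.length_finRange] at this
    omega)

/-- The morphism `G M → H M` in degree `j`: the image of an element `x` of `G M`
has the value `x` on `m₁`, and the value `0` on the other generators. -/
noncomputable def iotaX (j : ℤ) : M.GX j →ₗ[k] ((B k).obj M).HX j :=
  LinearMap.pi fun p => match p with
    | ⟨(0, i), h⟩ => M.inclHarrison i ∘ₗ
        (M.GObj.XIsoOfEq (show j = i by simpa using h.symm)).hom.hom
    | ⟨(_ + 1, _), _⟩ => 0

theorem harrisonMap_inclHarrison (i j : ℤ) (x : M.GX i) :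
    FinPart.harrisonMap (((B k).obj M).degD i j) 1 (M.inclHarrison i x) =
      M.inclHarrison j ((M.GObj.d i j).hom x) := by
  refine Subtype.ext (funext fun S => ?_)
  change ((M.obj (op (Sur.of S))).d i j).hom (M.inclB i x.1 S) =
    M.inclB j (((M.obj (op (Sur.of (Fin 1)))).d i j).hom x.1) S
  by_cases hS : Nonempty S
  · rw [inclB_of_nonempty _ _ _ _ hS, inclB_of_nonempty _ _ _ _ hS]
    exact congr($((M.map (toPoint (Sur.of S) hS).op).comm i j).hom x.1)
  · rw [inclB_of_isEmpty _ _ _ _ hS, inclB_of_isEmpty _ _ _ _ hS, map_zero]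

theorem harrisonMap_inclHarrison_naturality {M N : Shsur k} (τ : M ⟶ N) (i : ℤ) (x : M.GX i) :
    FinPart.harrisonMap (Shpart.degMap ((B k).map τ) i) 1 (M.inclHarrison i x) =
      N.inclHarrison i ((((G k).map τ).f i).hom x) := by
  refine Subtype.ext (funext fun S => ?_)
  change ((τ.app (op (Sur.of S))).f i).hom (M.inclB i x.1 S) =
    N.inclB i (((τ.app (op (Sur.of (Fin 1)))).f i).hom x.1) S
  by_cases hS : Nonempty S
  · rw [inclB_of_nonempty _ _ _ _ hS, inclB_of_nonempty _ _ _ _ hS]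
    exact congr(($(τ.naturality (toPoint (Sur.of S) hS).op).f i).hom x.1)
  · rw [inclB_of_isEmpty _ _ _ _ hS, inclB_of_isEmpty _ _ _ _ hS, map_zero]

theorem HD_iotaX (j j' : ℤ) (hj : j + 1 = j') (x : M.GX j) :
    ((B k).obj M).HD j j' hj (M.iotaX j x) = M.iotaX j' ((M.GObj.d j j').hom x) := by
  funext ⟨⟨m, i⟩, h⟩
  match m with
  | 0 =>
    have hi : j' = i := by simpa using h.symm
    subst hi
    have hi' : j = j' - 1 := by omega
    change FinPart.harrisonMap (((B k).obj M).degD (j' - 1) j') 1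
      (M.inclHarrison (j' - 1) ((M.GObj.XIsoOfEq hi').hom.hom x)) + (j.negOnePow : ℤ) • 0 =
        M.inclHarrison j' ((M.GObj.d j j').hom x)
    rw [smul_zero, add_zero, ← M.GObj.XIsoOfEq_hom_comp_d hi' j']
    refine Eq.trans (M.harrisonMap_inclHarrison _ _ _) ?_
    rfl
  | 1 =>
    have hi : j = i := by simp at h; omega
    subst hi
    change FinPart.harrisonMap (((B k).obj M).degD (j - 1) j) 2 0 + (j.negOnePow : ℤ) •
      FinPart.harrisonDifferential (((B k).obj M).deg j) 1 (M.inclHarrison j x) = 0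
    rw [map_zero, zero_add]
    refine (congrArg _ (Subtype.ext (M.hochschild_inclB j x.1 x.2))).trans (smul_zero _)
  | m + 2 =>
    change FinPart.harrisonMap (((B k).obj M).degD (i - 1) i) (m + 3) 0 + (j.negOnePow : ℤ) •
      FinPart.harrisonDifferential (((B k).obj M).deg i) (m + 2) 0 = 0
    rw [map_zero, map_zero, smul_zero, add_zero]

variable (k) in
/-- The morphism `i : G M → H M`. -/
noncomputable def iota : G k ⟶ H k where
  app M :=
    { f := fun j => ModuleCat.ofHom (M.iotaX j)
      comm' := fun j j' h => by
        have h' : j + 1 = j' := h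
        refine ModuleCat.hom_ext (LinearMap.ext fun x => ?_)
        refine Eq.trans ?_ (M.HD_iotaX j j' h' x)
        change ((if h : j + 1 = j' then ModuleCat.ofHom (((B k).obj M).HD j j' h) else 0 :
          ModuleCat.of k (((B k).obj M).HX j) ⟶ ModuleCat.of k (((B k).obj M).HX j'))).hom
            (M.iotaX j x) = _
        rw [dif_pos h']
        rfl }
  naturality M N τ := by
    refine HomologicalComplex.hom_ext _ _ fun j =>
      ModuleCat.hom_ext (LinearMap.ext fun x => funext fun ⟨⟨m, i⟩, h⟩ => ?_)
    match m with
    | 0 =>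
      have hi : j = i := by simpa using h.symm
      subst hi
      exact (harrisonMap_inclHarrison_naturality τ j x).symm
    | m + 1 =>
      exact (map_zero (FinPart.harrisonMap (Shpart.degMap ((B k).map τ) i) (m + 2))).symm

variable (k) in
/-- The morphisms of `Shsur` that are quasi-isomorphisms on every finite set. The derived category
of `Shsur` is the localization with respect to them. -/
def quasiIso : MorphismProperty (Shsur k) := fun _ _ τ => ∀ X : Surᵒᵖ, QuasiIso (τ.app X)

end Shsur

/-!
The theorem says that `H` preserves quasi-isomorphisms and that `i : G → H` exhibits it as the right
derived functor of `G`.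

That `H` preserves quasi-isomorphisms (`Shsur.quasiIso_H_map`) uses characteristic zero. The complex
`H T` is complete for the filtration by the number of arguments, and the graded pieces are the
spaces of elements of `T [n]` vanishing on shuffles. The Dynkin operator, which is transposed to the
bracketing of words, is `n` times a projector to this space (`FinPart.dynkin_of_mem_harrison`), so
the space is a natural direct summand of `T [n]`.

To derive `G` it is enough to find functorial resolutions `M → M'` such that `i` is a
quasi-isomorphism on `M'`: then the functors on which `i` is a quasi-isomorphism form a right
derivability structure, and the derived functor of `G` is computed by `G`, or equivalently by `H`,
on `M'`. The resolution used is the cobar construction of the endofunctor `coind`, where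
`coind M` is the functor `Y ↦ ∏ M [l]`, the product being over all surjections `[l] → Y`. It
contains `M`, as an objectwise direct summand (not compatibly with maps in `Sur`), hence the cobar
complex `coind M → coind² M → …` resolves `M` (`Shsur.quasiIso_cobarUnit`).

The point of `coind` is that `B (coind M)` has a simple shape. A surjection from `[l]` to a subset
of `X` is the same thing as a map `[l] → X`, so `B (coind M) X` consists of families of functions
from the maps `[l] → X` to `V l = M [l]` (`FinPart.coFun`). For `l > 0`, an element of its Harrison
complex is determined by its values at the maps `g` with `g 0 = 0`, as the brackets beginning
with a fixed letter form a basis of the multilinear Lie polynomials, and an extra degeneracy gives a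
contraction. The complex is a resolution of `V 1`
(`FinPart.contr_homotopy`, `FinPart.contr_homotopy_zero`), and `V 1` is also the value of `G` on
`coind M`. The contraction is natural in `V` and so compatible with the differential of `M`. It is
compatible with the differential of the cobar complex only up to terms of higher
filtration, which suffices as the filtration is complete (`Shsur.quasiIso_iota_cobarTot`).
-/

/-! ### Brackets of words and shuffles -/

section Brackets

variable {α β V W : Type*} [AddCommGroup V] [AddCommGroup W]

/-- The function whose value at `w ++ [y]` is `Q y w` (and which vanishes at the empty word). -/
def lastPart (Q : α → List α → V) (w : List α) : V :=
  match w.getLast? with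
  | none => 0
  | some y => Q y w.dropLast

/-- The function whose value at `y :: w` is `Q y w` (and which vanishes at the empty word). -/
def headPart (Q : α → List α → V) (w : List α) : V :=
  match w with
  | [] => 0
  | y :: u => Q y u

@[simp]
theorem lastPart_concat (Q : α → List α → V) (w : List α) (y : α) :
    lastPart Q (w ++ [y]) = Q y w := by
  simp [lastPart]

@[simp]
theorem headPart_cons (Q : α → List α → V) (w : List α) (y : α) :
    headPart Q (y :: w) = Q y w := rfl

/-- The inductive step in Ree's theorem: if a polynomial `P` is orthogonal to shuffles, then so is
its graded commutator with a letter `y`, which is `P y ± y P`. -/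
theorem shuffleSum_lastPart_add_headPart (n : ℕ) (Q : α → List α → V)
    (hQ : ∀ y s t, s ≠ [] → t ≠ [] → s.length + t.length = n + 1 → shuffleSum (Q y) s t = 0)
    (s t : List α) (hs : s ≠ []) (ht : t ≠ []) (hn : s.length + t.length = n + 2) :
    shuffleSum (fun w => lastPart Q w + (-1 : ℤ) ^ n • headPart Q w) s t = 0 := by
  have h1 : shuffleSum (headPart Q) s t =
      (if s.length = 1 then headPart Q (s ++ t) else 0) +
        (if t.length = 1 then (-1 : ℤ) ^ s.length • headPart Q (t ++ s) else 0) := by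
    match s, t with
    | a :: s, b :: t =>
      rw [shuffleSum_cons_cons]
      simp only [headPart_cons]
      congr 1
      · cases s with
        | nil => simp [shuffleSum_nil_left]
        | cons c s => rw [hQ _ _ _ (by simp) (by simp) (by simp at hn ⊢; omega)]; simp
      · cases t with
        | nil => simp [shuffleSum_nil_right]
        | cons c t => rw [hQ _ _ _ (by simp) (by simp) (by simp at hn ⊢; omega)]; simp
  have h2 : shuffleSum (lastPart Q) s t =
      (if t.length = 1 then headPart Q (t ++ s) else 0) +
        (if s.length = 1 then (-1 : ℤ) ^ t.length • headPart Q (s ++ t) else 0) := by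
    obtain ⟨s, a, rfl⟩ := s.eq_nil_or_concat.resolve_left hs
    obtain ⟨t, b, rfl⟩ := t.eq_nil_or_concat.resolve_left ht
    rw [List.concat_eq_append, List.concat_eq_append] at *
    rw [shuffleSum_snoc]
    simp only [lastPart_concat]
    congr 1
    · rcases eq_or_ne t [] with rfl | h
      · simp [shuffleSum_nil_right]
      · rw [hQ _ _ _ (by simp) h (by simp at hn ⊢; omega)]; simp [h]
    · rcases eq_or_ne s [] with rfl | h
      · simp [shuffleSum_nil_left]
      · rw [hQ _ _ _ h (by simp) (by simp at hn ⊢; omega)]; simp [h]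
  rw [shuffleSum_add, shuffleSum_zsmul, h1, h2]
  by_cases hs1 : s.length = 1 <;> by_cases ht1 : t.length = 1
  · obtain rfl : n = 0 := by omega
    simp [hs1, ht1]
  · have ht' : t.length = n + 1 := by omega
    rw [if_neg ht1, if_pos hs1, if_pos hs1, if_neg ht1, ht', pow_succ, add_zero, zero_add]
    simp
  · have hs' : s.length = n + 1 := by omega
    rw [if_pos ht1, if_neg hs1, if_neg hs1, if_pos ht1, hs', pow_succ, add_zero, zero_add,
      smul_smul, ← mul_assoc, ← mul_pow]
    simp
  · simp [hs1, ht1]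

/-- The transpose of the bracketing of words. For words `w` of length `n + 1`,
`bracketExpand A n F w` is the sum of the values `F v`, over all words `v` without letters
satisfying `A` except possibly the first one, weighted by the coefficient of `w` in the iterated
graded commutator `[[v₀, v₁], …, vₙ]` (where the letters are odd). -/
def bracketExpand (A : α → Prop) [DecidablePred A] : ℕ → (List α → V) → List α → V
  | 0, F, w => F w
  | n + 1, F, w =>
      lastPart (fun y u => if A y then 0 else bracketExpand A n (fun v => F (v ++ [y])) u) w +
        (-1 : ℤ) ^ n •
          headPart (fun y u => if A y then 0 else bracketExpand A n (fun v => F (v ++ [y])) u) w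

/-- Iterated commutators are orthogonal to signed shuffles. -/
theorem shuffleSum_bracketExpand (A : α → Prop) [DecidablePred A] (n : ℕ) (F : List α → V)
    (s t : List α) (hs : s ≠ []) (ht : t ≠ []) (hn : s.length + t.length = n + 1) :
    shuffleSum (bracketExpand A n F) s t = 0 := by
  induction n generalizing F s t with
  | zero =>
    have h1 := List.length_pos_iff.2 hs
    have h2 := List.length_pos_iff.2 ht
    omega
  | succ n ih =>
    refine shuffleSum_lastPart_add_headPart n _ (fun y s t hs ht hn => ?_) s t hs ht hn
    by_cases hy : A y
    · simp only [hy, if_true, shuffleSum_zero]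
    · simp only [hy, if_false]
      exact ih _ s t hs ht hn

/-- A word `a v` such that `a` satisfies `A` and the letters of `v` do not occurs in just one of
the brackets considered, the bracket of `a v` itself. -/
theorem bracketExpand_cons (A : α → Prop) [DecidablePred A] (n : ℕ) (F : List α → V) (a : α)
    (v : List α) (ha : A a) (hv : ∀ b ∈ v, ¬ A b) (hn : v.length = n) :
    bracketExpand A n F (a :: v) = F (a :: v) := by
  induction n generalizing F v with
  | zero => rfl
  | succ n ih =>
    obtain ⟨v, y, rfl⟩ := v.eq_nil_or_concat.resolve_left (by rintro rfl; simp at hn)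
    rw [List.concat_eq_append] at *
    have hy : ¬ A y := hv y (by simp)
    rw [bracketExpand, ← List.cons_append, lastPart_concat, if_neg hy,
      ih _ _ (fun b hb => hv b (by simp [hb])) (by simpa using hn), List.cons_append, headPart_cons,
      if_pos ha, smul_zero, add_zero]

theorem map_bracketExpand (A : α → Prop) [DecidablePred A] (φ : V →+ W) (n : ℕ) (F : List α → V)
    (w : List α) : φ (bracketExpand A n F w) = bracketExpand A n (fun u => φ (F u)) w := by
  induction n generalizing F w with
  | zero => rfl
  | succ n ih =>
    rcases w.eq_nil_or_concat with rfl | ⟨v, y, rfl⟩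
    · simp [bracketExpand, lastPart, headPart]
    · have key : ∀ (y : α) (u : List α),
          φ (if A y then 0 else bracketExpand A n (fun v => F (v ++ [y])) u) =
          if A y then 0 else bracketExpand A n (fun v => φ (F (v ++ [y]))) u := by
        intro y u
        split_ifs
        · simp
        · exact ih _ _
      rw [List.concat_eq_append, bracketExpand, bracketExpand, map_add, map_zsmul, lastPart_concat,
        lastPart_concat, key]
      cases v with
      | nil => simp only [List.nil_append, headPart_cons, key]
      | cons a v => simp only [List.cons_append, headPart_cons, key]

theorem bracketExpand_add (A : α → Prop) [DecidablePred A] (n : ℕ) (F G : List α → V)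
    (w : List α) : bracketExpand A n (fun u => F u + G u) w =
      bracketExpand A n F w + bracketExpand A n G w := by
  have h1 := map_bracketExpand A (AddMonoidHom.fst V V) n (fun u => (F u, G u)) w
  have h2 := map_bracketExpand A (AddMonoidHom.snd V V) n (fun u => (F u, G u)) w
  have h3 := map_bracketExpand A (AddMonoidHom.fst V V + AddMonoidHom.snd V V) n
    (fun u => (F u, G u)) w
  simp only [AddMonoidHom.add_apply, AddMonoidHom.coe_fst, AddMonoidHom.coe_snd] at h1 h2 h3
  rw [← h3, h1, h2]

theorem bracketExpand_map (A : β → Prop) [DecidablePred A] (f : α → β) (n : ℕ) (F : List β → V)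
    (w : List α) : bracketExpand A n F (w.map f) =
      bracketExpand (fun x => A (f x)) n (fun u => F (u.map f)) w := by
  induction n generalizing F w with
  | zero => rfl
  | succ n ih =>
    rcases w.eq_nil_or_concat with rfl | ⟨v, y, rfl⟩
    · simp [bracketExpand, lastPart, headPart]
    · rw [List.concat_eq_append, bracketExpand, bracketExpand, List.map_append, List.map_singleton,
        lastPart_concat, lastPart_concat, ih]
      cases v with
      | nil =>
        have := ih (fun u => F (u ++ [f y])) []
        rw [List.map_nil] at this
        simp only [List.nil_append, List.map_nil, List.map_cons, headPart_cons, this,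
          List.map_append]
      | cons a v =>
        have := ih (fun u => F (u ++ [f a])) (v ++ [y])
        rw [List.map_append, List.map_singleton] at this
        simp only [List.cons_append, List.map_cons, headPart_cons, this, List.map_append,
          List.map_nil]

/-- If `F` vanishes on the words in which a letter satisfying `A` occurs earlier than in `u a v`,
then only the trivial shuffle contributes to the sum over the shuffles of `u` and `a v`. -/
theorem shuffleSum_eq_append (A : α → Prop) (F : List α → V) (u : List α) (a : α) (v : List α)
    (ha : A a) (h : ∀ u' b v', A b → u'.length < u.length →
      (u' ++ b :: v').Perm (u ++ a :: v) → F (u' ++ b :: v') = 0) :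
    shuffleSum F u (a :: v) = F (u ++ a :: v) := by
  induction u generalizing F with
  | nil => rw [shuffleSum_nil_left]; rfl
  | cons c u ih =>
    rw [shuffleSum_cons_cons, ih, shuffleSum_congr _ (fun _ => 0), shuffleSum_zero, smul_zero,
      add_zero]
    · rfl
    · intro w hw
      exact h [] a w ha (by simp) ((hw.cons a).trans List.perm_middle.symm)
    · intro u' b v' hb hu' hp
      exact h (c :: u') b v' hb (by simpa using hu') (hp.cons c)

/-- A function vanishing on shuffles is determined by its values on the words beginning with a
letter that satisfies `A`. -/
theorem eq_zero_of_shuffleSum_eq_zero (A : α → Prop) (F : List α → V) (w₀ : List α)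
    (hF : ∀ s t : List α, s ≠ [] → t ≠ [] → (s ++ t).Perm w₀ → shuffleSum F s t = 0)
    (h0 : ∀ a v, A a → (a :: v).Perm w₀ → F (a :: v) = 0) (w : List α) (hw : w.Perm w₀)
    (hA : ∃ a ∈ w, A a) : F w = 0 := by
  obtain ⟨a, ha, hAa⟩ := hA
  obtain ⟨u, v, rfl⟩ := List.append_of_mem ha
  clear ha
  induction hl : u.length using Nat.strong_induction_on generalizing u a v with
  | _ l ih =>
    subst hl
    rcases eq_or_ne u [] with rfl | hu
    · exact h0 a v hAa hw
    · rw [← shuffleSum_eq_append A F u a v hAa, hF _ _ hu (by simp) hw]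
      intro u' b v' hb hl hp
      exact ih _ hl b hb u' v' (hp.trans hw) rfl

/-- If exactly one letter `a` satisfies `A`, a function vanishing on shuffles is the expansion of its
restriction to the words beginning with `a`: the brackets of these words form a basis of the
multilinear Lie polynomials. -/
theorem bracketExpand_eq_self (A : α → Prop) [DecidablePred A] (n : ℕ) (F : List α → V)
    (w : List α) (hF : ∀ s t : List α, s ≠ [] → t ≠ [] → (s ++ t).Perm w → shuffleSum F s t = 0)
    (hw : w.length = n + 1) (hA : w.countP (fun a => decide (A a)) = 1) :
    bracketExpand A n F w = F w := by
  rw [← sub_eq_zero]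
  refine eq_zero_of_shuffleSum_eq_zero A (fun u => bracketExpand A n F u - F u) w ?_ ?_ w
    (.refl w) ?_
  · intro s t hs ht hst
    rw [shuffleSum_sub, hF s t hs ht hst, sub_zero]
    exact shuffleSum_bracketExpand A n F s t hs ht (by
      rw [← hw, ← hst.length_eq, List.length_append])
  · intro a v ha hp
    have h1 := hp.countP_eq (fun a => decide (A a))
    rw [hA, List.countP_cons_of_pos (by simpa using ha)] at h1
    rw [bracketExpand_cons A n F a v ha, sub_self]
    · have h2 : v.countP (fun a => decide (A a)) = 0 := by omega
      simpa using h2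
    · have := hp.length_eq
      rw [hw] at this
      simpa using this
  · have : 0 < w.countP (fun a => decide (A a)) := by omega
    simpa using this

/-- The brackets of all words, sorted according to the first letter of the word. -/
theorem bracketExpand_false (n : ℕ) [DecidableEq α] (F : List α → V) (w : List α) (hw : w.Nodup)
    (hn : w.length = n + 1) : bracketExpand (fun _ => False) n F w =
      (w.map fun a => bracketExpand (fun x => x = a) n F w).sum := by
  induction n generalizing F w with
  | zero =>
    obtain ⟨a, rfl⟩ := List.length_eq_one_iff.1 hn
    simp [bracketExpand]
  | succ n ih =>
    have hlast : ∀ (v : List α) (y : α), (v ++ [y]).Nodup → v.length = n + 1 →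
        bracketExpand (fun _ => False) n (fun u => F (u ++ [y])) v =
        ((v ++ [y]).map fun a => if y = a then 0 else
          bracketExpand (fun x => x = a) n (fun u => F (u ++ [y])) v).sum := by
      intro v y hv hl
      rw [List.nodup_append] at hv
      rw [ih _ _ hv.1 hl, List.map_append, List.sum_append]
      simp only [List.map_singleton, if_true, List.sum_singleton, add_zero]
      congr 1
      refine List.map_congr_left fun a ha => ?_
      rw [if_neg]
      rintro rfl
      exact hv.2.2 _ ha _ (by simp) rfl
    obtain ⟨v, y, rfl⟩ := w.eq_nil_or_concat.resolve_left (by rintro rfl; simp at hn)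
    rw [List.concat_eq_append] at *
    simp only [bracketExpand, lastPart_concat, if_false, List.sum_map_add]
    rw [hlast v y hw (by simpa using hn)]
    congr 1
    have hsmul : ∀ (c : ℤ) (l : List α) (f : α → V), (l.map fun a => c • f a).sum =
        c • (l.map f).sum := by
      intro c l f
      induction l with
      | nil => simp
      | cons a l ih => simp [ih]
    rw [hsmul]
    congr 1
    cases hv : v ++ [y] with
    | nil => simp at hv
    | cons b u =>
      simp only [headPart_cons]
      rw [hv] at hw hn
      have hp : (u ++ [b]).Perm (b :: u) := List.perm_append_comm
      rw [hlast u b (hp.nodup_iff.2 hw) (by simpa using hn)]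
      exact (hp.map _).sum_eq

end Brackets

/-! ### The Dynkin projector -/

namespace FinPart

variable {k : Type u} [Field k] (F : FinPartᵒᵖ ⥤ ModuleCat.{u} k)

theorem position_finRange (n : ℕ) : position (List.finRange n) = 𝟙 (fin n) := by
  funext a
  simp [position]
  rfl

theorem position_comp_position {n : ℕ} (w u : List (Fin n)) (hw : w.Perm (List.finRange n)) :
    position w ≫ position u =
      position (u.map fun j : Fin n => w[j]'(by rw [hw.length_eq]; simp)) := by
  have hlen : w.length = n := by simpa using hw.length_eq
  have hnd : w.Nodup := hw.nodup_iff.2 (List.nodup_finRange _)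
  funext a
  have ha : w.idxOf a < n :=
    (List.idxOf_lt_length_iff.2 (hw.mem_iff.2 (List.mem_finRange a))).trans_eq hlen
  have h1 : position w a = some (⟨w.idxOf a, ha⟩ : Fin n) := by simp [position, ha]
  have h2 : (u.map fun j : Fin n => w[j]'(by rw [hw.length_eq]; simp)).idxOf a =
      u.idxOf (⟨w.idxOf a, ha⟩ : Fin n) := by
    have key : ∀ j : Fin n, w[j]'(by rw [hlen]; exact j.2) = a ↔
        j = (⟨w.idxOf a, ha⟩ : Fin n) := by
      intro j
      constructor
      · rintro rfl
        exact Fin.ext (hnd.idxOf_getElem _ _).symm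
      · rintro rfl
        exact List.getElem_idxOf _
    conv_lhs => unfold List.idxOf
    conv_rhs => unfold List.idxOf
    rw [List.findIdx_map]
    congr 1
    funext j
    simp only [Function.comp_apply, beq_eq_decide, decide_eq_decide]
    exact key j
  rw [comp_apply, h1, Option.bind_some]
  simp only [position, h2]

theorem map_getElem_finRange {n : ℕ} (w : List (Fin n)) (hw : w.length = n) :
    ((List.finRange n).map fun j : Fin n => w[j]'(by rw [hw]; exact j.2)) = w := by
  apply List.ext_getElem <;> simp [hw]

/-- The function on words whose value on a permutation `w` of `[n]` is the inverse image of an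
element of `F [n]`. -/
def wordValue {n : ℕ} (x : F.obj (op (fin n))) (w : List (Fin n)) : F.obj (op (fin n)) :=
  (F.map (position w).op).hom x

variable {F}

theorem wordValue_finRange {n : ℕ} (x : F.obj (op (fin n))) :
    wordValue F x (List.finRange n) = x := by
  rw [wordValue, position_finRange]
  simp

theorem wordValue_wordValue {n : ℕ} (x : F.obj (op (fin n))) (w u : List (Fin n))
    (hw : w.Perm (List.finRange n)) :
    wordValue F (wordValue F x u) w =
      wordValue F x (u.map fun j : Fin n => w[j]'(by rw [hw.length_eq]; simp)) := by
  rw [wordValue, wordValue, wordValue, ← position_comp_position w u hw, op_comp, F.map_comp]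
  rfl

theorem map_wordValue {F' : FinPartᵒᵖ ⥤ ModuleCat.{u} k} (τ : F ⟶ F') {n : ℕ}
    (x : F.obj (op (fin n))) (w : List (Fin n)) :
    (τ.app _).hom (wordValue F x w) = wordValue F' ((τ.app _).hom x) w :=
  congr($(τ.naturality (position w).op).hom x)

variable (F) in
/-- The Dynkin operator: the transpose of the map that takes a word to its iterated bracket. -/
def dynkin (n : ℕ) : F.obj (op (fin (n + 1))) →ₗ[k] F.obj (op (fin (n + 1))) where
  toFun x := bracketExpand (fun _ => False) n (wordValue F x) (List.finRange (n + 1))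
  map_add' x y := by
    rw [← bracketExpand_add]
    congr 1
    funext w
    simp [wordValue]
  map_smul' c x := by
    have := map_bracketExpand (fun _ => False) (LinearMap.lsmul k _ c).toAddMonoidHom n
      (wordValue F x) (List.finRange (n + 1))
    refine Eq.trans ?_ this.symm
    congr 1
    funext w
    simp [wordValue]

theorem wordValue_dynkin (n : ℕ) (x : F.obj (op (fin (n + 1)))) (w : List (Fin (n + 1)))
    (hw : w.Perm (List.finRange (n + 1))) :
    wordValue F (dynkin F n x) w = bracketExpand (fun _ => False) n (wordValue F x) w := by
  have h := map_bracketExpand (fun _ => False) (F.map (position w).op).hom.toAddMonoidHom n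
      (wordValue F x) (List.finRange (n + 1))
  refine h.trans ?_
  conv_rhs => rw [← map_getElem_finRange w (by simpa using hw.length_eq), bracketExpand_map]
  congr 1
  funext u
  exact wordValue_wordValue x w u hw

theorem dynkin_mem_harrison (n : ℕ) (x : F.obj (op (fin (n + 1)))) :
    dynkin F n x ∈ harrison F (n + 1) := by
  intro s t hs ht hst
  rw [← shuffleSum_bracketExpand (fun _ => False) n (wordValue F x) s t hs ht
    (by simpa using hst.length_eq)]
  exact shuffleSum_congr _ _ _ _ fun w hw => wordValue_dynkin n x w (hw.trans hst)

/-- The theorem of Dynkin, Specht and Wever: the Dynkin operator on `F [n + 1]` is multiplication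
by `n + 1` on the elements vanishing on shuffles. -/
theorem dynkin_of_mem_harrison (n : ℕ) (x : F.obj (op (fin (n + 1))))
    (hx : x ∈ harrison F (n + 1)) : dynkin F n x = (n + 1 : ℕ) • x := by
  have h : ∀ a ∈ List.finRange (n + 1),
      bracketExpand (fun y => y = a) n (wordValue F x) (List.finRange (n + 1)) = x := by
    intro a _
    rw [bracketExpand_eq_self, wordValue_finRange]
    · exact hx
    · simp
    · exact List.count_eq_one_of_mem (List.nodup_finRange _) (List.mem_finRange a)
  change bracketExpand (fun _ => False) n (wordValue F x) (List.finRange (n + 1)) = _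
  rw [bracketExpand_false n _ _ (List.nodup_finRange _) (by simp), List.map_congr_left h]
  simp

theorem map_dynkin {F' : FinPartᵒᵖ ⥤ ModuleCat.{u} k} (τ : F ⟶ F') (n : ℕ)
    (x : F.obj (op (fin (n + 1)))) :
    (τ.app _).hom (dynkin F n x) = dynkin F' n ((τ.app _).hom x) := by
  refine (map_bracketExpand _ (τ.app _).hom.toAddMonoidHom n _ _).trans ?_
  change bracketExpand _ n _ _ = bracketExpand _ n _ _
  congr 1
  funext u
  exact map_wordValue τ x u

variable (F) in
/-- The projection to the elements vanishing on shuffles, in characteristic zero. -/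
def harrisonProj (n : ℕ) : F.obj (op (fin (n + 1))) →ₗ[k] harrison F (n + 1) :=
  (((n + 1 : ℕ) : k)⁻¹ • dynkin F n).codRestrict _
    fun x => Submodule.smul_mem _ _ (dynkin_mem_harrison n x)

theorem harrisonProj_coe [CharZero k] (n : ℕ) (x : harrison F (n + 1)) : harrisonProj F n x = x := by
  apply Subtype.ext
  change ((n + 1 : ℕ) : k)⁻¹ • dynkin F n x.1 = x.1
  rw [dynkin_of_mem_harrison n x.1 x.2, ← Nat.cast_smul_eq_nsmul k, smul_smul,
    inv_mul_cancel₀ (Nat.cast_ne_zero.2 (Nat.succ_ne_zero n)), one_smul]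

theorem harrisonMap_harrisonProj {F' : FinPartᵒᵖ ⥤ ModuleCat.{u} k} (τ : F ⟶ F') (n : ℕ)
    (x : F.obj (op (fin (n + 1)))) :
    harrisonMap τ (n + 1) (harrisonProj F n x) = harrisonProj F' n ((τ.app _).hom x) := by
  apply Subtype.ext
  change (τ.app _).hom (((n + 1 : ℕ) : k)⁻¹ • dynkin F n x) = ((n + 1 : ℕ) : k)⁻¹ • dynkin F' n _
  rw [map_smul, map_dynkin]

end FinPart

/-! ### The Harrison complexes of the functors of functions -/

namespace FinPart

/-- A map, viewed as a partial map. -/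
def ofFun {Z : Type} [Finite Z] {X : FinPart} (g : Z → X) : FinPart.of Z ⟶ X := fun z => some (g z)

section Extend

variable {l : ℕ} {V : Type*} [Zero V]

open Classical in
/-- The extension by zero of a function on maps to a function on partial maps. -/
noncomputable def extendZero {X : FinPart} (c : (Fin l → X) → V) (g : fin l ⟶ X) : V :=
  if h : ∀ z : Fin l, (g z).isSome then c fun z => (g z).get (h z) else 0

theorem extendZero_of_isSome {X : FinPart} (c : (Fin l → X) → V) (g : fin l ⟶ X)
    (g' : Fin l → X) (h : ∀ z : Fin l, g z = some (g' z)) : extendZero c g = c g' := by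
  have h' : ∀ z : Fin l, (g z).isSome := fun z => by rw [h z]; rfl
  rw [extendZero, dif_pos h']
  congr 1
  funext z
  simp [h z]

theorem extendZero_of_eq_none {X : FinPart} (c : (Fin l → X) → V) (g : fin l ⟶ X)
    (z : Fin l) (h : g z = none) : extendZero c g = 0 := by
  rw [extendZero, dif_neg]
  intro h'
  simpa [h] using h' z

theorem extendZero_extendZero {X Y : FinPart} (c : (Fin l → Y) → V) (f : X ⟶ Y) (g : fin l ⟶ X) :
    extendZero (fun g' => extendZero c (ofFun g' ≫ f)) g = extendZero c (g ≫ f) := by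
  by_cases h : ∀ z : Fin l, (g z).isSome
  · rw [extendZero_of_isSome _ g (fun z => (g z).get (h z)) (fun z => by simp)]
    congr 1
    funext z
    rw [comp_apply, comp_apply]
    simp [ofFun]
  · push Not at h
    obtain ⟨z, hz⟩ := h
    have hz' : g z = none := by simpa using hz
    rw [extendZero_of_eq_none _ g z hz', extendZero_of_eq_none _ _ z]
    rw [comp_apply, hz']
    rfl

end Extend

variable {k : Type u} [Field k] (V : ℕ → Type u) [∀ l, AddCommGroup (V l)] [∀ l, Module k (V l)]

variable (k) in
/-- The functor that sends a finite set `X` to the families of functions from the maps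
`[l] → X` to vector spaces `V l`, where `l ≥ 0`. The inverse image along a partial map `f` is the
composition with `f`, with value zero at maps whose composition with `f` is not everywhere
defined. -/
noncomputable def coFun : FinPartᵒᵖ ⥤ ModuleCat.{u} k where
  obj X := ModuleCat.of k (∀ l, (Fin l → X.unop) → V l)
  map {X Y} f := ModuleCat.ofHom
    { toFun := fun c l g => extendZero (c l) (ofFun g ≫ f.unop)
      map_add' := fun c c' => by
        funext l g
        simp only [extendZero, Pi.add_apply]
        split_ifs <;> simp
      map_smul' := fun a c => by
        funext l g
        simp only [extendZero, Pi.smul_apply, RingHom.id_apply]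
        split_ifs <;> simp }
  map_id X := by
    refine ModuleCat.hom_ext (LinearMap.ext fun c => funext fun l => funext fun g => ?_)
    exact extendZero_of_isSome _ _ _ fun _ => rfl
  map_comp f f' := by
    refine ModuleCat.hom_ext (LinearMap.ext fun c => funext fun l => funext fun g => ?_)
    exact (extendZero_extendZero (c l) f.unop (ofFun g ≫ f'.unop)).symm

variable {V}

/-- The elements of `coFun k V` on `[n]`. -/
abbrev CoFam (V : ℕ → Type u) (n : ℕ) : Type u := ∀ l, (Fin l → Fin n) → V l

/-- The value at `g` of the inverse image of a family of functions under the permutation `w`. -/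
noncomputable def coWord {n : ℕ} (c : CoFam V n) (l : ℕ) (g : Fin l → Fin n) (w : List (Fin n)) :
    V l :=
  extendZero (X := fin n) (c l) (ofFun (X := fin n) g ≫ position w)

theorem idxOf_lt {n : ℕ} {w : List (Fin n)} (hw : w.Perm (List.finRange n)) (a : Fin n) :
    w.idxOf a < n :=
  (List.idxOf_lt_length_iff.2 (hw.mem_iff.2 (List.mem_finRange a))).trans_eq
    (by simpa using hw.length_eq)

theorem coWord_of_perm {n : ℕ} (c : CoFam V n) (w : List (Fin n))
    (hw : w.Perm (List.finRange n)) (l : ℕ) (g : Fin l → Fin n) :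
    coWord c l g w = c l fun z => ⟨w.idxOf (g z), idxOf_lt hw _⟩ := by
  refine extendZero_of_isSome _ _ _ fun z => ?_
  rw [comp_apply]
  change position w (g z) = _
  rw [position, dif_pos (idxOf_lt hw _)]

theorem coWord_finRange {n : ℕ} (c : CoFam V n) (l : ℕ) (g : Fin l → Fin n) :
    coWord c l g (List.finRange n) = c l g := by
  rw [coWord_of_perm _ _ (.refl _)]
  simp

theorem shuffleSum_apply {ι : Type*} {E : ι → Type*} [∀ i, AddCommGroup (E i)] {α : Type*}
    (F : List α → ∀ i, E i) (s t : List α) (i : ι) :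
    shuffleSum F s t i = shuffleSum (fun w => F w i) s t :=
  map_shuffleSum (Pi.evalAddMonoidHom E i) F s t

theorem mem_harrison_coFun_iff {n : ℕ} (c : CoFam V n) :
    c ∈ harrison (coFun k V) n ↔ ∀ (l : ℕ) (g : Fin l → Fin n) (s t : List (Fin n)),
      s ≠ [] → t ≠ [] → (s ++ t).Perm (List.finRange n) → shuffleSum (coWord c l g) s t = 0 := by
  have key : ∀ (l : ℕ) (g : Fin l → Fin n) (s t : List (Fin n)),
      shuffleSum (fun w => ((coFun k V).map (position w).op).hom c) s t l g =
        shuffleSum (coWord c l g) s t := fun l g s t =>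
    (congrFun (shuffleSum_apply (E := fun l => (Fin l → Fin n) → V l) _ s t l) g).trans
      (shuffleSum_apply _ s t g)
  constructor
  · intro hc l g s t hs ht hst
    rw [← key]
    exact congrFun (congrFun (hc s t hs ht hst) l) g
  · intro h s t hs ht hst
    funext l g
    exact (key l g s t).trans (h l g s t hs ht hst)

/-- For nonempty `[l]`, a family of functions vanishing on shuffles is determined by its values at
the maps `g` with `g 0 = 0`. -/
theorem harrison_coFun_eq_zero {n : ℕ} {c : CoFam V (n + 1)}
    (hc : c ∈ harrison (coFun k V) (n + 1)) (l : ℕ)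
    (h0 : ∀ g : Fin (l + 1) → Fin (n + 1), g 0 = 0 → c (l + 1) g = 0)
    (g : Fin (l + 1) → Fin (n + 1)) : c (l + 1) g = 0 := by
  rw [← coWord_finRange c]
  refine eq_zero_of_shuffleSum_eq_zero (fun y => y = g 0) _ (List.finRange (n + 1))
    (fun s t hs ht hst => (mem_harrison_coFun_iff c).1 hc _ g s t hs ht hst)
    (fun a v ha hp => ?_) (List.finRange (n + 1)) (.refl _) ⟨g 0, List.mem_finRange _, rfl⟩
  subst ha
  rw [coWord_of_perm _ _ hp]
  refine h0 _ (Fin.ext ?_)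
  simp

/-- The family of functions vanishing on shuffles which agrees with `c` at the maps `g` with
`g 0 = 0`. Its value at `g` is computed by means of the brackets of the words beginning
with the letter `g 0`. -/
noncomputable def lieExtend (n : ℕ) (c : CoFam V (n + 1)) (l : ℕ)
    (g : Fin (l + 1) → Fin (n + 1)) : V (l + 1) :=
  bracketExpand (fun y => y = g 0) n (coWord c (l + 1) g) (List.finRange (n + 1))

theorem lieExtend_of_eq_zero (n : ℕ) (c : CoFam V (n + 1)) (l : ℕ)
    (g : Fin (l + 1) → Fin (n + 1)) (hg : g 0 = 0) : lieExtend n c l g = c (l + 1) g := by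
  have h := bracketExpand_cons (fun y => y = g 0) n
    (coWord c (l + 1) g) 0 ((List.finRange n).map Fin.succ) hg.symm
    (by simp [hg]) (by simp)
  rw [← List.finRange_succ] at h
  exact h.trans (coWord_finRange _ _ _)

theorem shuffleSum_lieExtend (n : ℕ) (c : CoFam V (n + 1)) (l : ℕ)
    (g : Fin (l + 1) → Fin (n + 1)) (s t : List (Fin (n + 1))) (hs : s ≠ []) (ht : t ≠ [])
      (hst : (s ++ t).Perm (List.finRange (n + 1))) :
    shuffleSum (fun w => extendZero (X := fin (n + 1)) (lieExtend n c l)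
      (ofFun (X := fin (n + 1)) g ≫ position w)) s t = 0 := by
  rw [← shuffleSum_bracketExpand (fun y => y = g 0) n (coWord c (l + 1) g) s t hs ht
    (by simpa using hst.length_eq)]
  refine shuffleSum_congr _ _ _ _ fun w hw => ?_
  have hw := hw.trans hst
  have hlen : w.length = n + 1 := by simpa using hw.length_eq
  rw [extendZero_of_isSome _ _ (fun z => (⟨w.idxOf (g z), idxOf_lt hw _⟩ : Fin (n + 1)))]
  · have hnd : w.Nodup := hw.nodup_iff.2 (List.nodup_finRange _)
    conv_rhs => rw [← map_getElem_finRange w hlen, bracketExpand_map]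
    have hA : (fun x : Fin (n + 1) => w[x]'(by rw [hlen]; exact x.2) = g 0) =
        fun x : Fin (n + 1) => x = ⟨w.idxOf (g 0), idxOf_lt hw _⟩ := by
      funext x
      apply propext
      constructor
      · intro h
        rw [← h]
        exact Fin.ext (hnd.idxOf_getElem _ _).symm
      · rintro rfl
        exact List.getElem_idxOf _
    have hF : (coWord c (l + 1) fun z => ⟨w.idxOf (g z), idxOf_lt hw _⟩) =
        fun u => coWord c (l + 1) g
          (u.map fun j : Fin (n + 1) => w[j]'(by rw [hlen]; exact j.2)) := by
      funext u
      rw [coWord, coWord, ← position_comp_position w u hw]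
      congr 1
      funext z
      change _ = (position w (g z)).bind _
      rw [position, dif_pos (idxOf_lt hw _)]
      rfl
    unfold lieExtend
    rw [hF]
    congr 1
    exact hA.symm
  · intro z
    change position w (g z) = _
    rw [position, dif_pos (idxOf_lt hw _)]

end FinPart

namespace FinPart

variable {k : Type u} [Field k] {V : ℕ → Type u} [∀ l, AddCommGroup (V l)] [∀ l, Module k (V l)]

theorem shuffleSum_const_singleton {α E : Type*} [AddCommGroup E] (x : E) (a : α) (t : List α) :
    shuffleSum (fun _ => x) [a] t = if Even t.length then x else 0 := by
  induction t with
  | nil => simp [shuffleSum]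
  | cons b t ih =>
    rw [shuffleSum_cons_cons, ih, shuffleSum_nil_left]
    by_cases h : Even t.length <;> simp [h, Nat.even_add_one]

theorem shuffleSum_const_pair {α E : Type*} [AddCommGroup E] (x : E) (a b : α) (t : List α) :
    shuffleSum (fun _ => x) [a, b] t = (t.length / 2 + 1) • x := by
  induction t with
  | nil => simp [shuffleSum]
  | cons c t ih =>
    rw [shuffleSum_cons_cons, ih, shuffleSum_const_singleton]
    by_cases h : Even t.length
    · have : (t.length + 1) / 2 = t.length / 2 := by
        obtain ⟨m, hm⟩ := h
        omega
      simp [h, Nat.even_add_one, this]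
    · have : (t.length + 1) / 2 = t.length / 2 + 1 := by
        obtain ⟨m, hm⟩ := Nat.not_even_iff_odd.1 h
        omega
      simp [h, Nat.even_add_one, this, add_smul]
      abel

/-- The component with `l = 0` of an element of `coFun k V` on `[n]` is a constant function of the
order on `[n]`. In characteristic zero, such a function cannot vanish on shuffles if `n ≥ 3`. -/
theorem harrison_coFun_zero_eq_zero [CharZero k] {n : ℕ} {c : CoFam V (n + 3)}
    (hc : c ∈ harrison (coFun k V) (n + 3)) (g : Fin 0 → Fin (n + 3)) : c 0 g = 0 := by
  have hconst : ∀ s t : List (Fin (n + 3)), (s ++ t).Perm (List.finRange (n + 3)) →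
      shuffleSum (coWord c 0 g) s t = shuffleSum (fun _ => c 0 g) s t := by
    intro s t hst
    refine shuffleSum_congr _ _ _ _ fun w hw => ?_
    rw [coWord_of_perm _ _ (hw.trans hst)]
    exact congrArg _ (Subsingleton.elim _ _)
  have key : ∀ s t : List (Fin (n + 3)), s ++ t = List.finRange (n + 3) → s ≠ [] → t ≠ [] →
      shuffleSum (fun _ => c 0 g) s t = 0 := by
    intro s t h hs ht
    rw [← hconst s t (by rw [h]), (mem_harrison_coFun_iff c).1 hc 0 g s t hs ht (by rw [h])]
  rw [List.finRange_succ, List.finRange_succ] at key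
  simp only [List.map_cons] at key
  by_cases hn : Even n
  · have h := key [_] _ rfl (by simp) (by simp)
    rw [shuffleSum_const_singleton, if_pos] at h
    · exact h
    · simpa [Nat.even_add_one] using hn
  · have h := key [_, _] _ rfl (by simp) (by simp [List.finRange_succ])
    rw [shuffleSum_const_pair, ← Nat.cast_smul_eq_nsmul k] at h
    exact (smul_eq_zero.1 h).resolve_left (Nat.cast_ne_zero.2 (Nat.succ_ne_zero _))

/-- The Hochschild differential of a family of functions. -/
noncomputable def coHochschild (n : ℕ) (c : CoFam V n) : CoFam V (n + 1) := fun l g =>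
  ∑ i ∈ Finset.range (n + 2), (-1 : ℤ) ^ i •
    extendZero (X := fin n) (c l) (ofFun (X := fin (n + 1)) g ≫ face n i)

theorem hochschild_coFun {n : ℕ} (c : CoFam V n) :
    hochschild (coFun k V) n c = coHochschild n c := by
  funext l g
  have h := hochschild_apply (coFun k V) n c
  refine (congrFun (congrFun h l) g).trans ?_
  refine (congrFun (Finset.sum_apply l _ _) g).trans ?_
  exact Finset.sum_apply g _ _

theorem coHochschild_mem_harrison {n : ℕ} {c : CoFam V n} (hc : c ∈ harrison (coFun k V) n) :
    coHochschild n c ∈ harrison (coFun k V) (n + 1) := by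
  rw [← hochschild_coFun (k := k)]
  exact hochschild_mem_harrison _ _ _ hc

/-- The map `[l + 1] → [n + 1]` that takes `0` to `0`, and `z + 1` to the successor of
`g (z + 1)`. -/
def cone {l n : ℕ} (g : Fin (l + 1) → Fin n) : Fin (l + 1) → Fin (n + 1) :=
  Fin.cons 0 fun z => (g z.succ).succ

theorem cone_zero {l n : ℕ} (g : Fin (l + 1) → Fin n) : cone g 0 = 0 := rfl

/-- The values at `g`, for `l > 0` and `g 0 = 0`, of the contraction of the Harrison complex. -/
def coneFam (n : ℕ) (c : CoFam V (n + 2)) : CoFam V (n + 1)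
  | 0, _ => 0
  | _ + 1, g => -c _ (cone g)

/-- The contraction of the Harrison complex of `coFun k V`. For `l > 0` an element of the complex is
determined by its values at the maps `g` with `g 0 = 0`, and the contraction is the extra
degeneracy `coneFam`, extended to all maps. For `l = 0` the complex is concentrated on `[1]` and
`[2]`, where the differential is an isomorphism. -/
noncomputable def contrFun (n : ℕ) (c : CoFam V (n + 2)) : CoFam V (n + 1)
  | 0, _ => if n = 0 then c 0 Fin.elim0 else 0
  | l + 1, g => lieExtend n (coneFam n c) l g

theorem contrFun_zero (n : ℕ) (c : CoFam V (n + 2)) (g : Fin 0 → Fin (n + 1)) :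
    contrFun n c 0 g = if n = 0 then c 0 Fin.elim0 else 0 := rfl

theorem contrFun_succ (n : ℕ) (c : CoFam V (n + 2)) (l : ℕ) (g : Fin (l + 1) → Fin (n + 1)) :
    contrFun n c (l + 1) g = lieExtend n (coneFam n c) l g := rfl

theorem contrFun_mem_harrison (n : ℕ) (c : CoFam V (n + 2)) :
    contrFun n c ∈ harrison (coFun k V) (n + 1) := by
  rw [mem_harrison_coFun_iff]
  intro l g s t hs ht hst
  match l with
  | 0 =>
    rw [shuffleSum_congr _ (fun _ => 0), shuffleSum_zero]
    intro w hw
    rw [coWord_of_perm _ _ (hw.trans hst), contrFun_zero, if_neg]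
    rintro rfl
    have h0 := hst.length_eq
    have h1 := List.length_pos_iff.2 hs
    have h2 := List.length_pos_iff.2 ht
    simp at h0
    omega
  | l + 1 => exact shuffleSum_lieExtend n (coneFam n c) l g s t hs ht hst

theorem map_contrFun {V' : ℕ → Type u} [∀ l, AddCommGroup (V' l)] (φ : ∀ l, V l →+ V' l) (n : ℕ)
    (c : CoFam V (n + 2)) (l : ℕ) (g : Fin l → Fin (n + 1)) :
    φ l (contrFun n c l g) = contrFun n (fun l g => φ l (c l g)) l g := by
  match l with
  | 0 =>
    simp only [contrFun]
    split_ifs <;> simp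
  | l + 1 =>
    refine (map_bracketExpand _ (φ (l + 1)) n _ _).trans ?_
    change bracketExpand _ n _ _ = bracketExpand _ n _ _
    congr 1
    funext w
    simp only [coWord, extendZero]
    split_ifs
    · simp [coneFam]
    · simp

theorem face_succ (n i : ℕ) (hi : 0 < i) (a : Fin (n + 1)) :
    face (n + 1) (i + 1) (a.succ : Fin (n + 2)) =
      Option.map (Fin.succ : Fin n → Fin (n + 1)) (face n i a) := by
  simp only [face, Fin.val_succ]
  split_ifs <;> first | omega | rfl | skip
  · refine congrArg some (Fin.ext ?_)
    simp only [Fin.val_succ]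
    omega

theorem face_zero (n i : ℕ) (hi : 0 < i) : face (n + 1) i (0 : Fin (n + 2)) =
    some (0 : Fin (n + 1)) := by
  simp [face, hi]

theorem face_one_succ (n : ℕ) (a : Fin (n + 1)) :
    face (n + 1) 1 (a.succ : Fin (n + 2)) = some a := by
  simp [face]

theorem extendZero_contrFun (n i : ℕ) (hi : 0 < i) (c : CoFam V (n + 2)) (l : ℕ)
    (g : Fin (l + 1) → Fin (n + 2)) (hg : g 0 = 0) :
    extendZero (X := fin (n + 1)) (contrFun n c (l + 1))
        (ofFun (X := fin (n + 2)) g ≫ face (n + 1) i) =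
      -extendZero (X := fin (n + 2)) (c (l + 1))
        (ofFun (X := fin (n + 3)) (cone g) ≫ face (n + 2) (i + 1)) := by
  by_cases h : ∀ z, (face (n + 1) i (g z)).isSome
  · have h0 : ∀ z, face (n + 1) i (g z) = some ((face (n + 1) i (g z)).get (h z)) := by simp
    set g' : Fin (l + 1) → Fin (n + 1) := fun z => (face (n + 1) i (g z)).get (h z) with hg'
    have hg0 : g' 0 = 0 := by
      have := h0 0
      have h1 : face (n + 1) i (g 0) = some (0 : Fin (n + 1)) := by rw [hg]; exact face_zero _ _ hi
      exact Option.some_injective _ (this.symm.trans h1)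
    rw [extendZero_of_isSome _ _ g' h0, extendZero_of_isSome _ _ (cone g'), contrFun,
      lieExtend_of_eq_zero _ _ _ _ hg0]
    · rfl
    · intro z
      refine Fin.cases ?_ (fun z => ?_) z
      · exact (face_zero (n + 1) (i + 1) (by omega)).trans (congrArg some (by rfl))
      · change face (n + 2) (i + 1) (Fin.succ _) = _
        rw [face_succ _ _ hi, h0]
        rfl
  · push Not at h
    obtain ⟨z, hz⟩ := h
    have hz : face (n + 1) i (g z) = none := by simpa using hz
    rw [extendZero_of_eq_none _ _ z hz, extendZero_of_eq_none _ _ z, neg_zero]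
    revert hz
    refine Fin.cases ?_ (fun z => ?_) z
    · intro hz
      rw [hg, face_zero _ _ hi] at hz
      cases hz
    · intro hz
      change face (n + 2) (i + 1) (Fin.succ _) = _
      rw [face_succ _ _ hi, hz]
      rfl

theorem extendZero_face_zero {n l : ℕ} (c : (Fin (l + 1) → Fin n) → V (l + 1))
    (g : Fin (l + 1) → Fin (n + 1)) (hg : g 0 = 0) :
    extendZero (X := fin n) c (ofFun (X := fin (n + 1)) g ≫ face n 0) = 0 := by
  refine extendZero_of_eq_none _ _ 0 ?_
  change face n 0 (g 0) = none
  rw [hg]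
  simp [face]

theorem extendZero_cone_face_one {n l : ℕ} (c : (Fin (l + 1) → Fin (n + 1)) → V (l + 1))
    (g : Fin (l + 1) → Fin (n + 1)) (hg : g 0 = 0) :
    extendZero (X := fin (n + 1)) c (ofFun (X := fin (n + 2)) (cone g) ≫ face (n + 1) 1) = c g := by
  refine extendZero_of_isSome (X := fin (n + 1)) _ _ g fun z => ?_
  refine Fin.cases ?_ (fun z => ?_) z
  · rw [hg]
    exact face_zero _ _ one_pos
  · exact face_one_succ _ _

theorem coHochschild_cone {n : ℕ} (c : CoFam V (n + 1)) (l : ℕ) (g : Fin (l + 1) → Fin (n + 1))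
    (hg : g 0 = 0) : coHochschild (n + 1) c (l + 1) (cone g) =
      (∑ i ∈ Finset.range (n + 1), (-1 : ℤ) ^ i • extendZero (X := fin (n + 1)) (c (l + 1))
        (ofFun (X := fin (n + 2)) (cone g) ≫ face (n + 1) (i + 2))) - c (l + 1) g := by
  rw [coHochschild, Finset.sum_range_succ', Finset.sum_range_succ',
    extendZero_face_zero _ _ (cone_zero g), smul_zero, add_zero]
  simp only [zero_add, extendZero_cone_face_one _ _ hg, pow_succ, mul_neg, mul_one, neg_neg,
    neg_smul, sub_eq_add_neg, pow_zero, one_smul]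

theorem coHochschild_zero {n : ℕ} (c : CoFam V n) (g : Fin 0 → Fin (n + 1)) :
    coHochschild n c 0 g =
      (∑ i ∈ Finset.range (n + 2), (-1 : ℤ) ^ i) • c 0 Fin.elim0 := by
  rw [coHochschild, Finset.sum_smul]
  refine Finset.sum_congr rfl fun i _ => ?_
  rw [extendZero_of_isSome _ _ Fin.elim0 (fun z => z.elim0)]

/-- The Harrison complex of `coFun k V` is contracted by `contrFun` in degrees greater than one. -/
theorem contr_homotopy [CharZero k] (n : ℕ) (c : CoFam V (n + 2))
    (hc : c ∈ harrison (coFun k V) (n + 2)) :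
    coHochschild (n + 1) (contrFun n c) +
      contrFun (n + 1) (coHochschild (n + 2) c) = c := by
  have h1 := coHochschild_mem_harrison (contrFun_mem_harrison (k := k) n c)
  have h2 := contrFun_mem_harrison (k := k) (n + 1) (coHochschild (n + 2) c)
  rw [← sub_eq_zero]
  funext l g
  match l with
  | l + 1 =>
    refine harrison_coFun_eq_zero (Submodule.sub_mem _ (Submodule.add_mem _ h1 h2) hc) l ?_ g
    intro g hg
    change coHochschild (n + 1) (contrFun n c) (l + 1) g +
      contrFun (n + 1) (coHochschild (n + 2) c) (l + 1) g -
        c (l + 1) g = 0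
    rw [contrFun_succ, lieExtend_of_eq_zero _ _ _ _ hg, coneFam, coHochschild_cone _ _ _ hg,
      coHochschild, Finset.sum_range_succ', extendZero_face_zero _ _ hg, smul_zero,
      add_zero]
    have : ∀ i, (-1 : ℤ) ^ (i + 1) • extendZero (X := fin (n + 1)) (contrFun n c (l + 1))
        (ofFun (X := fin (n + 2)) g ≫ face (n + 1) (i + 1)) =
        (-1 : ℤ) ^ i • extendZero (X := fin (n + 2)) (c (l + 1))
          (ofFun (X := fin (n + 3)) (cone g) ≫ face (n + 2) (i + 2)) := by
      intro i
      rw [extendZero_contrFun _ _ (Nat.succ_pos i) _ _ _ hg]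
      simp [pow_succ]
    simp only [this]
    abel
  | 0 =>
    change coHochschild (n + 1) (contrFun n c) 0 g +
      contrFun (n + 1) (coHochschild (n + 2) c) 0 g - c 0 g = 0
    rw [coHochschild_zero, contrFun_zero, contrFun_zero, if_neg (Nat.succ_ne_zero n),
      Subsingleton.elim g Fin.elim0]
    match n with
    | 0 => simp [Finset.sum_range_succ]
    | n + 1 => rw [harrison_coFun_zero_eq_zero hc]; simp

/-- In degree one, the contraction leaves the component with `l = 1`, i.e. the cohomology of the
Harrison complex is `V 1`. -/
theorem contr_homotopy_zero (c : CoFam V 1) :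
    contrFun 0 (coHochschild 1 c) =
      fun l g => if l = 1 then 0 else c l g := by
  funext l g
  match l with
  | l + 1 =>
    have hg : g 0 = 0 := Subsingleton.elim (α := Fin 1) _ _
    rw [contrFun_succ, lieExtend_of_eq_zero _ _ _ _ hg, coneFam, coHochschild_cone _ _ _ hg]
    simp only [zero_add, Finset.range_one, Finset.sum_singleton, pow_zero, one_smul, neg_sub]
    match l with
    | 0 =>
      rw [if_pos rfl, sub_eq_zero]
      symm
      refine extendZero_of_isSome _ _ _ fun z => ?_
      obtain rfl : z = 0 := Subsingleton.elim (α := Fin 1) _ _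
      rw [hg]
      exact face_zero _ _ two_pos
    | l + 1 =>
      rw [if_neg (by omega), extendZero_of_eq_none _ _ 1, sub_zero]
      change face 1 2 (Fin.succ (g 1)) = none
      simp [face]
  | 0 =>
    rw [if_neg (by omega), contrFun_zero, coHochschild_zero, if_pos rfl,
      Subsingleton.elim g Fin.elim0]
    simp [Finset.sum_range_succ]

end FinPart

/-! ### Complete filtrations -/

section Filtration

variable {k : Type*} [Ring k]

/-- A filtration, thought of as decreasing, is complete if it is separated and if series whose
terms lie in the successive steps converge. -/
structure IsCompleteFiltration {E : Type*} [AddCommGroup E] [Module k E]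
    (F : ℕ → Submodule k E) : Prop where
  eq_zero : ∀ x, (∀ p, x ∈ F p) → x = 0
  exists_sum : ∀ y : ℕ → E, (∀ p, y p ∈ F p) → ∃ z, ∀ p, z - ∑ q ∈ Finset.range p, y q ∈ F p

/-- Successive approximation: a complex with complete filtrations is exact if the associated graded
complex is exact. -/
theorem exists_eq_of_filtration {A B C : Type*} [AddCommGroup A] [Module k A] [AddCommGroup B]
    [Module k B] [AddCommGroup C] [Module k C] (D : A →ₗ[k] B) (D' : B →ₗ[k] C)
    (hD : ∀ y, D' (D y) = 0) (FA : ℕ → Submodule k A) (FB : ℕ → Submodule k B)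
    (hA : IsCompleteFiltration FA) (hB : IsCompleteFiltration FB) (hB0 : ∀ x, x ∈ FB 0)
    (hF : ∀ p y, y ∈ FA p → D y ∈ FB p)
    (hgr : ∀ p x, x ∈ FB p → D' x = 0 → ∃ y ∈ FA p, x - D y ∈ FB (p + 1)) (x : B) (hx : D' x = 0) :
    ∃ y, D y = x := by
  choose Y hY hY' using hgr
  let X : ∀ p : ℕ, {x : B // x ∈ FB p ∧ D' x = 0} := fun p =>
    Nat.rec ⟨x, hB0 x, hx⟩ (fun p x => ⟨x.1 - D (Y p x.1 x.2.1 x.2.2), hY' p _ _ _, by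
      exact (map_sub _ _ _).trans (by rw [hD, sub_zero]; exact x.2.2)⟩) p
  let y : ℕ → A := fun p => Y p (X p).1 (X p).2.1 (X p).2.2
  have hX : ∀ p, (X (p + 1)).1 = (X p).1 - D (y p) := fun p => rfl
  have hsum : ∀ p, (X p).1 = x - D (∑ q ∈ Finset.range p, y q) := by
    intro p
    induction p with
    | zero => simp [X]
    | succ p ih => rw [hX, ih, Finset.sum_range_succ, map_add]; abel
  obtain ⟨z, hz⟩ := hA.exists_sum y fun p => hY p _ _ _
  refine ⟨z, sub_eq_zero.1 (hB.eq_zero _ fun p => ?_)⟩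
  have h1 := hF p _ (hz p)
  have h2 := (X p).2.1
  rw [hsum] at h2
  have h3 := (FB p).sub_mem h1 h2
  rw [map_sub] at h3
  convert h3 using 1
  abel

theorem IsCompleteFiltration.prod {A B : Type*} [AddCommGroup A] [Module k A] [AddCommGroup B]
    [Module k B] {FA : ℕ → Submodule k A} {FB : ℕ → Submodule k B} (hA : IsCompleteFiltration FA)
    (hB : IsCompleteFiltration FB) : IsCompleteFiltration fun p => (FA p).prod (FB p) where
  eq_zero x hx := Prod.ext (hA.eq_zero _ fun p => (hx p).1) (hB.eq_zero _ fun p => (hx p).2)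
  exists_sum y hy := by
    obtain ⟨z, hz⟩ := hA.exists_sum (fun p => (y p).1) fun p => (hy p).1
    obtain ⟨z', hz'⟩ := hB.exists_sum (fun p => (y p).2) fun p => (hy p).2
    refine ⟨(z, z'), fun p => ⟨?_, ?_⟩⟩
    · simpa [Prod.fst_sum] using hz p
    · simpa [Prod.snd_sum] using hz' p

theorem IsCompleteFiltration.pi {ι : Type*} {E : ι → Type*} [∀ i, AddCommGroup (E i)]
    [∀ i, Module k (E i)] {F : ∀ i, ℕ → Submodule k (E i)} (h : ∀ i, IsCompleteFiltration (F i)) :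
    IsCompleteFiltration fun p => Submodule.pi Set.univ fun i => F i p where
  eq_zero x hx := funext fun i => (h i).eq_zero _ fun p => hx p i trivial
  exists_sum y hy := by
    choose z hz using fun i => (h i).exists_sum (fun p => y p i) fun p => hy p i trivial
    refine ⟨z, fun p i _ => ?_⟩
    simpa using hz i p

/-- The elements of a product whose components in degrees `< p` vanish. -/
def degreeFiltration {ι : Type*} (E : ι → Type*) [∀ i, AddCommGroup (E i)]
    [∀ i, Module k (E i)] (deg : ι → ℕ) (p : ℕ) : Submodule k (∀ i, E i) where
  carrier := {x | ∀ i, deg i < p → x i = 0}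
  zero_mem' _ _ := rfl
  add_mem' hx hy i hi := by rw [Pi.add_apply, hx i hi, hy i hi, add_zero]
  smul_mem' c x hx i hi := by rw [Pi.smul_apply, hx i hi, smul_zero]

theorem isCompleteFiltration_degreeFiltration {ι : Type*} (E : ι → Type*)
    [∀ i, AddCommGroup (E i)] [∀ i, Module k (E i)] (deg : ι → ℕ) :
    IsCompleteFiltration (degreeFiltration (k := k) E deg) where
  eq_zero x hx := funext fun i => hx (deg i + 1) i (Nat.lt_succ_self _)
  exists_sum y hy := by
    refine ⟨fun i => ∑ q ∈ Finset.range (deg i + 1), y q i, fun p i hi => ?_⟩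
    rw [Pi.sub_apply, Finset.sum_apply, sub_eq_zero]
    refine Finset.sum_subset (Finset.range_subset_range.2 hi) fun q _ hq => hy q i ?_
    simpa using hq

/-- The filtration induced on a subspace is complete if the subspace is the kernel of a family of
filtered maps to complete spaces. -/
theorem IsCompleteFiltration.comap_subtype {E ι : Type*} {E' : ι → Type*} [AddCommGroup E]
    [Module k E] [∀ i, AddCommGroup (E' i)] [∀ i, Module k (E' i)] {F : ℕ → Submodule k E}
    (hF : IsCompleteFiltration F) {F' : ∀ i, ℕ → Submodule k (E' i)}
    (hF' : ∀ i, IsCompleteFiltration (F' i)) (T : ∀ i, E →+ E' i)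
    (hT : ∀ i p x, x ∈ F p → T i x ∈ F' i p) (S : Submodule k E) (hS : ∀ x, x ∈ S ↔ ∀ i, T i x = 0) :
    IsCompleteFiltration fun p => (F p).comap S.subtype where
  eq_zero x hx := Subtype.ext (hF.eq_zero _ fun p => hx p)
  exists_sum y hy := by
    obtain ⟨z, hz⟩ := hF.exists_sum (fun p => (y p).1) fun p => hy p
    refine ⟨⟨z, (hS z).2 fun i => (hF' i).eq_zero _ fun p => ?_⟩, fun p => ?_⟩
    · have h := hT i p _ (hz p)
      rw [map_sub, map_sum, Finset.sum_eq_zero fun q _ => (hS _).1 (y q).2 i, sub_zero] at h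
      exact h
    · simpa using hz p

end Filtration

/-! ### Quasi-isomorphisms of complexes of vector spaces -/

section QuasiIso

open CategoryTheory.Limits

variable {k : Type u} [Field k] {K L : CochainComplex (ModuleCat.{u} k) ℤ}

theorem d_d_apply (K : CochainComplex (ModuleCat.{u} k) ℤ) (i j l : ℤ) (x : K.X i) :
    (K.d j l).hom ((K.d i j).hom x) = 0 :=
  congr($(K.d_comp_d i j l).hom x)

theorem f_d_apply (f : K ⟶ L) (i j : ℤ) (x : K.X i) :
    (L.d i j).hom ((f.f i).hom x) = (f.f j).hom ((K.d i j).hom x) :=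
  congr($(f.comm i j).hom x)

/-- A morphism of complexes is a quasi-isomorphism if and only if its cone is acyclic. -/
theorem quasiIso_iff_cone_exact (f : K ⟶ L) : QuasiIso f ↔
    ∀ (j : ℤ) (a : K.X (j + 1)) (b : L.X j), (K.d (j + 1) (j + 1 + 1)).hom a = 0 →
      (f.f (j + 1)).hom a = (L.d j (j + 1)).hom b →
      ∃ (a' : K.X j) (b' : L.X (j - 1)), (K.d j (j + 1)).hom a' = a ∧
        b = (f.f j).hom a' + (L.d (j - 1) j).hom b' := by
  constructor
  · intro hf j a b ha hab
    have hmono : Mono (HomologicalComplex.homologyMap f (j + 1)) := inferInstance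
    have hepi : Epi (HomologicalComplex.homologyMap f j) := inferInstance
    rw [HomologicalComplex.mono_homologyMap_iff_up_to_refinements f j (j + 1) (j + 1 + 1) (by simp)
      (by simp)] at hmono
    rw [HomologicalComplex.epi_homologyMap_iff_up_to_refinements f (j - 1) j (j + 1) (by simp)
      (by simp)] at hepi
    obtain ⟨A, π, hπ, x, hx⟩ := hmono (ModuleCat.ofHom (LinearMap.toSpanSingleton k _ a))
      (ModuleCat.hom_ext (LinearMap.ext_ring (by simpa using ha)))
      (ModuleCat.ofHom (LinearMap.toSpanSingleton k _ b))
      (ModuleCat.hom_ext (LinearMap.ext_ring (by simpa using hab)))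
    obtain ⟨t, ht⟩ := (ModuleCat.epi_iff_surjective π).1 hπ (1 : k)
    have h1 : a = (K.d j (j + 1)).hom (x.hom t) := by
      have := congr(($hx).hom t)
      simp only [ModuleCat.hom_comp, LinearMap.comp_apply, ModuleCat.hom_ofHom] at this
      rw [← this, ht]
      simp
    have h2 : (L.d j (j + 1)).hom (b - (f.f j).hom (x.hom t)) = 0 := by
      rw [map_sub, f_d_apply, ← h1, hab, sub_self]
    obtain ⟨A', π', hπ', x', hx', y', hy'⟩ := hepi (ModuleCat.ofHom
      (LinearMap.toSpanSingleton k _ (b - (f.f j).hom (x.hom t))))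
      (ModuleCat.hom_ext (LinearMap.ext_ring (by simpa using h2)))
    obtain ⟨t', ht'⟩ := (ModuleCat.epi_iff_surjective π').1 hπ' (1 : k)
    have h3 : b - (f.f j).hom (x.hom t) =
        (f.f j).hom (x'.hom t') + (L.d (j - 1) j).hom (y'.hom t') := by
      have := congr(($hy').hom t')
      simp only [ModuleCat.hom_comp, LinearMap.comp_apply, ModuleCat.hom_ofHom,
        ModuleCat.hom_add, LinearMap.add_apply] at this
      rw [← this, ht']
      simp
    refine ⟨x.hom t + x'.hom t', y'.hom t', ?_, ?_⟩
    · rw [map_add, ← h1]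
      have := congr(($hx').hom t')
      simp only [ModuleCat.hom_comp, LinearMap.comp_apply] at this
      rw [this]
      simp
    · rw [map_add, add_assoc, ← h3]
      abel
  · intro h
    rw [quasiIso_iff]
    intro i
    rw [quasiIsoAt_iff_isIso_homologyMap]
    have hmono : Mono (HomologicalComplex.homologyMap f i) := by
      obtain ⟨j, rfl⟩ : ∃ j, i = j + 1 := ⟨i - 1, by omega⟩
      rw [HomologicalComplex.mono_homologyMap_iff_up_to_refinements f j (j + 1) (j + 1 + 1) (by simp)
        (by simp)]
      intro A x₂ hx₂ y₁ hy₁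
      have key : ∀ t : A, ∃ x : K.X j, (K.d j (j + 1)).hom x = x₂.hom t := fun t => by
        obtain ⟨a', _, ha', _⟩ := h j (x₂.hom t) (y₁.hom t) congr(($hx₂).hom t) congr(($hy₁).hom t)
        exact ⟨a', ha'⟩
      choose X hX using key
      refine ⟨ModuleCat.of k (A →₀ k), ModuleCat.ofHom (Finsupp.linearCombination k id),
        (ModuleCat.epi_iff_surjective _).2 (Finsupp.linearCombination_id_surjective k A),
        ModuleCat.ofHom (Finsupp.linearCombination k X), ?_⟩
      refine ModuleCat.hom_ext (Finsupp.lhom_ext fun t c => ?_)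
      simp [hX]
    have hepi : Epi (HomologicalComplex.homologyMap f i) := by
      rw [HomologicalComplex.epi_homologyMap_iff_up_to_refinements f (i - 1) i (i + 1) (by simp)
        (by simp)]
      intro A y₂ hy₂
      have key : ∀ t : A, ∃ (x : K.X i) (y : L.X (i - 1)), (K.d i (i + 1)).hom x = 0 ∧
          y₂.hom t = (f.f i).hom x + (L.d (i - 1) i).hom y := fun t =>
        h i 0 (y₂.hom t) (map_zero _) (by
          rw [map_zero]
          exact congr(($hy₂).hom t).symm)
      choose X Y hX hY using key
      refine ⟨ModuleCat.of k (A →₀ k), ModuleCat.ofHom (Finsupp.linearCombination k id),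
        (ModuleCat.epi_iff_surjective _).2 (Finsupp.linearCombination_id_surjective k A),
        ModuleCat.ofHom (Finsupp.linearCombination k X), ?_,
        ModuleCat.ofHom (Finsupp.linearCombination k Y), ?_⟩
      · refine ModuleCat.hom_ext (Finsupp.lhom_ext fun t c => ?_)
        simp [hX]
      · refine ModuleCat.hom_ext (Finsupp.lhom_ext' fun t => LinearMap.ext_ring ?_)
        simp [hY]
    exact isIso_of_mono_of_epi _

/-- A morphism of complexes with complete filtrations is a quasi-isomorphism if its cone is acyclic
up to terms of higher filtration. -/
theorem quasiIso_of_filtration (f : K ⟶ L) (FK : ∀ j, ℕ → Submodule k (K.X j))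
    (FL : ∀ j, ℕ → Submodule k (L.X j)) (hK : ∀ j, IsCompleteFiltration (FK j))
    (hL : ∀ j, IsCompleteFiltration (FL j)) (hK0 : ∀ j x, x ∈ FK j 0) (hL0 : ∀ j x, x ∈ FL j 0)
    (hdK : ∀ j p x, x ∈ FK j p → (K.d j (j + 1)).hom x ∈ FK (j + 1) p)
    (hdL : ∀ i j p x, i + 1 = j → x ∈ FL i p → (L.d i j).hom x ∈ FL j p)
    (hf : ∀ j p x, x ∈ FK j p → (f.f j).hom x ∈ FL j p)
    (hgr : ∀ j p (a : K.X (j + 1)) (b : L.X j), a ∈ FK (j + 1) p → b ∈ FL j p →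
      (K.d (j + 1) (j + 1 + 1)).hom a = 0 → (f.f (j + 1)).hom a = (L.d j (j + 1)).hom b →
      ∃ a' ∈ FK j p, ∃ b' ∈ FL (j - 1) p, a - (K.d j (j + 1)).hom a' ∈ FK (j + 1) (p + 1) ∧
        b - ((f.f j).hom a' + (L.d (j - 1) j).hom b') ∈ FL j (p + 1)) : QuasiIso f := by
  rw [quasiIso_iff_cone_exact]
  intro j a b ha hab
  let D : K.X j × L.X (j - 1) →ₗ[k] K.X (j + 1) × L.X j :=
    LinearMap.prod ((K.d j (j + 1)).hom ∘ₗ LinearMap.fst k _ _)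
      ((f.f j).hom ∘ₗ LinearMap.fst k _ _ + (L.d (j - 1) j).hom ∘ₗ LinearMap.snd k _ _)
  let D' : K.X (j + 1) × L.X j →ₗ[k] K.X (j + 1 + 1) × L.X (j + 1) :=
    LinearMap.prod ((K.d (j + 1) (j + 1 + 1)).hom ∘ₗ LinearMap.fst k _ _)
      ((f.f (j + 1)).hom ∘ₗ LinearMap.fst k _ _ - (L.d j (j + 1)).hom ∘ₗ LinearMap.snd k _ _)
  obtain ⟨⟨a', b'⟩, hy⟩ := exists_eq_of_filtration D D' (fun y => Prod.ext (d_d_apply _ _ _ _ _) (by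
      change (f.f (j + 1)).hom ((K.d j (j + 1)).hom y.1) -
        (L.d j (j + 1)).hom ((f.f j).hom y.1 + (L.d (j - 1) j).hom y.2) = 0
      rw [map_add, d_d_apply, f_d_apply, add_zero, sub_self]))
    (fun p => (FK j p).prod (FL (j - 1) p)) (fun p => (FK (j + 1) p).prod (FL j p))
    ((hK _).prod (hL _)) ((hK _).prod (hL _)) (fun x => ⟨hK0 _ _, hL0 _ _⟩)
    (fun p y hy => ⟨hdK _ _ _ hy.1, Submodule.add_mem _ (hf _ _ _ hy.1)
      (hdL _ _ _ _ (by omega) hy.2)⟩)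
    (fun p x hx hx' => by
      obtain ⟨a', ha', b', hb', h1, h2⟩ := hgr j p x.1 x.2 hx.1 hx.2 congr($(hx').1)
        (sub_eq_zero.1 congr($(hx').2))
      exact ⟨(a', b'), ⟨ha', hb'⟩, h1, h2⟩)
    (a, b) (Prod.ext ha (sub_eq_zero.2 hab))
  exact ⟨a', b', congr($(hy).1), congr($(hy).2).symm⟩

end QuasiIso

/-! ### The functor `H` preserves quasi-isomorphisms -/

namespace Shpart

open FinPart

variable {k : Type u} [Field k] (T : Shpart k)

theorem HD_apply_zero (j j' i i' : ℤ) (hj : j + 1 = j') (hi : i + 1 = i')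
    (h : i + ((0 : ℕ) : ℤ) = j) (h' : i' + ((0 : ℕ) : ℤ) = j') (φ : T.HX j) :
    T.HD j j' hj φ ⟨(0, i'), h'⟩ = harrisonMap (T.degD i i') 1 (φ ⟨(0, i), h⟩) := by
  obtain rfl : i = i' - 1 := by omega
  change harrisonMap (T.degD (i' - 1) i') 1 (φ ⟨(0, i' - 1), _⟩) + (j.negOnePow : ℤ) • 0 = _
  rw [smul_zero, add_zero]

theorem HD_apply_succ (j j' i i' : ℤ) (hj : j + 1 = j') (hi : i + 1 = i') (m : ℕ)
    (h : i + ((m + 1 : ℕ) : ℤ) = j) (h' : i' + ((m + 1 : ℕ) : ℤ) = j') (h'' : i' + (m : ℤ) = j)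
    (φ : T.HX j) : T.HD j j' hj φ ⟨(m + 1, i'), h'⟩ =
      harrisonMap (T.degD i i') (m + 2) (φ ⟨(m + 1, i), h⟩) +
      (j.negOnePow : ℤ) • harrisonDifferential (T.deg i') (m + 1) (φ ⟨(m, i'), h''⟩) := by
  obtain rfl : i = i' - 1 := by omega
  rfl

theorem HObj_d_apply (j j' : ℤ) (hj : j + 1 = j') (φ : T.HX j) :
    (T.HObj.d j j').hom φ = T.HD j j' hj φ := by
  change (dite (j + 1 = j') _ _ : ModuleCat.of k (T.HX j) ⟶ ModuleCat.of k (T.HX j')).hom φ = _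
  rw [dif_pos hj]
  rfl

/-- The filtration of `H T` by the cochains which vanish on the first `p` generators. -/
def arityFiltration (j : ℤ) : ℕ → Submodule k (T.HX j) :=
  degreeFiltration _ fun p => p.1.1

variable {T}

theorem HD_mem_arityFiltration (j j' : ℤ) (hj : j + 1 = j') (p : ℕ) (φ : T.HX j)
    (hφ : φ ∈ T.arityFiltration j p) : T.HD j j' hj φ ∈ T.arityFiltration j' p := by
  rintro ⟨⟨m, i⟩, h⟩ hm
  dsimp only at h
  match m with
  | 0 =>
    rw [HD_apply_zero T j j' (i - 1) i hj (by omega) (by omega), hφ _ hm, map_zero]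
  | m + 1 =>
    rw [HD_apply_succ T j j' (i - 1) i hj (by omega) m (by omega) h (by push_cast at h; omega),
      hφ _ hm, hφ _ (lt_trans (Nat.lt_succ_self _) hm), map_zero, map_zero, smul_zero, add_zero]

/-- The differential of the graded complex is the differential of `T`. -/
theorem HD_apply_of_mem_arityFiltration (j j' : ℤ) (hj : j + 1 = j') (p : ℕ) (φ : T.HX j)
    (hφ : φ ∈ T.arityFiltration j p) (i i' : ℤ) (hi : i + 1 = i') (h : i' + (p : ℤ) = j')
    (h' : i + (p : ℤ) = j) :
    T.HD j j' hj φ ⟨(p, i'), h⟩ = harrisonMap (T.degD i i') (p + 1) (φ ⟨(p, i), h'⟩) := by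
  match p with
  | 0 => exact HD_apply_zero T j j' i i' hj hi h' h φ
  | p + 1 =>
    rw [HD_apply_succ T j j' i i' hj hi p h' h (by push_cast at h; omega),
      hφ ⟨(p, i'), _⟩ (Nat.lt_succ_self p), map_zero, smul_zero, add_zero]

theorem mem_arityFiltration_succ (j : ℤ) (p : ℕ) (φ : T.HX j) (hφ : φ ∈ T.arityFiltration j p)
    (i : ℤ) (h : i + (p : ℤ) = j) (h0 : φ ⟨(p, i), h⟩ = 0) : φ ∈ T.arityFiltration j (p + 1) := by
  rintro ⟨⟨m, i'⟩, h'⟩ hm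
  rcases Nat.lt_succ_iff_lt_or_eq.1 hm with hm | hm
  · exact hφ _ hm
  · dsimp only at hm h'
    subst hm
    obtain rfl : i = i' := by omega
    exact h0

theorem single_mem_arityFiltration (j : ℤ) (p : Bidegree j)
    (x : harrison (T.deg p.1.2) (p.1.1 + 1)) :
    (Pi.single p x : T.HX j) ∈ T.arityFiltration j p.1.1 := fun q hq =>
  Pi.single_eq_of_ne (fun h => (hq.ne (by rw [h])).elim) _

/-- The graded complexes of the arity filtration are spaces of elements vanishing on shuffles. These
are natural direct summands of the values of `T`, so that they preserve quasi-isomorphisms. -/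
theorem quasiIso_H_map [CharZero k] {T T' : Shpart k} (τ : T ⟶ T')
    (hτ : ∀ X, QuasiIso (τ.app X)) : QuasiIso ((H k).map τ) := by
  refine quasiIso_of_filtration ((H k).map τ) (fun j => T.arityFiltration j)
    (fun j => T'.arityFiltration j)
    (fun j => isCompleteFiltration_degreeFiltration _ _)
    (fun j => isCompleteFiltration_degreeFiltration _ _)
    (fun j x i hi => absurd hi (Nat.not_lt_zero _)) (fun j x i hi => absurd hi (Nat.not_lt_zero _))
    (fun j p x hx => ?_) (fun i j p x hij hx => ?_) (fun j p x hx i hi => ?_) ?_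
  · exact (HObj_d_apply T j (j + 1) rfl x).symm ▸ HD_mem_arityFiltration j (j + 1) rfl p x hx
  · exact (HObj_d_apply T' i j hij x).symm ▸ HD_mem_arityFiltration i j hij p x hx
  · change harrisonMap _ _ (x i) = 0
    rw [hx i hi, map_zero]
  · intro j p (a : T.HX (j + 1)) (b : T'.HX j) ha hb hda hab
    have hda' : T.HD (j + 1) (j + 1 + 1) rfl a = 0 := (HObj_d_apply T _ _ rfl a).symm.trans hda
    have hab' : HXMap τ (j + 1) a = T'.HD j (j + 1) rfl b :=
      hab.trans (HObj_d_apply T' _ _ rfl b)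
    obtain ⟨i, h1⟩ : ∃ i : ℤ, i + (p : ℤ) = j := ⟨j - p, by omega⟩
    have h2 : i + 1 + (p : ℤ) = j + 1 := by omega
    have h3 : i + 1 + 1 + (p : ℤ) = j + 1 + 1 := by omega
    have h4 : i - 1 + (p : ℤ) = j - 1 := by omega
    have e1 := HD_apply_of_mem_arityFiltration (j + 1) (j + 1 + 1) rfl p a ha (i + 1) (i + 1 + 1)
      rfl h3 h2
    rw [hda'] at e1
    have e2 := HD_apply_of_mem_arityFiltration j (j + 1) rfl p b hb i (i + 1) rfl h2 h1
    rw [← hab'] at e2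
    obtain ⟨α, β, hα, hβ⟩ : ∃ (α : harrison (T.deg i) (p + 1))
        (β : harrison (T'.deg (i - 1)) (p + 1)),
        harrisonMap (T.degD i (i + 1)) (p + 1) α = a ⟨(p, i + 1), h2⟩ ∧
        b ⟨(p, i), h1⟩ = harrisonMap (degMap τ i) (p + 1) α +
          harrisonMap (T'.degD (i - 1) i) (p + 1) β := by
      obtain ⟨a', b', ea, eb⟩ := (quasiIso_iff_cone_exact _).1 (hτ (op (fin (p + 1)))) i
        (a ⟨(p, i + 1), h2⟩).1 (b ⟨(p, i), h1⟩).1 congr(($e1).1).symm congr(($e2).1)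
      refine ⟨harrisonProj (T.deg i) p a', harrisonProj (T'.deg (i - 1)) p b', ?_, ?_⟩
      · exact (harrisonMap_harrisonProj (T.degD i (i + 1)) p a').trans
          ((congrArg (harrisonProj (T.deg (i + 1)) p) ea).trans (harrisonProj_coe p _))
      · refine (harrisonProj_coe p _).symm.trans
          ((congrArg (harrisonProj (T'.deg i) p) eb).trans ((map_add _ _ _).trans ?_))
        exact congrArg₂ (· + ·) (harrisonMap_harrisonProj (degMap τ i) p a').symm
          (harrisonMap_harrisonProj (T'.degD (i - 1) i) p b').symm
    have ma := single_mem_arityFiltration j ⟨(p, i), h1⟩ α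
    have mb := single_mem_arityFiltration (j - 1) ⟨(p, i - 1), h4⟩ β
    refine ⟨_, ma, _, mb, ?_, ?_⟩
    · refine (congrArg (fun x : T.HX (j + 1) => a - x ∈ T.arityFiltration (j + 1) (p + 1))
        (HObj_d_apply T j (j + 1) rfl _)).mpr ?_
      refine mem_arityFiltration_succ _ p _ (Submodule.sub_mem _ ha
        (HD_mem_arityFiltration _ _ rfl _ _ ma)) (i + 1) h2 ?_
      rw [Pi.sub_apply, HD_apply_of_mem_arityFiltration _ _ rfl p _ ma i (i + 1) rfl h2 h1,
        Pi.single_eq_same, hα, sub_self]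
    · refine (congrArg (fun x : T'.HX j => b - (HXMap τ j (Pi.single ⟨(p, i), h1⟩ α) + x) ∈
        T'.arityFiltration j (p + 1)) (HObj_d_apply T' (j - 1) j (by omega) _)).mpr ?_
      have hma : HXMap τ j (Pi.single ⟨(p, i), h1⟩ α) ∈ T'.arityFiltration j p := fun q hq =>
        (congrArg (harrisonMap (degMap τ q.1.2) (q.1.1 + 1)) (ma q hq)).trans (map_zero _)
      refine mem_arityFiltration_succ _ p _ (Submodule.sub_mem _ hb (Submodule.add_mem _ hma
        (HD_mem_arityFiltration _ _ (by omega) _ _ mb))) i h1 ?_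
      have e3 : HXMap τ j (Pi.single ⟨(p, i), h1⟩ α) ⟨(p, i), h1⟩ =
          harrisonMap (degMap τ i) (p + 1) α := by
        change harrisonMap (degMap τ i) (p + 1)
          ((Pi.single ⟨(p, i), h1⟩ α : T.HX j) ⟨(p, i), h1⟩) = _
        rw [Pi.single_eq_same]
      rw [Pi.sub_apply, Pi.add_apply,
        HD_apply_of_mem_arityFiltration _ _ (by omega) p _ mb (i - 1) i (by omega) h1 h4,
        Pi.single_eq_same, e3, hβ, sub_self]

end Shpart

namespace Shsur

variable {k : Type u} [Field k]

theorem quasiIso_B_map {M N : Shsur k} (τ : M ⟶ N) (hτ : quasiIso k τ) (X : FinPartᵒᵖ) :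
    QuasiIso (((B k).map τ).app X) := by
  rw [quasiIso_iff_cone_exact]
  intro j a b ha hab
  have key := fun S : Set X.unop => (quasiIso_iff_cone_exact _).1 (hτ (op (Sur.of S))) j (a S) (b S)
    congr($ha S) congr($hab S)
  choose a' b' h1 h2 using key
  exact ⟨a', b', funext h1, funext h2⟩

theorem quasiIso_H_map [CharZero k] {M N : Shsur k} (τ : M ⟶ N) (hτ : quasiIso k τ) :
    QuasiIso ((H k).map τ) :=
  Shpart.quasiIso_H_map _ (quasiIso_B_map τ hτ)

end Shsur

/-! ### Total complexes -/

section Tot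

open Shpart (Bidegree)

variable {k : Type u} [Field k]

theorem negOnePow_smul_of_add_one_eq {E : Type*} [AddCommGroup E] {j j' : ℤ} (h : j + 1 = j')
    (x : E) : (j'.negOnePow : ℤ) • x = -((j.negOnePow : ℤ) • x) := by
  rw [← h, Int.negOnePow_succ, Units.val_neg, neg_smul]

theorem negOnePow_smul_smul {E : Type*} [AddCommGroup E] (j : ℤ) (x : E) :
    (j.negOnePow : ℤ) • (j.negOnePow : ℤ) • x = x := by
  rw [smul_smul, ← Units.val_mul, Int.units_mul_self, Units.val_one, one_smul]

/-- A cochain complex, in degrees `≥ 0`, of complexes of `k`-vector spaces. -/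
structure Columns (k : Type u) [Field k] where
  /-- The complexes. -/
  col : ℕ → CochainComplex (ModuleCat.{u} k) ℤ
  /-- The differential. -/
  δ : ∀ n, col n ⟶ col (n + 1)
  δ_comp_δ : ∀ n, δ n ≫ δ (n + 1) = 0

namespace Columns

variable (C : Columns k)

theorem δ_δ_apply (n : ℕ) (i : ℤ) (x : (C.col n).X i) :
    ((C.δ (n + 1)).f i).hom (((C.δ n).f i).hom x) = 0 :=
  congr(($(C.δ_comp_δ n).f i).hom x)

/-- The degree `j` part of the total complex. -/
abbrev TotX (j : ℤ) : Type u := ∀ p : Bidegree j, (C.col p.1.1).X p.1.2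

/-- The part of the differential of the total complex that comes from `δ`. -/
def horizontal {j : ℤ} : ∀ (m : ℕ) (i : ℤ), i + m = j + 1 → (C.TotX j →ₗ[k] (C.col m).X i)
  | 0, _, _ => 0
  | m + 1, i, h => ((C.δ m).f i).hom ∘ₗ
      LinearMap.proj (⟨(m, i), by push_cast at h; dsimp only; omega⟩ : Bidegree j)

/-- The differential `d + (-1) ^ j • δ` of the total complex. -/
def totD (j j' : ℤ) (hj : j + 1 = j') : C.TotX j →ₗ[k] C.TotX j' :=
  LinearMap.pi fun p =>
    ((C.col p.1.1).d (p.1.2 - 1) p.1.2).hom ∘ₗ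
      LinearMap.proj (⟨(p.1.1, p.1.2 - 1), by have := p.2; dsimp only; omega⟩ : Bidegree j) +
    (j.negOnePow : ℤ) • C.horizontal p.1.1 p.1.2 (p.2.trans hj.symm)

theorem totD_apply_zero (j j' i i' : ℤ) (hj : j + 1 = j') (hi : i + 1 = i')
    (h' : i + ((0 : ℕ) : ℤ) = j) (h : i' + ((0 : ℕ) : ℤ) = j') (x : C.TotX j) :
    C.totD j j' hj x ⟨(0, i'), h⟩ = ((C.col 0).d i i').hom (x ⟨(0, i), h'⟩) := by
  obtain rfl : i = i' - 1 := by omega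
  change ((C.col 0).d (i' - 1) i').hom (x ⟨(0, i' - 1), _⟩) + (j.negOnePow : ℤ) • 0 = _
  rw [smul_zero, add_zero]

theorem totD_apply_succ (j j' i i' : ℤ) (hj : j + 1 = j') (hi : i + 1 = i') (m : ℕ)
    (h : i' + ((m + 1 : ℕ) : ℤ) = j') (h' : i + ((m + 1 : ℕ) : ℤ) = j) (h'' : i' + (m : ℤ) = j)
    (x : C.TotX j) : C.totD j j' hj x ⟨(m + 1, i'), h⟩ =
      ((C.col (m + 1)).d i i').hom (x ⟨(m + 1, i), h'⟩) +
      (j.negOnePow : ℤ) • ((C.δ m).f i').hom (x ⟨(m, i'), h''⟩) := by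
  obtain rfl : i = i' - 1 := by omega
  rfl

theorem totD_totD (j j' j'' : ℤ) (hj : j + 1 = j') (hj' : j' + 1 = j'') (x : C.TotX j) :
    C.totD j' j'' hj' (C.totD j j' hj x) = 0 := by
  funext ⟨⟨m, i⟩, h⟩
  dsimp only at h
  match m with
  | 0 =>
    rw [C.totD_apply_zero j' j'' (i - 1) i hj' (by omega) (by omega) h,
      C.totD_apply_zero j j' (i - 1 - 1) (i - 1) hj (by omega) (by omega) (by omega), d_d_apply]
    rfl
  | 1 =>
    rw [C.totD_apply_succ j' j'' (i - 1) i hj' (by omega) 0 h (by omega) (by omega),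
      C.totD_apply_succ j j' (i - 1 - 1) (i - 1) hj (by omega) 0 (by omega) (by omega) (by omega),
      C.totD_apply_zero j j' (i - 1) i hj (by omega) (by omega) (by omega), map_add, d_d_apply,
      map_zsmul, f_d_apply, negOnePow_smul_of_add_one_eq hj]
    exact (congrArg (· + _) (zero_add _)).trans (add_neg_cancel _)
  | m + 2 =>
    rw [C.totD_apply_succ j' j'' (i - 1) i hj' (by omega) (m + 1) h (by push_cast at h ⊢; omega)
        (by push_cast at h ⊢; omega),
      C.totD_apply_succ j j' (i - 1 - 1) (i - 1) hj (by omega) (m + 1) (by push_cast at h ⊢; omega)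
        (by push_cast at h ⊢; omega) (by push_cast at h ⊢; omega),
      C.totD_apply_succ j j' (i - 1) i hj (by omega) m (by push_cast at h ⊢; omega)
        (by push_cast at h ⊢; omega) (by push_cast at h ⊢; omega), map_add, map_add, d_d_apply,
      map_zsmul, f_d_apply, map_zsmul, C.δ_δ_apply, smul_zero, add_zero,
      negOnePow_smul_of_add_one_eq hj]
    exact (congrArg (· + _) (zero_add _)).trans (add_neg_cancel _)

/-- The total complex of a complex of complexes, formed with products. The sign of the
differential is as in `Shpart.H`. -/
def tot : CochainComplex (ModuleCat.{u} k) ℤ where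
  X j := ModuleCat.of k (C.TotX j)
  d j j' := if h : j + 1 = j' then ModuleCat.ofHom (C.totD j j' h) else 0
  shape j j' h := dif_neg h
  d_comp_d' j j' j'' h h' := by
    rw [dif_pos (show j + 1 = j' from h), dif_pos (show j' + 1 = j'' from h')]
    exact ModuleCat.hom_ext (LinearMap.ext fun φ => C.totD_totD j j' j'' h h' φ)

theorem tot_d_apply (j j' : ℤ) (hj : j + 1 = j') (x : C.TotX j) :
    (C.tot.d j j').hom x = C.totD j j' hj x := by
  change (dite (j + 1 = j') _ _ : ModuleCat.of k (C.TotX j) ⟶ ModuleCat.of k (C.TotX j')).hom x = _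
  rw [dif_pos hj]
  rfl

variable {C}

/-- The action on total complexes of a morphism of complexes of complexes, in degree `j`. -/
def totMapX {C' : Columns k} (f : ∀ n, C.col n ⟶ C'.col n) (j : ℤ) : C.TotX j →ₗ[k] C'.TotX j :=
  LinearMap.pi fun p => ((f p.1.1).f p.1.2).hom ∘ₗ LinearMap.proj p

theorem totD_totMapX {C' : Columns k} (f : ∀ n, C.col n ⟶ C'.col n)
    (hf : ∀ n, f n ≫ C'.δ n = C.δ n ≫ f (n + 1)) (j j' : ℤ) (hj : j + 1 = j') (x : C.TotX j) :
    C'.totD j j' hj (totMapX f j x) = totMapX f j' (C.totD j j' hj x) := by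
  funext ⟨⟨m, i⟩, hi⟩
  dsimp only at hi
  match m with
  | 0 =>
    rw [C'.totD_apply_zero j j' (i - 1) i hj (by omega) (by omega)]
    change _ = ((f 0).f i).hom (C.totD j j' hj x ⟨(0, i), hi⟩)
    rw [C.totD_apply_zero j j' (i - 1) i hj (by omega) (by omega)]
    exact f_d_apply _ _ _ _
  | m + 1 =>
    rw [C'.totD_apply_succ j j' (i - 1) i hj (by omega) m hi (by omega) (by push_cast at hi; omega)]
    change _ = ((f (m + 1)).f i).hom (C.totD j j' hj x ⟨(m + 1, i), hi⟩)
    rw [C.totD_apply_succ j j' (i - 1) i hj (by omega) m hi (by omega) (by push_cast at hi; omega),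
      map_add, map_zsmul]
    congr 1
    · exact f_d_apply _ _ _ _
    · congr 1
      exact congr(($(hf m).f i).hom (x ⟨(m, i), _⟩))

/-- The action on total complexes of a morphism of complexes of complexes. -/
def totMap {C' : Columns k} (f : ∀ n, C.col n ⟶ C'.col n)
    (hf : ∀ n, f n ≫ C'.δ n = C.δ n ≫ f (n + 1)) : C.tot ⟶ C'.tot where
  f j := ModuleCat.ofHom (totMapX f j)
  comm' j j' h := by
    refine ModuleCat.hom_ext (LinearMap.ext fun x => ?_)
    have h' : j + 1 = j' := h
    exact ((C'.tot_d_apply j j' h' _).trans (totD_totMapX f hf j j' h' x)).trans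
      (congrArg (totMapX f j') (C.tot_d_apply j j' h' x).symm)

variable {A : CochainComplex (ModuleCat.{u} k) ℤ} (ε : A ⟶ C.col 0)

/-- The morphism to the total complex induced by a coaugmentation, in degree `j`. -/
def toTotX (j : ℤ) : A.X j →ₗ[k] C.TotX j :=
  LinearMap.pi fun p => match p with
    | ⟨(0, i), h⟩ => (ε.f i).hom ∘ₗ (A.XIsoOfEq (show j = i by simpa using h.symm)).hom.hom
    | ⟨(_ + 1, _), _⟩ => 0

theorem toTotX_apply_zero (j : ℤ) (h : j + ((0 : ℕ) : ℤ) = j) (x : A.X j) :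
    (toTotX ε j x) ⟨(0, j), h⟩ = (ε.f j).hom x := rfl

theorem toTotX_apply_succ (j i : ℤ) (m : ℕ) (h : i + ((m + 1 : ℕ) : ℤ) = j) (x : A.X j) :
    (toTotX ε j x) ⟨(m + 1, i), h⟩ = 0 := rfl

variable {ε}

theorem totD_toTotX (hε : ε ≫ C.δ 0 = 0) (j j' : ℤ) (hj : j + 1 = j') (x : A.X j) :
    C.totD j j' hj (toTotX ε j x) = toTotX ε j' ((A.d j j').hom x) := by
  funext ⟨⟨m, i⟩, hi⟩
  match m with
  | 0 =>
    obtain rfl : j' = i := by simpa using hi.symm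
    rw [C.totD_apply_zero j j' j j' hj hj (by simp)]
    exact f_d_apply ε j j' x
  | 1 =>
    obtain rfl : j = i := by simp at hi; omega
    rw [C.totD_apply_succ j j' (j - 1) j hj (by omega) 0 hi (by push_cast; omega) (by simp),
      toTotX_apply_succ, toTotX_apply_succ, toTotX_apply_zero, map_zero, zero_add]
    exact (congrArg _ congr(($(hε).f j).hom x)).trans (smul_zero _)
  | m + 2 =>
    dsimp only at hi
    rw [C.totD_apply_succ j j' (i - 1) i hj (by omega) (m + 1) hi (by omega)
      (by push_cast at hi ⊢; omega), toTotX_apply_succ, toTotX_apply_succ, toTotX_apply_succ,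
      map_zero, map_zero, smul_zero, add_zero]

/-- The morphism to the total complex induced by a coaugmentation. -/
def toTot (hε : ε ≫ C.δ 0 = 0) : A ⟶ C.tot where
  f j := ModuleCat.ofHom (toTotX ε j)
  comm' j j' h := by
    refine ModuleCat.hom_ext (LinearMap.ext fun x => ?_)
    have h' : j + 1 = j' := h
    exact (C.tot_d_apply j j' h' _).trans (totD_toTotX hε j j' h' x)

/-- A coaugmented complex of complexes that is contractible, by homotopies compatible with the
vertical differentials, has a total complex quasi-isomorphic to the coaugmentation. -/
theorem quasiIso_toTot (hε : ε ≫ C.δ 0 = 0) (r : C.col 0 ⟶ A) (s : ∀ n, C.col (n + 1) ⟶ C.col n)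
    (hr : ε ≫ r = 𝟙 A) (hs0 : C.δ 0 ≫ s 0 + r ≫ ε = 𝟙 _)
    (hs : ∀ n, C.δ (n + 1) ≫ s (n + 1) + s n ≫ C.δ n = 𝟙 _) : QuasiIso (toTot hε) := by
  have hr' : ∀ i x, (r.f i).hom ((ε.f i).hom x) = x := fun i x => congr(($(hr).f i).hom x)
  have hs0' : ∀ i x, ((s 0).f i).hom (((C.δ 0).f i).hom x) + (ε.f i).hom ((r.f i).hom x) = x :=
    fun i x => congr(($(hs0).f i).hom x)
  have hs' : ∀ n i x, ((s (n + 1)).f i).hom (((C.δ (n + 1)).f i).hom x) +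
      ((C.δ n).f i).hom (((s n).f i).hom x) = x := fun n i x => congr(($(hs n).f i).hom x)
  rw [quasiIso_iff_cone_exact]
  intro j a (b : C.TotX j) ha hab
  have hab' : toTotX ε (j + 1) a = C.totD j (j + 1) rfl b :=
    hab.trans (C.tot_d_apply j (j + 1) rfl b)
  have hd : ∀ (m : ℕ) (i i' : ℤ) (hi : i + 1 = i') (h : i + ((m + 1 : ℕ) : ℤ) = j)
      (h' : i' + (m : ℤ) = j), ((C.col (m + 1)).d i i').hom (b ⟨(m + 1, i), h⟩) =
      - ((j.negOnePow : ℤ) • ((C.δ m).f i').hom (b ⟨(m, i'), h'⟩)) := by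
    intro m i i' hi h h'
    have := congrFun hab' ⟨(m + 1, i'), by push_cast at h ⊢; omega⟩
    rw [C.totD_apply_succ j (j + 1) i i' rfl hi m _ h h', toTotX_apply_succ] at this
    exact eq_neg_of_add_eq_zero_left this.symm
  have hd0 : (ε.f (j + 1)).hom a = ((C.col 0).d j (j + 1)).hom (b ⟨(0, j), by simp⟩) := by
    have := congrFun hab' ⟨(0, j + 1), by simp⟩
    rwa [C.totD_apply_zero j (j + 1) j (j + 1) rfl rfl (by simp)] at this
  let b' : C.TotX (j - 1) := fun p => -((j.negOnePow : ℤ) • ((s p.1.1).f p.1.2).hom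
    (b ⟨(p.1.1 + 1, p.1.2), by have := p.2; push_cast; omega⟩))
  have hdb' : ∀ (m : ℕ) (i i' : ℤ) (hi : i + 1 = i') (h : i + (m : ℤ) = j - 1)
      (h' : i' + (m : ℤ) = j), ((C.col m).d i i').hom (b' ⟨(m, i), h⟩) =
        ((s m).f i').hom (((C.δ m).f i').hom (b ⟨(m, i'), h'⟩)) := by
    intro m i i' hi h h'
    change ((C.col m).d i i').hom (-((j.negOnePow : ℤ) • ((s m).f i).hom (b ⟨(m + 1, i), _⟩))) = _
    rw [map_neg, map_zsmul, f_d_apply, hd m i i' hi (by push_cast; omega) h', map_neg, map_zsmul,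
      smul_neg, neg_neg, negOnePow_smul_smul]
  refine ⟨(r.f j).hom (b ⟨(0, j), by simp⟩), b', ?_, ?_⟩
  · rw [f_d_apply, ← hd0, hr']
  · have key : b = toTotX ε j ((r.f j).hom (b ⟨(0, j), by simp⟩)) +
        C.totD (j - 1) j (by omega) b' := by
      funext ⟨⟨m, i⟩, hi⟩
      dsimp only at hi
      rw [Pi.add_apply]
      match m with
      | 0 =>
        obtain rfl : j = i := by simpa using hi.symm
        rw [toTotX_apply_zero, C.totD_apply_zero (j - 1) j (j - 1) j (by omega) (by omega) (by simp),
          hdb' 0 (j - 1) j (by omega) _ (by simp), add_comm, hs0']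
      | m + 1 =>
        rw [toTotX_apply_succ, zero_add, C.totD_apply_succ (j - 1) j (i - 1) i (by omega) (by omega)
          m hi (by push_cast at hi ⊢; omega) (by push_cast at hi ⊢; omega),
          hdb' (m + 1) (i - 1) i (by omega) _ hi]
        refine Eq.trans (hs' m i _).symm (congrArg _ ?_)
        change _ = ((j - 1).negOnePow : ℤ) • ((C.δ m).f i).hom
          (-((j.negOnePow : ℤ) • ((s m).f i).hom (b ⟨(m + 1, i), _⟩)))
        rw [map_neg, map_zsmul, smul_neg,
          negOnePow_smul_of_add_one_eq (show j - 1 + 1 = j by omega), smul_neg, neg_neg,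
          negOnePow_smul_smul]
    exact key.trans (congrArg (fun x : C.TotX j =>
      toTotX ε j ((r.f j).hom (b ⟨(0, j), by simp⟩)) + x) (C.tot_d_apply (j - 1) j (by omega) b').symm)

end Columns

end Tot

/-! ### The cobar resolution -/

namespace Shsur

variable {k : Type u} [Field k] (M : Shsur k)

/-- The degree `i` part of the product of copies of `M [l]` over all surjections `[l] → Y`. -/
abbrev CoindX (Y : Sur) (i : ℤ) : Type u :=
  ∀ l : ℕ, (Sur.of (Fin l) ⟶ Y) → (M.obj (op (Sur.of (Fin l)))).X i

/-- The functor whose value on `Y` is the product of the complexes `M [l]` over all surjections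
`[l] → Y`. It is coinduced from the family of complexes `M [l]`, and contains `M`. -/
def coindObj : Shsur k where
  obj Y :=
    { X := fun i => ModuleCat.of k (M.CoindX Y.unop i)
      d := fun i j => ModuleCat.ofHom (LinearMap.pi fun l => LinearMap.pi fun f =>
        ((M.obj (op (Sur.of (Fin l)))).d i j).hom ∘ₗ LinearMap.proj f ∘ₗ LinearMap.proj l)
      shape := fun i j h => by
        exact ModuleCat.hom_ext (LinearMap.ext fun c => funext fun l => funext fun f =>
          congr($((M.obj (op (Sur.of (Fin l)))).shape i j h).hom (c l f)))
      d_comp_d' := fun i j l _ _ => by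
        exact ModuleCat.hom_ext (LinearMap.ext fun c => funext fun n => funext fun f =>
          congr($((M.obj (op (Sur.of (Fin n)))).d_comp_d i j l).hom (c n f))) }
  map g :=
    { f := fun i => ModuleCat.ofHom (LinearMap.pi fun l => LinearMap.pi fun f =>
        LinearMap.proj (f ≫ g.unop) ∘ₗ LinearMap.proj l)
      comm' := fun _ _ _ => rfl }
  map_id _ := rfl
  map_comp _ _ := rfl

variable (k) in
/-- The functor `M ↦ coindObj M`. -/
def coind : Shsur k ⥤ Shsur k where
  obj M := M.coindObj
  map {M N} τ :=
    { app := fun Y =>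
        { f := fun i => ModuleCat.ofHom (LinearMap.pi fun l => LinearMap.pi fun f =>
            ((τ.app (op (Sur.of (Fin l)))).f i).hom ∘ₗ LinearMap.proj f ∘ₗ LinearMap.proj l)
          comm' := fun i j _ => by
            exact ModuleCat.hom_ext (LinearMap.ext fun c => funext fun l => funext fun f =>
              congr($((τ.app (op (Sur.of (Fin l)))).comm i j).hom (c l f))) }
      naturality := fun _ _ _ => rfl }
  map_id _ := rfl
  map_comp _ _ := rfl

theorem coind_map_zero {M N : Shsur k} : (coind k).map (0 : M ⟶ N) = 0 := rfl

variable (k) in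
/-- The inclusion of `M` in the functor coinduced from `M`. -/
def coindUnit : 𝟭 (Shsur k) ⟶ coind k where
  app M :=
    { app := fun Y =>
        { f := fun i => ModuleCat.ofHom (LinearMap.pi fun l => LinearMap.pi fun f =>
            ((M.map f.op).f i).hom)
          comm' := fun i j _ => by
            exact ModuleCat.hom_ext (LinearMap.ext fun x => funext fun l => funext fun f =>
              congr($((M.map f.op).comm i j).hom x)) }
      naturality := fun X Y g => by
        refine HomologicalComplex.hom_ext _ _ fun i => ModuleCat.hom_ext (LinearMap.ext fun x =>
          funext fun l => funext fun f => ?_)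
        exact congr(($(M.map_comp g f.op).f i).hom x).symm }
  naturality M N τ := by
    refine NatTrans.ext (funext fun Y => HomologicalComplex.hom_ext _ _ fun i =>
      ModuleCat.hom_ext (LinearMap.ext fun x => funext fun l => funext fun f => ?_))
    exact congr(($(τ.naturality f.op).f i).hom x).symm

/-- A numbering of a finite set, as a surjection. -/
noncomputable def numbering (Y : Sur) : Y ⟶ Sur.of (Fin (Nat.card Y)) :=
  ⟨Finite.equivFin Y, (Finite.equivFin Y).surjective⟩

/-- The inverse of `numbering`. -/
noncomputable def numberingInv (Y : Sur) : Sur.of (Fin (Nat.card Y)) ⟶ Y :=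
  ⟨(Finite.equivFin Y).symm, (Finite.equivFin Y).symm.surjective⟩

theorem numbering_comp_numberingInv (Y : Sur) : numbering Y ≫ numberingInv Y = 𝟙 Y :=
  Subtype.ext (funext fun y => (Finite.equivFin Y).symm_apply_apply y)

/-- The retraction of the inclusion of `M Y`, projecting to the component of a bijection
`[l] → Y`. It is natural in `M`, but not in `Y`. -/
noncomputable def coindRetraction (Y : Surᵒᵖ) : M.coindObj.obj Y ⟶ M.obj Y where
  f i := ModuleCat.ofHom (((M.map (numbering Y.unop).op).f i).hom ∘ₗ
    LinearMap.proj (numberingInv Y.unop) ∘ₗ LinearMap.proj (Nat.card Y.unop))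
  comm' i j _ := by
    exact ModuleCat.hom_ext (LinearMap.ext fun c =>
      congr($((M.map (numbering Y.unop).op).comm i j).hom (c _ (numberingInv Y.unop))))

theorem coindUnit_retraction (Y : Surᵒᵖ) :
    ((coindUnit k).app M).app Y ≫ M.coindRetraction Y = 𝟙 (M.obj Y) := by
  refine HomologicalComplex.hom_ext _ _ fun i => ModuleCat.hom_ext (LinearMap.ext fun x => ?_)
  have h : M.map (numberingInv Y.unop).op ≫ M.map (numbering Y.unop).op = 𝟙 _ := by
    rw [← M.map_comp, ← op_comp, numbering_comp_numberingInv]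
    exact M.map_id _
  exact congr(($(h).f i).hom x)

theorem coind_map_retraction {M N : Shsur k} (τ : M ⟶ N) (Y : Surᵒᵖ) :
    ((coind k).map τ).app Y ≫ N.coindRetraction Y = M.coindRetraction Y ≫ τ.app Y := by
  refine HomologicalComplex.hom_ext _ _ fun i =>
    ModuleCat.hom_ext (LinearMap.ext fun (c : M.CoindX Y.unop i) => ?_)
  exact congr(($(τ.naturality (numbering Y.unop).op).f i).hom (c _ (numberingInv Y.unop))).symm

variable (k) in
/-- The iterates of `coind`. -/
def coindIter : ℕ → Shsur k ⥤ Shsur k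
  | 0 => 𝟭 _
  | n + 1 => coindIter n ⋙ coind k

/-- The inclusion of an iterate of `coind` in the next one. -/
def iterUnit (n : ℕ) (M : Shsur k) : (coindIter k n).obj M ⟶ (coindIter k (n + 1)).obj M :=
  (coindUnit k).app ((coindIter k n).obj M)

/-- The functor `coind`, on morphisms between values of its iterates. -/
def iterMap {m n : ℕ} {M N : Shsur k} (τ : (coindIter k m).obj M ⟶ (coindIter k n).obj N) :
    (coindIter k (m + 1)).obj M ⟶ (coindIter k (n + 1)).obj N :=
  (coind k).map τ

/-- The retraction of `iterUnit`. -/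
noncomputable def iterRetraction (n : ℕ) (M : Shsur k) (Y : Surᵒᵖ) :
    ((coindIter k (n + 1)).obj M).obj Y ⟶ ((coindIter k n).obj M).obj Y :=
  ((coindIter k n).obj M).coindRetraction Y

theorem comp_iterUnit {m n : ℕ} {M N : Shsur k}
    (τ : (coindIter k m).obj M ⟶ (coindIter k n).obj N) :
    τ ≫ iterUnit n N = iterUnit m M ≫ iterMap τ :=
  (coindUnit k).naturality τ

/-- The differential of the cobar complex: the alternating sum of the
`n + 1` inclusions of the `n`-th iterate of `coind` in the next one. -/
def cobarD : ∀ (n : ℕ) (M : Shsur k), (coindIter k n).obj M ⟶ (coindIter k (n + 1)).obj M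
  | 0, M => iterUnit 0 M
  | n + 1, M => iterUnit (n + 1) M - iterMap (cobarD n M)

theorem cobarD_succ (n : ℕ) (M : Shsur k) :
    cobarD (n + 1) M = iterUnit (n + 1) M - iterMap (cobarD n M) := rfl

theorem cobarD_naturality (n : ℕ) {M N : Shsur k} (τ : M ⟶ N) :
    cobarD n M ≫ (coindIter k (n + 1)).map τ = (coindIter k n).map τ ≫ cobarD n N := by
  induction n with
  | zero => exact ((coindUnit k).naturality τ).symm
  | succ n ih =>
    rw [cobarD_succ, cobarD_succ, Preadditive.sub_comp, Preadditive.comp_sub, comp_iterUnit]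
    refine congrArg (_ - ·) ?_
    exact ((coind k).map_comp _ _).symm.trans ((congrArg (coind k).map ih).trans
      ((coind k).map_comp _ _))

theorem cobarD_comp_cobarD (n : ℕ) (M : Shsur k) : cobarD n M ≫ cobarD (n + 1) M = 0 := by
  have key : ∀ n, cobarD n M ≫ cobarD (n + 1) M =
      (iterUnit n M - cobarD n M) ≫ iterMap (cobarD n M) := by
    intro n
    rw [cobarD_succ, Preadditive.sub_comp, Preadditive.comp_sub, comp_iterUnit]
  induction n with
  | zero =>
    rw [key, show cobarD 0 M = iterUnit 0 M from rfl, sub_self, Limits.zero_comp]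
  | succ n ih =>
    rw [key, cobarD_succ, sub_sub_cancel]
    exact ((coind k).map_comp _ _).symm.trans ((congrArg _ ih).trans coind_map_zero)

/-- On each finite set, the retractions of the inclusions contract the cobar complex. -/
theorem cobarD_retraction (n : ℕ) (M : Shsur k) (Y : Surᵒᵖ) :
    (cobarD (n + 1) M).app Y ≫ iterRetraction (n + 1) M Y +
      iterRetraction n M Y ≫ (cobarD n M).app Y = 𝟙 _ := by
  have h1 : (iterUnit (n + 1) M).app Y ≫ iterRetraction (n + 1) M Y = 𝟙 _ :=
    coindUnit_retraction _ Y
  have h2 : (iterMap (cobarD n M)).app Y ≫ iterRetraction (n + 1) M Y =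
      iterRetraction n M Y ≫ (cobarD n M).app Y := coind_map_retraction (cobarD n M) Y
  rw [cobarD_succ, NatTrans.app_sub, Preadditive.sub_comp, h1, h2, sub_add_cancel]

/-- The cobar complex of `M` on `Y`. -/
def cobar (Y : Surᵒᵖ) : Columns k where
  col n := ((coindIter k (n + 1)).obj M).obj Y
  δ n := (cobarD (n + 1) M).app Y
  δ_comp_δ n := congr(($(cobarD_comp_cobarD (n + 1) M)).app Y)

theorem cobarD_comp_δ (Y : Surᵒᵖ) : (cobarD 0 M).app Y ≫ (M.cobar Y).δ 0 = 0 :=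
  congrArg (NatTrans.app · Y) (cobarD_comp_cobarD 0 M)

theorem cobar_map_δ {Y Z : Surᵒᵖ} (g : Y ⟶ Z) (n : ℕ) :
    ((coindIter k (n + 1)).obj M).map g ≫ (M.cobar Z).δ n =
      (M.cobar Y).δ n ≫ ((coindIter k (n + 1 + 1)).obj M).map g :=
  (cobarD (n + 1) M).naturality g

theorem cobar_app_δ {M N : Shsur k} (τ : M ⟶ N) (Y : Surᵒᵖ) (n : ℕ) :
    ((coindIter k (n + 1)).map τ).app Y ≫ (N.cobar Y).δ n =
      (M.cobar Y).δ n ≫ ((coindIter k (n + 1 + 1)).map τ).app Y :=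
  (congrArg (NatTrans.app · Y) (cobarD_naturality (n + 1) τ)).symm

/-- The total complex of the cobar complex, a resolution of `M` by products of
coinduced functors. -/
def cobarTot : Shsur k where
  obj Y := (M.cobar Y).tot
  map {Y Z} g := Columns.totMap (fun n => ((coindIter k (n + 1)).obj M).map g) (M.cobar_map_δ g)
  map_id Y := by
    refine HomologicalComplex.hom_ext _ _ fun j => ModuleCat.hom_ext (LinearMap.ext fun x =>
      funext fun p => ?_)
    exact congr(($(((coindIter k (p.1.1 + 1)).obj M).map_id Y).f p.1.2).hom (x p))
  map_comp {Y Z W} g h := by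
    refine HomologicalComplex.hom_ext _ _ fun j => ModuleCat.hom_ext (LinearMap.ext fun x =>
      funext fun p => ?_)
    exact congr(($(((coindIter k (p.1.1 + 1)).obj M).map_comp g h).f p.1.2).hom (x p))

variable (k) in
/-- The functor `M ↦ cobarTot M`. -/
def cobarResolution : Shsur k ⥤ Shsur k where
  obj M := M.cobarTot
  map {M N} τ :=
    { app := fun Y => Columns.totMap (C := M.cobar Y) (C' := N.cobar Y)
        (fun n => ((coindIter k (n + 1)).map τ).app Y) (cobar_app_δ τ Y)
      naturality := fun Y Z g => by
        refine HomologicalComplex.hom_ext _ _ fun j => ModuleCat.hom_ext (LinearMap.ext fun x =>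
          funext fun p => ?_)
        exact congr(($(((coindIter k (p.1.1 + 1)).map τ).naturality g).f p.1.2).hom (x p)) }
  map_id M := by
    refine NatTrans.ext (funext fun Y => HomologicalComplex.hom_ext _ _ fun j =>
      ModuleCat.hom_ext (LinearMap.ext fun x => funext fun p => ?_))
    exact congr((($((coindIter k (p.1.1 + 1)).map_id M).app Y).f p.1.2).hom (x p))
  map_comp τ τ' := by
    refine NatTrans.ext (funext fun Y => HomologicalComplex.hom_ext _ _ fun j =>
      ModuleCat.hom_ext (LinearMap.ext fun x => funext fun p => ?_))
    exact congr((($((coindIter k (p.1.1 + 1)).map_comp τ τ').app Y).f p.1.2).hom (x p))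

theorem toTot_comp_totMap {A A' : CochainComplex (ModuleCat.{u} k) ℤ} {C C' : Columns k}
    {ε : A ⟶ C.col 0} {ε' : A' ⟶ C'.col 0} (hε : ε ≫ C.δ 0 = 0) (hε' : ε' ≫ C'.δ 0 = 0)
    (f : ∀ n, C.col n ⟶ C'.col n) (hf : ∀ n, f n ≫ C'.δ n = C.δ n ≫ f (n + 1)) (g : A ⟶ A')
    (hg : ε ≫ f 0 = g ≫ ε') :
    Columns.toTot hε ≫ Columns.totMap f hf = g ≫ Columns.toTot hε' := by
  refine HomologicalComplex.hom_ext _ _ fun j => ModuleCat.hom_ext (LinearMap.ext fun x =>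
    funext fun ⟨⟨m, i⟩, h⟩ => ?_)
  match m with
  | 0 =>
    obtain rfl : j = i := by simpa using h.symm
    exact congr(($(hg).f j).hom x)
  | m + 1 => exact map_zero ((f (m + 1)).f i).hom

variable (k) in
/-- The coaugmentation of the cobar complex. -/
def cobarUnit : 𝟭 (Shsur k) ⟶ cobarResolution k where
  app M :=
    { app := fun Y => Columns.toTot (M.cobarD_comp_δ Y)
      naturality := fun Y Z g => (toTot_comp_totMap (M.cobarD_comp_δ Y) (M.cobarD_comp_δ Z) _
        (M.cobar_map_δ g) (M.map g) ((cobarD 0 M).naturality g).symm).symm }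
  naturality M N τ := by
    refine NatTrans.ext (funext fun Y => ?_)
    exact (toTot_comp_totMap (M.cobarD_comp_δ Y) (N.cobarD_comp_δ Y) _ (cobar_app_δ τ Y) (τ.app Y)
      (congrArg (NatTrans.app · Y) (cobarD_naturality 0 τ))).symm

theorem quasiIso_cobarUnit : quasiIso k ((cobarUnit k).app M) := fun Y =>
  Columns.quasiIso_toTot (M.cobarD_comp_δ Y) (iterRetraction 0 M Y)
    (fun n => iterRetraction (n + 1) M Y) (M.coindUnit_retraction Y)
    (cobarD_retraction 0 M Y) fun n => cobarD_retraction (n + 1) M Y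

end Shsur

/-! ### Comparison of `G` and `H` on cobar resolutions -/

namespace FinPart

variable {k : Type u} [Field k]

theorem harrisonMap_mem {F F' : FinPartᵒᵖ ⥤ ModuleCat.{u} k} (τ : F ⟶ F') (n : ℕ)
    (x : F.obj (op (fin n))) (hx : x ∈ harrison F n) : (τ.app _).hom x ∈ harrison F' n :=
  (harrisonMap τ n ⟨x, hx⟩).2

theorem hochschild_naturality {F F' : FinPartᵒᵖ ⥤ ModuleCat.{u} k} (τ : F ⟶ F') (n : ℕ)
    (x : F.obj (op (fin n))) :
    (τ.app _).hom (hochschild F n x) = hochschild F' n ((τ.app _).hom x) := by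
  rw [hochschild_apply, hochschild_apply, map_sum]
  refine Finset.sum_congr rfl fun a _ => ?_
  rw [map_zsmul]
  exact congrArg _ congr(($(τ.naturality (face n a).op)).hom x)

theorem map_shuffleSum_position {F F' : FinPartᵒᵖ ⥤ ModuleCat.{u} k} (τ : F ⟶ F') (n : ℕ)
    (x : F.obj (op (fin n))) (s t : List (Fin n)) :
    (τ.app _).hom (shuffleSum (fun w => (F.map (position w).op).hom x) s t) =
      shuffleSum (fun w => (F'.map (position w).op).hom ((τ.app _).hom x)) s t := by
  rw [map_shuffleSum]
  refine congrArg (fun G => shuffleSum G s t) (funext fun w => ?_)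
  exact congr(($(τ.naturality (position w).op)).hom x)

end FinPart

namespace Shsur

open FinPart Shpart

variable {k : Type u} [Field k] (M : Shsur k)

/-- A map, viewed as a surjection onto its image. -/
def surRange {l : ℕ} {X : Type} [Finite X] (g : Fin l → X) :
    Sur.of (Fin l) ⟶ Sur.of (Set.range g) :=
  ⟨fun z => ⟨g z, z, rfl⟩, by
    rintro ⟨_, z, rfl⟩
    exact ⟨z, rfl⟩⟩

/-- The values on the standard finite sets of the iterates of `coind`. -/
abbrev IterX (q : ℕ) (i : ℤ) (l : ℕ) : Type u :=
  (((coindIter k q).obj M).obj (op (Sur.of (Fin l)))).X i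

/-- An element of `cobarTot M`, as a family of functions on surjections. -/
abbrev CobarX (Y : Sur) (i : ℤ) : Type u :=
  ∀ p : Bidegree i, ∀ l : ℕ, (Sur.of (Fin l) ⟶ Y) → M.IterX p.1.1 p.1.2 l

theorem cobar_apply_congr {X : FinPart} {i : ℤ} (x : ∀ S : Set X, M.CobarX (Sur.of S) i)
    (p : Bidegree i) {l : ℕ} {S S' : Set X} (h : S = S')
    (f : Sur.of (Fin l) ⟶ Sur.of S) (f' : Sur.of (Fin l) ⟶ Sur.of S')
    (hf : ∀ z : Fin l, (f.1 z).1 = (f'.1 z).1) : x S p l f = x S' p l f' := by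
  subst h
  obtain rfl : f = f' := Subtype.ext (funext fun y => Subtype.ext (hf y))
  rfl

/-- The component of bidegree `p` of an element of `B (cobarTot M)`: the elements of
`B (cobarTot M) X` with values in the product of the complexes `M' [l]` over the surjections from
`[l]` to subsets of `X` are functions on the maps `[l] → X`. -/
noncomputable def cobarComponent (i : ℤ) (p : Bidegree i) :
    ((B k).obj M.cobarTot).deg i ⟶ coFun k (M.IterX p.1.1 p.1.2) where
  app X := ModuleCat.ofHom
    { toFun := fun (x : ∀ S : Set X.unop, M.CobarX (Sur.of S) i) l g =>
        x (Set.range g) p l (surRange g)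
      map_add' := fun _ _ => rfl
      map_smul' := fun _ _ => rfl }
  naturality X Z f := by
    refine ModuleCat.hom_ext (LinearMap.ext fun x => funext fun l => funext fun g => ?_)
    change _ = extendZero (fun g' => (x : ∀ S : Set X.unop, M.CobarX (Sur.of S) i) (Set.range g') p l
        (surRange g')) (ofFun g ≫ f.unop)
    have apply : ∀ {E : M.CobarX (Sur.of (Set.range g)) i},
        (M.cobarTot.BMap f.unop i x (Set.range g) : M.CobarX (Sur.of (Set.range g)) i) = E →
        (M.cobarTot.BMap f.unop i x (Set.range g) : M.CobarX (Sur.of (Set.range g)) i) p l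
          (surRange g) = E p l (surRange g) := fun h => by rw [h]
    by_cases h : ∀ z ∈ Set.range g, (f.unop z).isSome
    · refine (apply (M.cobarTot.BMap_of_isSome f.unop i x _ h)).trans ?_
      rw [extendZero_of_isSome _ _
        (fun z => (f.unop (g z)).get (h _ ⟨z, rfl⟩)) (fun z => by rw [comp_apply]; simp [ofFun])]
      refine M.cobar_apply_congr x p ?_ (surRange g ≫ restr f.unop _ h) _ fun _ => rfl
      ext y
      constructor
      · rintro ⟨_, ⟨z, rfl⟩, hy⟩
        exact ⟨z, by simp [hy]⟩
      · rintro ⟨z, rfl⟩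
        exact ⟨_, ⟨z, rfl⟩, by simp⟩
    · refine (apply (M.cobarTot.BMap_of_not f.unop i x _ h)).trans ?_
      push Not at h
      obtain ⟨_, ⟨z, rfl⟩, hz⟩ := h
      exact (extendZero_of_eq_none _ _ z (by rw [comp_apply]; simpa [ofFun] using hz)).symm

/-- The component of bidegree `p` of an element of `B (cobarTot M) [n]`. -/
noncomputable def component {i : ℤ} {n : ℕ} (p : Bidegree i) :
    M.cobarTot.BX (fin n) i →ₗ[k] CoFam (M.IterX p.1.1 p.1.2) n :=
  ((M.cobarComponent i p).app (op (fin n))).hom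

variable {M}

/-- An element of `B (cobarTot M) [n]` is determined by its components. -/
theorem component_eq {i : ℤ} {n : ℕ} (x : ∀ S : Set (Fin n), M.CobarX (Sur.of S) i)
    (S : Set (Fin n)) (p : Bidegree i) (l : ℕ) (f : Sur.of (Fin l) ⟶ Sur.of S) :
    x S p l f = M.component p x l fun z => (f.1 z).1 := by
  refine M.cobar_apply_congr (X := fin n) x p ?_ _ _ fun _ => rfl
  ext y
  constructor
  · intro hy
    obtain ⟨z, hz⟩ := f.2 ⟨y, hy⟩
    exact ⟨z, congrArg Subtype.val hz⟩
  · rintro ⟨z, rfl⟩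
    exact (f.1 z).2

theorem component_ext {i : ℤ} {n : ℕ} {x y : M.cobarTot.BX (fin n) i}
    (h : ∀ p, M.component p x = M.component p y) : x = y := by
  funext S p l f
  refine (component_eq x S p l f).trans (Eq.trans ?_ (component_eq y S p l f).symm)
  rw [h p]

theorem mem_harrison_of_component {i : ℤ} {n : ℕ} {x : M.cobarTot.BX (fin n) i}
    (h : ∀ p, M.component p x ∈ harrison (coFun k (M.IterX p.1.1 p.1.2)) n) :
    x ∈ harrison (((B k).obj M.cobarTot).deg i) n := by
  intro s t hs ht hst
  refine component_ext fun p => ?_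
  refine (map_shuffleSum_position (M.cobarComponent i p) n x s t).trans ?_
  exact (h p s t hs ht hst).trans (map_zero ((M.cobarComponent i p).app (op (fin n))).hom).symm

theorem component_mem_harrison {i : ℤ} {n : ℕ} {x : M.cobarTot.BX (fin n) i}
    (hx : x ∈ harrison (((B k).obj M.cobarTot).deg i) n) (p : Bidegree i) :
    M.component p x ∈ harrison (coFun k (M.IterX p.1.1 p.1.2)) n :=
  harrisonMap_mem (M.cobarComponent i p) n x hx

variable (M) in
/-- The Hochschild differential of `B (cobarTot M)`. -/
noncomputable def BHochschild (n : ℕ) (i : ℤ) :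
    M.cobarTot.BX (fin n) i →ₗ[k] M.cobarTot.BX (fin (n + 1)) i :=
  hochschild (((B k).obj M.cobarTot).deg i) n

theorem component_BHochschild {i : ℤ} {n : ℕ} (x : M.cobarTot.BX (fin n) i) (p : Bidegree i) :
    M.component p (M.BHochschild n i x) = coHochschild n (M.component p x) :=
  (hochschild_naturality (M.cobarComponent i p) n x).trans (hochschild_coFun _)

end Shsur

namespace FinPart

theorem contrFun_zsmul {V : ℕ → Type u} [∀ l, AddCommGroup (V l)] (n : ℕ) (z : ℤ)
    (c : CoFam V (n + 2)) : contrFun n (z • c) = z • contrFun n c :=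
  funext fun l => funext fun g =>
    (map_contrFun (fun l => DistribSMul.toAddMonoidHom (V l) z) n c l g).symm

/-- The signed sum of the images of an element under the shuffles of two words. -/
def shuffleSumHom {k : Type u} [Field k] (F : FinPartᵒᵖ ⥤ ModuleCat.{u} k) (n : ℕ)
    (s t : List (Fin n)) : F.obj (op (fin n)) →+ F.obj (op (fin n)) where
  toFun x := shuffleSum (fun v => (F.map (position v).op).hom x) s t
  map_zero' := by simp only [map_zero, shuffleSum_zero]
  map_add' x y := by simp only [map_add, shuffleSum_add]

end FinPart

namespace Shsur

open FinPart Shpart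

variable {k : Type u} [Field k] (M : Shsur k)

/-- The filtration of `cobarTot M` by the number of iterations of `coind`. -/
def cobarFiltration (Y : Sur) (i : ℤ) : ℕ → Submodule k (M.CobarX Y i) :=
  degreeFiltration _ fun p => p.1.1

variable {M}

theorem mem_cobarFiltration_succ {Y : Sur} {i : ℤ} {q : ℕ} {x : M.CobarX Y i}
    (hx : x ∈ M.cobarFiltration Y i q) (h : ∀ (a : ℤ) (h : a + (q : ℤ) = i), x ⟨(q, a), h⟩ = 0) :
    x ∈ M.cobarFiltration Y i (q + 1) := by
  rintro ⟨⟨m, a⟩, h'⟩ hm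
  rcases Nat.lt_succ_iff_lt_or_eq.1 hm with hm | hm
  · exact hx _ hm
  · dsimp only at hm h'
    subst hm
    exact h a h'

theorem cobarTot_d_apply {Y : Sur} {i i' : ℤ} (hi : i + 1 = i') {q : ℕ} {x : M.CobarX Y i}
    (hx : x ∈ M.cobarFiltration Y i q) (a a' : ℤ) (ha : a + 1 = a') (h : a + (q : ℤ) = i)
    (h' : a' + (q : ℤ) = i') (l : ℕ) (f : Sur.of (Fin l) ⟶ Y) :
    (((M.cobarTot.obj (op Y)).d i i').hom x : M.CobarX Y i') ⟨(q, a'), h'⟩ l f =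
      ((((coindIter k q).obj M).obj (op (Sur.of (Fin l)))).d a a').hom (x ⟨(q, a), h⟩ l f) := by
  refine (congrFun (congrFun (congrFun ((M.cobar (op Y)).tot_d_apply i i' hi x) ⟨(q, a'), h'⟩) l)
    f).trans ?_
  match q with
  | 0 =>
    rw [(M.cobar (op Y)).totD_apply_zero i i' a a' hi ha h h' x]
    rfl
  | q + 1 =>
    rw [(M.cobar (op Y)).totD_apply_succ i i' a a' hi ha q h' h (by push_cast at h'; omega) x]
    have h0 : (((M.cobar (op Y)).δ q).f a').hom
        (x ⟨(q, a'), by push_cast at h'; dsimp only; omega⟩) = 0 :=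
      (congrArg _ (hx _ (Nat.lt_succ_self q))).trans (map_zero _)
    rw [h0, smul_zero, add_zero]
    rfl

theorem cobarTot_d_mem {Y : Sur} {i i' : ℤ} (hi : i + 1 = i') {q : ℕ} {x : M.CobarX Y i}
    (hx : x ∈ M.cobarFiltration Y i q) :
    (((M.cobarTot.obj (op Y)).d i i').hom x : M.CobarX Y i') ∈ M.cobarFiltration Y i' q := by
  rintro ⟨⟨m, a⟩, h⟩ hm
  funext l f
  have hx' : x ∈ M.cobarFiltration Y i m := fun p hp => hx p (hp.trans hm)
  have h0 : x ⟨(m, a - 1), by dsimp only at h ⊢; omega⟩ = 0 := hx _ hm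
  dsimp only at h
  rw [cobarTot_d_apply hi hx' (a - 1) a (by omega) (by omega) h, h0]
  exact map_zero _

variable (M)

/-- The filtration of `B (cobarTot M)` by the number of iterations of `coind`. -/
def BFiltration (n : ℕ) (i : ℤ) (q : ℕ) : Submodule k (M.cobarTot.BX (fin n) i) :=
  Submodule.pi Set.univ fun S => M.cobarFiltration (Sur.of S) i q

variable {M}

theorem mem_BFiltration_iff {n : ℕ} {i : ℤ} {q : ℕ} {x : M.cobarTot.BX (fin n) i} :
    x ∈ M.BFiltration n i q ↔ ∀ p : Bidegree i, p.1.1 < q → M.component p x = 0 := by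
  constructor
  · intro h p hp
    funext l g
    exact congrFun (congrFun (h (Set.range g) trivial p hp) l) _
  · intro h S _ p hp
    funext l f
    exact (component_eq x S p l f).trans (congrFun (congrFun (h p hp) l) _)

theorem mem_BFiltration_succ {n : ℕ} {i : ℤ} {q : ℕ} {x : M.cobarTot.BX (fin n) i}
    (hx : x ∈ M.BFiltration n i q)
    (h : ∀ (a : ℤ) (h : a + (q : ℤ) = i), M.component ⟨(q, a), h⟩ x = 0) :
    x ∈ M.BFiltration n i (q + 1) := by
  rw [mem_BFiltration_iff] at hx ⊢
  rintro ⟨⟨m, a⟩, h'⟩ hm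
  rcases Nat.lt_succ_iff_lt_or_eq.1 hm with hm | hm
  · exact hx _ hm
  · dsimp only at hm h'
    subst hm
    exact h a h'

variable (M)

/-- The differential of `B (cobarTot M)`. -/
noncomputable def BD (n : ℕ) (i i' : ℤ) : M.cobarTot.BX (fin n) i →ₗ[k] M.cobarTot.BX (fin n) i' :=
  ((((B k).obj M.cobarTot).degD i i').app (op (fin n))).hom

variable {M}

theorem BD_mem {n : ℕ} {i i' : ℤ} (hi : i + 1 = i') {q : ℕ} {x : M.cobarTot.BX (fin n) i}
    (hx : x ∈ M.BFiltration n i q) : M.BD n i i' x ∈ M.BFiltration n i' q := fun S _ =>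
  cobarTot_d_mem hi (hx S trivial)

theorem component_BD {n : ℕ} {i i' : ℤ} (hi : i + 1 = i') {q : ℕ} {x : M.cobarTot.BX (fin n) i}
    (hx : x ∈ M.BFiltration n i q) (a a' : ℤ) (ha : a + 1 = a') (h : a + (q : ℤ) = i)
    (h' : a' + (q : ℤ) = i') (l : ℕ) (g : Fin l → Fin n) :
    M.component ⟨(q, a'), h'⟩ (M.BD n i i' x) l g =
      ((((coindIter k q).obj M).obj (op (Sur.of (Fin l)))).d a a').hom
        (M.component ⟨(q, a), h⟩ x l g) :=
  cobarTot_d_apply hi (hx (Set.range g) trivial) a a' ha h h' l (surRange g)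

theorem isCompleteFiltration_harrison (n : ℕ) (i : ℤ) : IsCompleteFiltration fun q =>
    (M.BFiltration n i q).comap (harrison (((B k).obj M.cobarTot).deg i) n).subtype := by
  have hB : IsCompleteFiltration (M.BFiltration n i) :=
    IsCompleteFiltration.pi fun S => isCompleteFiltration_degreeFiltration _ _
  refine IsCompleteFiltration.comap_subtype (k := k) (E := M.cobarTot.BX (fin n) i)
    (ι := {w : List (Fin n) × List (Fin n) //
      w.1 ≠ [] ∧ w.2 ≠ [] ∧ (w.1 ++ w.2).Perm (List.finRange n)}) (E' := fun _ =>
      M.cobarTot.BX (fin n) i) hB (fun _ => hB)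
      (fun w => shuffleSumHom (((B k).obj M.cobarTot).deg i) n w.1.1 w.1.2) ?_ _ ?_
  · intro w q x hx
    rw [mem_BFiltration_iff] at hx ⊢
    intro p hp
    refine (map_shuffleSum_position (M.cobarComponent i p) n x _ _).trans ?_
    exact (congrArg (shuffleSumHom (coFun k (M.IterX p.1.1 p.1.2)) n w.1.1 w.1.2) (hx p hp)).trans
      (map_zero _)
  · intro x
    exact ⟨fun h w => h w.1.1 w.1.2 w.2.1 w.2.2.1 w.2.2.2, fun h s t hs ht hst =>
      h ⟨(s, t), hs, ht, hst⟩⟩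

theorem isCompleteFiltration_G (i : ℤ) : IsCompleteFiltration fun q =>
    (M.cobarFiltration (Sur.of (Fin 1)) i q).comap (M.cobarTot.GX i).subtype := by
  refine IsCompleteFiltration.comap_subtype (k := k) (E := M.CobarX (Sur.of (Fin 1)) i)
    (ι := Σ n : {n : ℕ // 1 < n}, (Sur.of (Fin n.1) ⟶ Sur.of (Fin 1)))
    (E' := fun f => M.CobarX (Sur.of (Fin f.1.1)) i)
    (F' := fun f => M.cobarFiltration (Sur.of (Fin f.1.1)) i)
    (isCompleteFiltration_degreeFiltration _ _)
    (fun f => isCompleteFiltration_degreeFiltration _ _)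
    (fun f => ((M.cobarTot.map f.2.op).f i).hom.toAddMonoidHom) ?_ _ ?_
  · intro f q x hx p hp
    funext l g
    exact congrFun (congrFun (hx p hp) l) _
  · intro x
    exact ⟨fun h f => h f.1.1 f.1.2 f.2, fun h n hn f => h ⟨⟨n, hn⟩, f⟩⟩

end Shsur

namespace Shsur

open FinPart Shpart

variable {k : Type u} [Field k] {M : Shsur k}

/-- The contraction of the Harrison complexes of the functors `coFun k V`, applied to the
components of an element of `B (cobarTot M)`. -/
noncomputable def cobarContr (n : ℕ) (i : ℤ)
    (b : harrison (((B k).obj M.cobarTot).deg i) (n + 2)) :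
    harrison (((B k).obj M.cobarTot).deg i) (n + 1) :=
  ⟨fun _ p l f => contrFun n (M.component p b.1) l fun z => (f.1 z).1,
    mem_harrison_of_component fun p => contrFun_mem_harrison n (M.component p b.1)⟩

/-- The projection of `B (cobarTot M) [1]` to `G (cobarTot M)`, which retains
the values on the map `[1] → [1]`. -/
noncomputable def cobarProj (i : ℤ) (b : M.cobarTot.BX (fin 1) i) : M.cobarTot.GX i :=
  ⟨fun p l f => if l = 1 then M.component p b l f.1 else 0, by
    intro n hn f
    funext p l g
    refine if_neg ?_
    rintro rfl
    have := Nat.card_le_card_of_surjective g.1 g.2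
    simp only [Nat.card_eq_fintype_card, Fintype.card_fin] at this
    omega⟩

theorem cobarProj_apply (i : ℤ) (b : M.cobarTot.BX (fin 1) i) (p : Bidegree i)
    (f : Sur.of (Fin 1) ⟶ Sur.of (Fin 1)) :
    ((cobarProj i b).1 : M.CobarX (Sur.of (Fin 1)) i) p 1 f = M.component p b 1 f.1 := rfl

theorem component_inclB (i : ℤ) (a : M.cobarTot.GX i) (p : Bidegree i) (l : ℕ)
    (f : Sur.of (Fin l) ⟶ Sur.of (Fin 1)) :
    M.component p (M.cobarTot.inclB i a.1) l f.1 = (a.1 : M.CobarX (Sur.of (Fin 1)) i) p l f := by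
  have h : Nonempty (Set.range f.1) := ⟨⟨_, (f.2 0).choose, rfl⟩⟩
  refine (congrFun (congrFun (congrFun (M.cobarTot.inclB_of_nonempty i a.1 _ h) p) l)
    (surRange f.1)).trans ?_
  exact congrArg (fun f => (a.1 : M.CobarX (Sur.of (Fin 1)) i) p l f)
    (Subtype.ext (funext fun _ => Subsingleton.elim (α := Fin 1) _ _))

theorem apply_eq_zero_of_mem_GX (i : ℤ) (a : M.cobarTot.GX i) (p : Bidegree i) (l : ℕ)
    (hl : l ≠ 1) (f : Sur.of (Fin l) ⟶ Sur.of (Fin 1)) :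
    (a.1 : M.CobarX (Sur.of (Fin 1)) i) p l f = 0 := by
  have hl' : 1 < l := by
    have := Nat.card_le_card_of_surjective f.1 f.2
    simp only [Nat.card_eq_fintype_card, Fintype.card_fin] at this
    omega
  exact congrFun (congrFun (congrFun (a.2 l hl' f) p) l) (𝟙 _)

theorem component_inclB_of_ne (i : ℤ) (a : M.cobarTot.GX i) (p : Bidegree i) (l : ℕ) (hl : l ≠ 1)
    (g : Fin l → Fin 1) : M.component p (M.cobarTot.inclB i a.1) l g = 0 := by
  by_cases hl0 : l = 0
  · subst hl0
    refine congrFun (congrFun (congrFun (M.cobarTot.inclB_of_isEmpty i a.1 (Set.range g) ?_) p) 0)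
      (surRange g)
    rintro ⟨_, z, _⟩
    exact z.elim0
  · exact (component_inclB i a p l ⟨g, fun y => ⟨⟨0, by omega⟩, Subsingleton.elim _ _⟩⟩).trans
      (apply_eq_zero_of_mem_GX i a p l hl _)

theorem component_inclB_cobarProj (i : ℤ) (b : M.cobarTot.BX (fin 1) i) (p : Bidegree i) :
    M.component p (M.cobarTot.inclB i (cobarProj i b).1) =
      fun l g => if l = 1 then M.component p b l g else 0 := by
  funext l g
  split_ifs with hl
  · subst hl
    exact (component_inclB i (cobarProj i b) p 1
      ⟨g, fun y => ⟨0, Subsingleton.elim (α := Fin 1) _ _⟩⟩).trans (cobarProj_apply i b p _)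
  · exact component_inclB_of_ne i (cobarProj i b) p l hl g

theorem component_inclB_eq_zero (i : ℤ) (a : M.cobarTot.GX i) (p : Bidegree i)
    (h : (a.1 : M.CobarX (Sur.of (Fin 1)) i) p = 0) :
    M.component p (M.cobarTot.inclB i a.1) = 0 := by
  funext l g
  by_cases hl : l = 1
  · subst hl
    exact (component_inclB i a p 1 ⟨g, fun y => ⟨0, Subsingleton.elim (α := Fin 1) _ _⟩⟩).trans
      (congrFun (congrFun h 1) _)
  · exact component_inclB_of_ne i a p l hl g

variable (M) in
/-- The filtration of `G (cobarTot M)` by the number of iterations of `coind`. -/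
def GFiltration (j : ℤ) (q : ℕ) : Submodule k (M.cobarTot.GX j) :=
  (M.cobarFiltration (Sur.of (Fin 1)) j q).comap (M.cobarTot.GX j).subtype

/-- The value on the generator `m_{n + 1}` of a cochain with values in `B (cobarTot M)`. -/
noncomputable def coeff {j : ℤ} (n : ℕ) (i : ℤ) (h : i + (n : ℤ) = j) :
    ((B k).obj M.cobarTot).HX j →ₗ[k] M.cobarTot.BX (fin (n + 1)) i :=
  (harrison (((B k).obj M.cobarTot).deg i) (n + 1)).subtype ∘ₗ
    LinearMap.proj (R := k) (φ := fun r : Bidegree j =>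
      harrison (((B k).obj M.cobarTot).deg r.1.2) (r.1.1 + 1)) (⟨(n, i), h⟩ : Bidegree j)

theorem coeff_HD_zero (j j' i i' : ℤ) (hj : j + 1 = j') (hi : i + 1 = i')
    (h : i + ((0 : ℕ) : ℤ) = j) (h' : i' + ((0 : ℕ) : ℤ) = j') (φ : ((B k).obj M.cobarTot).HX j) :
    coeff 0 i' h' (((B k).obj M.cobarTot).HD j j' hj φ) = M.BD (0 + 1) i i' (coeff 0 i h φ) :=
  congrArg Subtype.val (HD_apply_zero _ j j' i i' hj hi h h' φ)

theorem coeff_HD_succ (j j' i i' : ℤ) (hj : j + 1 = j') (hi : i + 1 = i') (n : ℕ)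
    (h : i + ((n + 1 : ℕ) : ℤ) = j) (h' : i' + ((n + 1 : ℕ) : ℤ) = j') (h'' : i' + (n : ℤ) = j)
    (φ : ((B k).obj M.cobarTot).HX j) :
    coeff (n + 1) i' h' (((B k).obj M.cobarTot).HD j j' hj φ) =
      M.BD (n + 1 + 1) i i' (coeff (n + 1) i h φ) + (j.negOnePow : ℤ) •
        M.BHochschild (n + 1) i' (coeff n i' h'' φ) :=
  congrArg Subtype.val (HD_apply_succ _ j j' i i' hj hi n h h' h'' φ)

theorem coeff_iotaX_zero (j : ℤ) (h : j + ((0 : ℕ) : ℤ) = j) (a : M.cobarTot.GX j) :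
    coeff 0 j h (M.cobarTot.iotaX j a) = M.cobarTot.inclB j a.1 := rfl

theorem coeff_iotaX_succ (j : ℤ) (n : ℕ) (i : ℤ) (h : i + ((n + 1 : ℕ) : ℤ) = j)
    (a : M.cobarTot.GX j) : coeff (n + 1) i h (M.cobarTot.iotaX j a) = 0 := rfl

variable (M) in
/-- The filtration of `H (cobarTot M)` by the number of iterations of `coind`. -/
noncomputable def HFiltration (j : ℤ) (q : ℕ) : Submodule k (((B k).obj M.cobarTot).HX j) :=
  Submodule.pi Set.univ fun r => (M.BFiltration (r.1.1 + 1) r.1.2 q).comap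
    (harrison (((B k).obj M.cobarTot).deg r.1.2) (r.1.1 + 1)).subtype

theorem mem_HFiltration {j : ℤ} {q : ℕ} {φ : ((B k).obj M.cobarTot).HX j} :
    φ ∈ M.HFiltration j q ↔ ∀ n i h, coeff n i h φ ∈ M.BFiltration (n + 1) i q :=
  ⟨fun h n i hi => h ⟨(n, i), hi⟩ trivial, fun h r _ => h r.1.1 r.1.2 r.2⟩

theorem BHochschild_mem_BFiltration {i : ℤ} {n q : ℕ} {x : M.cobarTot.BX (fin n) i}
    (hx : x ∈ M.BFiltration n i q) : M.BHochschild n i x ∈ M.BFiltration (n + 1) i q := by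
  rw [mem_BFiltration_iff] at hx ⊢
  intro p hp
  rw [component_BHochschild, hx p hp, ← hochschild_coFun (k := k)]
  exact map_zero _

theorem HD_mem_HFiltration {j j' : ℤ} (hj : j + 1 = j') {q : ℕ} {φ : ((B k).obj M.cobarTot).HX j}
    (hφ : φ ∈ M.HFiltration j q) : ((B k).obj M.cobarTot).HD j j' hj φ ∈ M.HFiltration j' q := by
  rw [mem_HFiltration] at hφ ⊢
  intro n i h
  match n with
  | 0 =>
    rw [coeff_HD_zero j j' (i - 1) i hj (by omega) (by omega) h]
    exact BD_mem (by omega) (hφ _ _ _)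
  | n + 1 =>
    rw [coeff_HD_succ j j' (i - 1) i hj (by omega) n (by omega) h (by push_cast at h; omega)]
    exact Submodule.add_mem _ (BD_mem (by omega) (hφ _ _ _))
      (zsmul_mem (BHochschild_mem_BFiltration (hφ _ _ _)) _)

theorem iotaX_mem_HFiltration {j : ℤ} {q : ℕ} {a : M.cobarTot.GX j} (ha : a ∈ M.GFiltration j q) :
    M.cobarTot.iotaX j a ∈ M.HFiltration j q := by
  rw [mem_HFiltration]
  intro n i h
  match n with
  | 0 =>
    obtain rfl : j = i := by simpa using h.symm
    exact mem_BFiltration_iff.2 fun p hp => component_inclB_eq_zero j a p (ha p hp)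
  | n + 1 => exact Submodule.zero_mem _

theorem coHochschild_zsmul (i : ℤ) (p : Bidegree i) (n : ℕ) (z : ℤ)
    (c : CoFam (M.IterX p.1.1 p.1.2) n) : coHochschild n (z • c) = z • coHochschild n c := by
  rw [← hochschild_coFun (k := k), ← hochschild_coFun (k := k)]
  exact map_zsmul _ z c

/-- The contraction, applied to the values of a cochain. It lowers the degree by one. -/
noncomputable def contrH {j : ℤ} (b : ((B k).obj M.cobarTot).HX j) :
    ((B k).obj M.cobarTot).HX (j - 1) := fun r => -((j.negOnePow : ℤ) •
  cobarContr r.1.1 r.1.2 (b ⟨(r.1.1 + 1, r.1.2), by have := r.2; push_cast; omega⟩))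

theorem component_coeff_contrH {j : ℤ} (b : ((B k).obj M.cobarTot).HX j) (n : ℕ) (i : ℤ)
    (h : i + (n : ℤ) = j - 1) (h' : i + ((n + 1 : ℕ) : ℤ) = j) (p : Bidegree i) :
    M.component p (coeff n i h (contrH b)) =
      -((j.negOnePow : ℤ) • contrFun n (M.component p (coeff (n + 1) i h' b))) := by
  let x : M.cobarTot.BX (fin (n + 1)) i := (cobarContr n i (b ⟨(n + 1, i), h'⟩)).1
  have h1 : coeff n i h (contrH b) = -((j.negOnePow : ℤ) • x) := rfl
  rw [h1, map_neg, map_zsmul]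
  rfl

theorem contrFun_fam_zero {V : ℕ → Type u} [∀ l, AddCommGroup (V l)] (n : ℕ) :
    contrFun n (0 : CoFam V (n + 2)) = 0 := by
  have := contrFun_zsmul (V := V) n 0 0
  rwa [zero_smul, zero_smul] at this

theorem contrH_mem_HFiltration {j : ℤ} {q : ℕ} {b : ((B k).obj M.cobarTot).HX j}
    (hb : b ∈ M.HFiltration j q) : contrH b ∈ M.HFiltration (j - 1) q := by
  rw [mem_HFiltration] at hb ⊢
  intro n i h
  refine mem_BFiltration_iff.2 fun p hp => ?_
  have h' : i + ((n + 1 : ℕ) : ℤ) = j := by push_cast; omega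
  rw [component_coeff_contrH b n i h h', mem_BFiltration_iff.1 (hb _ _ h') p hp,
    contrFun_fam_zero, smul_zero, neg_zero]

variable (M) in
/-- The differential of `G (cobarTot M)`. -/
def GD (j : ℤ) : M.cobarTot.GX j →ₗ[k] M.cobarTot.GX (j + 1) :=
  (M.cobarTot.GObj.d j (j + 1)).hom

theorem GD_mem_GFiltration {j : ℤ} {q : ℕ} {a : M.cobarTot.GX j} (ha : a ∈ M.GFiltration j q) :
    M.GD j a ∈ M.GFiltration (j + 1) q :=
  cobarTot_d_mem rfl ha

theorem cobarProj_mem_GFiltration {j : ℤ} {q : ℕ} {b : M.cobarTot.BX (fin 1) j}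
    (hb : b ∈ M.BFiltration 1 j q) : cobarProj j b ∈ M.GFiltration j q := by
  rw [mem_BFiltration_iff] at hb
  intro p hp
  funext l f
  change (if l = 1 then M.component p b l f.1 else 0) = 0
  rw [hb p hp]
  exact ite_self _

/-- The cone of the inclusion `G (cobarTot M) → H (cobarTot M)` is acyclic up to terms of higher
filtration, since the differentials of the cobar complex are of filtration one, and the
contraction of the Harrison complexes is compatible with the remaining differentials. -/
theorem exists_approximation [CharZero k] {j : ℤ} {q : ℕ} (a : M.cobarTot.GX (j + 1))
    (b : ((B k).obj M.cobarTot).HX j) (ha : a ∈ M.GFiltration (j + 1) q)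
    (hb : b ∈ M.HFiltration j q)
    (hab' : M.cobarTot.iotaX (j + 1) a = ((B k).obj M.cobarTot).HD j (j + 1) rfl b) :
    ∃ a' ∈ M.GFiltration j q, ∃ b' ∈ M.HFiltration (j - 1) q,
      a - M.GD j a' ∈ M.GFiltration (j + 1) (q + 1) ∧
      b - (M.cobarTot.iotaX j a' + ((B k).obj M.cobarTot).HD (j - 1) j (by omega) b') ∈
        M.HFiltration j (q + 1) := by
  have hbm := mem_HFiltration.1 hb
  have h00 : j + ((0 : ℕ) : ℤ) = j := by simp
  have hb0 : M.cobarTot.inclB (j + 1) a.1 = M.BD (0 + 1) j (j + 1) (coeff 0 j h00 b) := by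
    rw [← coeff_HD_zero j (j + 1) j (j + 1) rfl rfl h00 (by simp), ← hab']
    rfl
  have hbs : ∀ (n : ℕ) (i i' : ℤ) (hi : i + 1 = i') (h : i + ((n + 1 : ℕ) : ℤ) = j)
      (h' : i' + (n : ℤ) = j) (c c' : ℤ) (hc : c + 1 = c') (hp : c + (q : ℤ) = i)
      (hp' : c' + (q : ℤ) = i'), (fun l g => ((((coindIter k q).obj M).obj
        (op (Sur.of (Fin l)))).d c c').hom (M.component ⟨(q, c), hp⟩ (coeff (n + 1) i h b) l g)) =
      -((j.negOnePow : ℤ) • coHochschild (n + 1)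
        (M.component ⟨(q, c'), hp'⟩ (coeff n i' h' b))) := by
    intro n i i' hi h h' c c' hc hp hp'
    have h2 := congrArg (fun φ => M.component ⟨(q, c'), hp'⟩
      (coeff (n + 1) i' (by push_cast at h ⊢; omega) φ)) hab'
    simp only [coeff_iotaX_succ, map_zero] at h2
    rw [coeff_HD_succ j (j + 1) i i' rfl hi n h _ h', map_add, map_zsmul, component_BHochschild]
      at h2
    refine Eq.trans (funext fun l => funext fun g => ?_) (eq_neg_of_add_eq_zero_left h2.symm)
    exact (component_BD hi (hbm (n + 1) i h) c c' hc hp hp' l g).symm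
  have hb' := contrH_mem_HFiltration hb
  have hdb' : ∀ (n : ℕ) (i i' : ℤ) (hi : i + 1 = i') (h : i + (n : ℤ) = j - 1)
      (h' : i' + (n : ℤ) = j) (c : ℤ) (hp : c + (q : ℤ) = i'),
      M.component ⟨(q, c), hp⟩ (M.BD (n + 1) i i' (coeff n i h (contrH b))) =
        contrFun n (coHochschild (n + 1) (M.component ⟨(q, c), hp⟩ (coeff n i' h' b))) := by
    intro n i i' hi h h' c hp
    have hs : i + ((n + 1 : ℕ) : ℤ) = j := by push_cast; omega
    have hp' : c - 1 + (q : ℤ) = i := by omega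
    have h3 := hbs n i i' hi hs h' (c - 1) c (by omega) hp' hp
    funext l g
    rw [component_BD hi (mem_HFiltration.1 hb' n i h) (c - 1) c (by omega) hp' hp,
      component_coeff_contrH b n i h hs]
    let d := fun l => ((((coindIter k q).obj M).obj (op (Sur.of (Fin l)))).d (c - 1) c).hom
    refine (map_neg (d l) _).trans ?_
    refine (congrArg Neg.neg (map_zsmul (d l) (j.negOnePow : ℤ) _)).trans ?_
    refine (congrArg (fun y => -((j.negOnePow : ℤ) • y)) (map_contrFun (fun l =>
      (d l).toAddMonoidHom) n (M.component ⟨(q, c - 1), hp'⟩ (coeff (n + 1) i hs b)) l g)).trans ?_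
    refine (congrArg (fun y => -((j.negOnePow : ℤ) • contrFun n y l g)) h3).trans ?_
    rw [← neg_smul, ← neg_smul, contrFun_zsmul]
    change -(j.negOnePow : ℤ) • -(j.negOnePow : ℤ) • contrFun n (coHochschild (n + 1)
      (M.component ⟨(q, c), hp⟩ (coeff n i' h' b))) l g = _
    rw [neg_smul, neg_smul, smul_neg, neg_neg, negOnePow_smul_smul]
  have ha' := cobarProj_mem_GFiltration (hbm 0 j h00)
  have hc := Submodule.sub_mem _ hb (Submodule.add_mem _ (iotaX_mem_HFiltration ha')
    (HD_mem_HFiltration (show j - 1 + 1 = j by omega) hb'))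
  refine ⟨cobarProj j (coeff 0 j h00 b), ha', contrH b, hb', ?_, ?_⟩
  · refine mem_cobarFiltration_succ (Submodule.sub_mem _ ha (GD_mem_GFiltration ha'))
      fun c hp => ?_
    funext l f
    have hp' : c - 1 + (q : ℤ) = j := by omega
    have h1 : (((M.GD j (cobarProj j (coeff 0 j h00 b))).1 :
        M.CobarX (Sur.of (Fin 1)) (j + 1))) ⟨(q, c), hp⟩ l f = _ :=
      cobarTot_d_apply rfl ha' (c - 1) c (by omega) hp' hp l f
    refine sub_eq_zero.2 (Eq.trans ?_ h1.symm)
    by_cases hl : l = 1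
    · subst hl
      refine (component_inclB (j + 1) a ⟨(q, c), hp⟩ 1 f).symm.trans ?_
      rw [hb0]
      exact component_BD rfl (hbm 0 j h00) (c - 1) c (by omega) hp' hp 1 f.1
    · refine (apply_eq_zero_of_mem_GX (j + 1) a _ l hl f).trans ?_
      refine ((congrArg (((((coindIter k q).obj M).obj (op (Sur.of (Fin l)))).d (c - 1) c).hom)
        (apply_eq_zero_of_mem_GX j (cobarProj j (coeff 0 j h00 b)) ⟨(q, c - 1), hp'⟩ l hl f)).trans
          (map_zero _)).symm
  · rw [mem_HFiltration] at hc ⊢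
    intro n i h
    refine mem_BFiltration_succ (hc n i h) fun c hp => ?_
    match n with
    | 0 =>
      obtain rfl : j = i := by simpa using h.symm
      rw [map_sub, map_add, map_sub, map_add, coeff_iotaX_zero,
        coeff_HD_zero (j - 1) j (j - 1) j (by omega) (by omega) (by simp) h,
        hdb' 0 (j - 1) j (by omega) (by simp) h c hp, sub_eq_zero]
      refine Eq.trans ?_ (congrArg₂ (· + ·) (component_inclB_cobarProj j (coeff 0 j h00 b) _).symm
        (contr_homotopy_zero (M.component ⟨(q, c), hp⟩ (coeff 0 j h00 b))).symm)
      funext l g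
      rw [Pi.add_apply, Pi.add_apply]
      dsimp only
      split_ifs
      · exact (add_zero _).symm
      · exact (zero_add _).symm
    | n + 1 =>
      have h2 : i - 1 + ((n + 1 : ℕ) : ℤ) = j - 1 := by omega
      have h3 : i + (n : ℤ) = j - 1 := by push_cast at h; omega
      rw [map_sub, map_add, map_sub, map_add, coeff_iotaX_succ, map_zero, zero_add,
        coeff_HD_succ (j - 1) j (i - 1) i (by omega) (by omega) n h2 h h3, map_add, map_zsmul,
        component_BHochschild, hdb' (n + 1) (i - 1) i (by omega) h2 h c hp,
        component_coeff_contrH b n i h3 h, sub_eq_zero]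
      refine (contr_homotopy n (M.component ⟨(q, c), hp⟩ (coeff (n + 1) i h b)) (component_mem_harrison (b ⟨(n + 1, i), h⟩).2 _)).symm.trans ?_
      refine (add_comm _ _).trans (congrArg (_ + ·) ?_)
      rw [← neg_smul, coHochschild_zsmul, neg_smul, smul_neg,
        ← negOnePow_smul_of_add_one_eq (show j - 1 + 1 = j by omega), negOnePow_smul_smul]

variable (M) in
/-- The functor `coind M'` is such that `B (coind M')` is of the form `coFun k V` with `V l = M' [l]`,
whose Harrison complex is a resolution of `V 1`, the value of `G` on `coind M'`. -/
theorem quasiIso_iota_cobarTot [CharZero k] : QuasiIso ((iota k).app M.cobarTot) := by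
  refine quasiIso_of_filtration ((iota k).app M.cobarTot) M.GFiltration M.HFiltration
    (fun j => isCompleteFiltration_G j)
    (fun j => IsCompleteFiltration.pi fun r => isCompleteFiltration_harrison _ _)
    (fun j x p hp => absurd hp (Nat.not_lt_zero _))
    (fun j x => mem_HFiltration.2 fun _ _ _ => mem_BFiltration_iff.2 fun p hp =>
      absurd hp (Nat.not_lt_zero _))
    (fun j q x hx => cobarTot_d_mem rfl hx)
    (fun i j q x hij hx => (HObj_d_apply _ i j hij x).symm ▸ HD_mem_HFiltration hij hx)
    (fun j q x hx => iotaX_mem_HFiltration hx) ?_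
  intro j q a b ha hb _ hab
  obtain ⟨a', ha', b', hb', h1, h2⟩ := exists_approximation a b ha hb
    (hab.trans (HObj_d_apply _ j (j + 1) rfl b))
  refine ⟨a', ha', b', hb', h1, ?_⟩
  exact (HObj_d_apply ((B k).obj M.cobarTot) (j - 1) j (by omega) b').symm ▸ h2

end Shsur

/-! ### The right derived functor of `G` -/

namespace Shsur

variable (k : Type u) [Field k]

instance : (quasiIso k).IsMultiplicative where
  id_mem _ _ := inferInstanceAs (QuasiIso (𝟙 _))
  comp_mem f g hf hg X :=
    have := hf X
    have := hg X
    inferInstanceAs (QuasiIso (f.app X ≫ g.app X))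

instance : (quasiIso k).HasTwoOutOfThreeProperty where
  of_postcomp f g hg hfg X :=
    have := hg X
    have : QuasiIso (f.app X ≫ g.app X) := hfg X
    quasiIso_of_comp_right (f.app X) (g.app X)
  of_precomp f g hf hfg X :=
    have := hf X
    have : QuasiIso (f.app X ≫ g.app X) := hfg X
    quasiIso_of_comp_left (f.app X) (g.app X)

/-- The functors `M` for which `i : G M → H M` is a quasi-isomorphism. -/
def acyclic : ObjectProperty (Shsur k) := fun M => QuasiIso ((iota k).app M)

/-- The inclusion of the full subcategory of the functors `M` for which `i : G M → H M` is a
quasi-isomorphism. -/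
def acyclicInclusion : LocalizerMorphism ((quasiIso k).inverseImage (acyclic k).ι) (quasiIso k) where
  functor := (acyclic k).ι
  map _ _ _ h := h

/-- The cobar resolutions are functorial resolutions by objects of the subcategory. -/
theorem isRightDerivabilityStructure_acyclicInclusion [CharZero k] :
    (acyclicInclusion k).IsRightDerivabilityStructure := by
  have : (acyclicInclusion k).functor.Full := inferInstanceAs (acyclic k).ι.Full
  have : (acyclicInclusion k).functor.Faithful := inferInstanceAs (acyclic k).ι.Faithful
  exact (acyclicInclusion k).isRightDerivabilityStructure_of_functorial_resolutions
    (ρ := (acyclic k).lift (cobarResolution k) fun M => M.quasiIso_iota_cobarTot)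
    (cobarUnit k) quasiIso_cobarUnit rfl

variable {k}

/-- On the subcategory, `G` is quasi-isomorphic to `H`, which preserves quasi-isomorphisms. -/
theorem derives_G [CharZero k] [HasDerivedCategory.{w} (ModuleCat.{u} k)] :
    (acyclicInclusion k).Derives (G k ⋙ DerivedCategory.Q) := by
  intro M N τ hτ
  have hM : QuasiIso ((iota k).app M.obj) := M.property
  have hN : QuasiIso ((iota k).app N.obj) := N.property
  have hH : QuasiIso ((H k).map τ.hom) := quasiIso_H_map τ.hom hτ
  have hcomp : QuasiIso ((G k).map τ.hom ≫ (iota k).app N.obj) := by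
    rw [(iota k).naturality]
    infer_instance
  have hG : QuasiIso ((G k).map τ.hom) :=
    quasiIso_of_comp_right _ ((iota k).app N.obj)
  exact Localization.inverts DerivedCategory.Q (HomologicalComplex.quasiIso _ _) _ hG

end Shsur

theorem corollary6p5 {k : Type u} [Field k] [CharZero k] [HasDerivedCategory.{w} (ModuleCat.{u} k)]
    {D : Type*} [Category* D] (L : Shsur k ⥤ D) [L.IsLocalization (Shsur.quasiIso k)] :
    ∃ hH : (Shsur.quasiIso k).IsInvertedBy (Shsur.H k ⋙ DerivedCategory.Q),
      (Localization.lift (Shsur.H k ⋙ DerivedCategory.Q) hH L).IsRightDerivedFunctor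
        (Functor.whiskerRight (Shsur.iota k) DerivedCategory.Q ≫
          (Localization.fac (Shsur.H k ⋙ DerivedCategory.Q) hH L).inv)
        (Shsur.quasiIso k) := by
  have hH : (Shsur.quasiIso k).IsInvertedBy (Shsur.H k ⋙ DerivedCategory.Q) := fun M N τ hτ =>
    Localization.inverts DerivedCategory.Q (HomologicalComplex.quasiIso _ _) _
      (Shsur.quasiIso_H_map τ hτ)
  refine ⟨hH, ?_⟩
  have := Shsur.isRightDerivabilityStructure_acyclicInclusion k
  refine Shsur.derives_G.isRightDerivedFunctor_of_isIso _ fun M => ?_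
  have hM : QuasiIso ((Shsur.iota k).app M.obj) := M.property
  have : IsIso (DerivedCategory.Q.map ((Shsur.iota k).app M.obj)) :=
    Localization.inverts DerivedCategory.Q (HomologicalComplex.quasiIso _ _) _ hM
  rw [NatTrans.comp_app]
  exact IsIso.comp_isIso' this inferInstance
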